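/- Let $\mathcal X,\mathcal Y,\mathcal Z,\hat{\mathcal X}$ be finite non-empty alphabets, $P_X$ a distribution on $\mathcal X$, $P_{Y|X}$ and $P_{Z|X}$ channels, $P_{XYZ}=P_XP_{Y|X}P_{Z|X}$, and $d:\mathcal X\times\hat{\mathcal X}\to[0,\infty)$ a distortion measure, with $d(x^n,\hat x^n)=\frac1n\sum_{i=1}^n d(x_i,\hat x_i)$. Write $\bar a=1-a$; all logarithms are natural. **Rate-distortion region.** A code of blocklength $n$ consists of integers $M,L\ge1$ and functions $f:\mathcal Y^n\to\{1,\dots,L\}$, $g:\{1,\dots,L\}^M\times\mathcal Z^n\to\{1,\dots,M\}$, $h:\{1,\dots,L\}\times\mathcal Z^n\to\hat{\mathcal X}^n$. Let the pairs $(X^n(m),Y^n(m))$, $1\le m\le M$, be independent and i.i.d. $\sim P_XP_{Y|X}$ over time, let $W$ be uniform on $\{1,\dots,M\}$ and independent of them, let $Z^n$ be the output of the memoryless channel $P_{Z|X}$ with input $X^n(W)$, and put $S(m)=f(Y^n(m))$, $\hat W=g(S(1),\dots,S(M),Z^n)$, $\hat X^n=h(S(\hat W),Z^n)$ and $\mathrm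 P_{\mathrm e}^{(n)}(D)=\Pr\{\hat W\ne W\text{ or }d(X^n(W),\hat X^n)>D\}$. A triple $(R^{\mathrm i},R^{\mathrm c},D)\in\mathbb R^3$ is $\varepsilon$-achievable if there is a sequence of codes with $\liminf_n\frac1n\log M\ge R^{\mathrm i}$, $\limsup_n\frac1n\log L\le R^{\mathrm c}$ and $\limsup_n\mathrm P_{\mathrm e}^{(n)}(D)\le\varepsilon$. Let $\mathcal R(\varepsilon)$ be the closure of the set of $\varepsilon$-achievable triples and $\mathcal R=\bigcap_{\varepsilon\in(0,1)}\mathcal R(\varepsilon)$. **Exponent function.** Let $\mathcal Q$ be the set of all joint distributions $Q=Q_{XYZU\hat X}$ on $\mathcal X\times\mathcal Y\times\mathcal Z\times\mathcal U\times\hat{\mathcal X}$ with $|\mathcal U|\le|\mathcal X||\mathcal Y||\mathcal Z||\hat{\mathcal X}|$. For $\alpha,\theta>0$, $\mu,\beta\in[0,1]$ and $Q\in\mathcal Q$, define on the support of $Q$ $$\begin{aligned}\omega_Q^{(\alpha,\mu,\beta)}(x,y,z,\hat x|u)={}&\log\frac{Q_Y(y)}{P_Y(y)}+\log\frac{Q_{Z|YU}(z|y,u)}{P_{Z|Y}(z|y)}+\log\frac{Q_{X|YZU}(x|y,z,u)}{P_{X|YZ}(x|y,z)}+\log\frac{Q_{XY|ZU\hat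 X}(x,y|z,u,\hat x)}{Q_{XY|ZU}(x,y|z,u)}\\&+\alpha\Big(\bar\mu\bar\beta\log\frac{Q_{YZ|U}(y,z|u)}{P_{YZ}(y,z)}+\bar\mu\log\frac{Q_Z(z)}{Q_{Z|U}(z|u)}+\mu\,d(x,\hat x)\Big),\end{aligned}$$ with $\omega=+\infty$ where $P_{XYZ}(x,y,z)=0$. Let $$\Omega^{(\alpha,\mu,\beta,\theta)}(Q)=-\log\mathbb E_Q\big[\exp(-\theta\,\omega_Q^{(\alpha,\mu,\beta)}(X,Y,Z,\hat X|U))\big],\qquad\Omega^{(\alpha,\mu,\beta,\theta)}=\inf_{Q\in\mathcal Q}\Omega^{(\alpha,\mu,\beta,\theta)}(Q),$$ $$F(R^{\mathrm i},R^{\mathrm c},D)=\sup_{\alpha,\theta>0,\ \mu,\beta\in[0,1]}\frac{\Omega^{(\alpha,\mu,\beta,\theta)}-\theta\alpha\big(\bar\mu(\bar\beta R^{\mathrm c}-R^{\mathrm i})+\mu D\big)}{1+5\theta+\theta\alpha\bar\mu(3-\beta)},$$ the infimum and the supremum being taken in $[-\infty,+\infty]$. **Statement.** For all real $R^{\mathrm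 i}\ge0$, $R^{\mathrm c}$ and $D$: i) if $(R^{\mathrm i},R^{\mathrm c},D)\notin\mathcal R$, then $F(R^{\mathrm i},R^{\mathrm c},D)>0$; ii) if $(R^{\mathrm i},R^{\mathrm c},D)\in\mathcal R$, then $F(R^{\mathrm i},R^{\mathrm c},D)=0$. -/

import Mathlib

open Filter Topology
open scoped ENNReal

noncomputable section

namespace ContentId

/-! ### Finite probability -/

open Classical in
/-- For a mass function `Q` on a finite set `T` and a random variable `f : T → A`, the probability
`Q {f = a}`. -/
def law {T A : Type*} [Fintype T] (Q : T → ℝ) (f : T → A) (a : A) : ℝ :=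
  ∑ t, if f t = a then Q t else 0

/-- The conditional probability `Q (f = a | g = b)` (with value `0` if `Q (g = b) = 0`). -/
def condLaw {T A B : Type*} [Fintype T] (Q : T → ℝ) (f : T → A) (g : T → B) (a : A) (b : B) : ℝ :=
  law Q (fun t => (f t, g t)) (a, b) / law Q g b

/-- `log (a / b)` for `a, b ≥ 0`, with value `+∞` if `a > 0 = b`. -/
def logRatio (a b : ℝ) : EReal := ENNReal.log (ENNReal.ofReal a / ENNReal.ofReal b)

/-- The joint mass function `P_XYZ = P_X × P_{Y|X} × P_{Z|X}`. -/
def jointXYZ {X Y Z : Type*} (PX : X → ℝ) (PYX : X → Y → ℝ) (PZX : X → Z → ℝ) :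
    X × Y × Z → ℝ :=
  fun t => PX t.1 * PYX t.1 t.2.1 * PZX t.1 t.2.2

/-! ### Codes and the operational rate-distortion region -/

/-- A code of blocklength `n` for content identification with lossy recovery. `M` is the number of
items, `L` the number of codewords, `f` the encoder of the enrollment phase, `g` the identification
function and `h` the reproduction function. -/
structure Code (Y Z Xh : Type*) (n : ℕ) where
  M : ℕ
  L : ℕ
  M_pos : 0 < M
  L_pos : 0 < L
  f : (Fin n → Y) → Fin L
  g : (Fin M → Fin L) → (Fin n → Z) → Fin M
  h : Fin L → (Fin n → Z) → (Fin n → Xh)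

/-- The per-letter distortion between two sequences. -/
def blockDist {X Xh : Type*} (d : X → Xh → ℝ) {n : ℕ} (x : Fin n → X) (xh : Fin n → Xh) : ℝ :=
  (1 / (n : ℝ)) * ∑ i, d (x i) (xh i)

open Classical in
/-- The joint identification-error and excess-distortion probability
`Pr (Ŵ ≠ W or d (X^n(W), X̂^n) > D)`. Here `W = w` is uniform on the `M` items,
`x m` and `y m` are the feature vector of item `m` and its noisy version, `z` is the output of the
channel `P_{Z|X}` on input `x w`, `Ŵ = g (S(1), …, S(M), z)` with `S(m) = f (y m)`, and
`X̂^n = h (S(Ŵ), z)`. -/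
def errProb {X Y Z Xh : Type*} [Fintype X] [Fintype Y] [Fintype Z]
    (PX : X → ℝ) (PYX : X → Y → ℝ) (PZX : X → Z → ℝ) (d : X → Xh → ℝ) (D : ℝ)
    {n : ℕ} (C : Code Y Z Xh n) : ℝ :=
  ∑ w : Fin C.M, (1 / (C.M : ℝ)) *
    ∑ x : Fin C.M → Fin n → X, ∑ y : Fin C.M → Fin n → Y, ∑ z : Fin n → Z,
      (∏ m, ∏ i, PX (x m i) * PYX (x m i) (y m i)) * (∏ i, PZX (x w i) (z i)) *
        (let wh := C.g (fun m => C.f (y m)) z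
         if wh ≠ w ∨ D < blockDist d (x w) (C.h (C.f (y wh)) z) then 1 else 0)

/-- The triple `r = (Rⁱ, Rᶜ, D)` is `ε`-achievable. -/
def Achievable {X Y Z Xh : Type*} [Fintype X] [Fintype Y] [Fintype Z]
    (PX : X → ℝ) (PYX : X → Y → ℝ) (PZX : X → Z → ℝ) (d : X → Xh → ℝ)
    (ε : ℝ) (r : ℝ × ℝ × ℝ) : Prop :=
  ∃ C : ∀ n : ℕ, Code Y Z Xh n,
    (r.1 : EReal) ≤ liminf (fun n : ℕ => ((1 / (n : ℝ) * Real.log (C n).M : ℝ) : EReal)) atTop ∧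
    limsup (fun n : ℕ => ((1 / (n : ℝ) * Real.log (C n).L : ℝ) : EReal)) atTop ≤ (r.2.1 : EReal) ∧
    limsup (fun n : ℕ => ((errProb PX PYX PZX d r.2.2 (C n) : ℝ) : EReal)) atTop ≤ (ε : EReal)

/-- The `ε`-rate-distortion region: the closure of the set of `ε`-achievable triples. -/
def epsRegion {X Y Z Xh : Type*} [Fintype X] [Fintype Y] [Fintype Z]
    (PX : X → ℝ) (PYX : X → Y → ℝ) (PZX : X → Z → ℝ) (d : X → Xh → ℝ) (ε : ℝ) :
    Set (ℝ × ℝ × ℝ) :=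
  closure {r | Achievable PX PYX PZX d ε r}

/-- The rate-distortion region: the intersection of the `ε`-regions over `ε ∈ (0, 1)`. -/
def region {X Y Z Xh : Type*} [Fintype X] [Fintype Y] [Fintype Z]
    (PX : X → ℝ) (PYX : X → Y → ℝ) (PZX : X → Z → ℝ) (d : X → Xh → ℝ) :
    Set (ℝ × ℝ × ℝ) :=
  ⋂ ε ∈ Set.Ioo (0 : ℝ) 1, epsRegion PX PYX PZX d ε

/-! ### The exponent function -/

section Exponent

variable {X Y Z Xh U : Type*} [Fintype X] [Fintype Y] [Fintype Z] [Fintype Xh] [Fintype U]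

/-- The linear combination `ω` of log-likelihood ratios, for a joint mass function `Q` of
`(X, Y, Z, U, X̂)`, at a point `t = (x, y, z, u, x̂)`. It is only used at points with `Q t > 0`;
there every numerator is positive, so every summand lies in `(-∞, +∞]`, and `ω = +∞` exactly if
`P_XYZ (x, y, z) = 0`. -/
def omega (PX : X → ℝ) (PYX : X → Y → ℝ) (PZX : X → Z → ℝ) (d : X → Xh → ℝ)
    (α μ β : ℝ) (Q : X × Y × Z × U × Xh → ℝ) (t : X × Y × Z × U × Xh) : EReal :=
  let P : X × Y × Z → ℝ := jointXYZ PX PYX PZX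
  let pX : X × Y × Z → X := fun s => s.1
  let pY : X × Y × Z → Y := fun s => s.2.1
  let pZ : X × Y × Z → Z := fun s => s.2.2
  let qX : X × Y × Z × U × Xh → X := fun s => s.1
  let qY : X × Y × Z × U × Xh → Y := fun s => s.2.1
  let qZ : X × Y × Z × U × Xh → Z := fun s => s.2.2.1
  let qU : X × Y × Z × U × Xh → U := fun s => s.2.2.2.1
  let qXh : X × Y × Z × U × Xh → Xh := fun s => s.2.2.2.2
  let x := qX t
  let y := qY t
  let z := qZ t
  let u := qU t
  let xh := qXh t
  logRatio (law Q qY y) (law P pY y)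
  + logRatio (condLaw Q qZ (fun s => (qY s, qU s)) z (y, u)) (condLaw P pZ pY z y)
  + logRatio (condLaw Q qX (fun s => (qY s, qZ s, qU s)) x (y, z, u))
      (condLaw P pX (fun s => (pY s, pZ s)) x (y, z))
  + logRatio
      (condLaw Q (fun s => (qX s, qY s)) (fun s => (qZ s, qU s, qXh s)) (x, y) (z, u, xh))
      (condLaw Q (fun s => (qX s, qY s)) (fun s => (qZ s, qU s)) (x, y) (z, u))
  + (α : EReal) *
    ((((1 - μ) * (1 - β) : ℝ) : EReal) *
        logRatio (condLaw Q (fun s => (qY s, qZ s)) qU (y, z) u)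
          (law P (fun s => (pY s, pZ s)) (y, z))
      + ((1 - μ : ℝ) : EReal) * logRatio (law Q qZ z) (condLaw Q qZ qU z u)
      + ((μ * d x xh : ℝ) : EReal))

/-- The negative cumulant generating function `Ω(Q) = - log E_Q [exp (-θ ω)] ∈ (-∞, +∞]`. -/
def OmegaQ (PX : X → ℝ) (PYX : X → Y → ℝ) (PZX : X → Z → ℝ) (d : X → Xh → ℝ)
    (α μ β θ : ℝ) (Q : X × Y × Z × U × Xh → ℝ) : EReal :=
  - ENNReal.log (∑ t, ENNReal.ofReal (Q t) *
      EReal.exp (-((θ : EReal) * omega PX PYX PZX d α μ β Q t)))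

/-- The infimum of `Ω(Q)` over all joint distributions `Q` of `(X, Y, Z, U, X̂)` whose auxiliary
alphabet has at most `|X| |Y| |Z| |X̂|` elements. -/
def OmegaMin (PX : X → ℝ) (PYX : X → Y → ℝ) (PZX : X → Z → ℝ) (d : X → Xh → ℝ)
    (α μ β θ : ℝ) : EReal :=
  ⨅ (k : ℕ) (_ : k ≤ Fintype.card X * Fintype.card Y * Fintype.card Z * Fintype.card Xh)
    (Q : X × Y × Z × Fin k × Xh → ℝ) (_ : Q ∈ stdSimplex ℝ (X × Y × Z × Fin k × Xh)),
    OmegaQ PX PYX PZX d α μ β θ Q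

/-- The rate function `F^{(α,μ,β,θ)}(Rⁱ, Rᶜ, D)`. -/
def Fparam (PX : X → ℝ) (PYX : X → Y → ℝ) (PZX : X → Z → ℝ) (d : X → Xh → ℝ)
    (α μ β θ Ri Rc D : ℝ) : EReal :=
  (OmegaMin PX PYX PZX d α μ β θ
      - ((θ * α * ((1 - μ) * ((1 - β) * Rc - Ri) + μ * D) : ℝ) : EReal))
    / ((1 + 5 * θ + θ * α * (1 - μ) * (3 - β) : ℝ) : EReal)

/-- The exponent function `F(Rⁱ, Rᶜ, D)`, the supremum in `[-∞, +∞]` of the rate functions over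
`α, θ > 0` and `μ, β ∈ [0, 1]`. -/
def F (PX : X → ℝ) (PYX : X → Y → ℝ) (PZX : X → Z → ℝ) (d : X → Xh → ℝ)
    (Ri Rc D : ℝ) : EReal :=
  ⨆ (α : ℝ) (_ : 0 < α) (θ : ℝ) (_ : 0 < θ)
    (μ : ℝ) (_ : μ ∈ Set.Icc (0 : ℝ) 1) (β : ℝ) (_ : β ∈ Set.Icc (0 : ℝ) 1),
    Fparam PX PYX PZX d α μ β θ Ri Rc D

end Exponent

end ContentId

end

namespace ContentId

/-! Only the sign of `F` is at stake, so no exponential converse is needed. The region and the sign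
of `F` are both compared with one single-letter quantity, `lagrangian`, which is (1-μ)(1-β) I(Y;U) -
(1-μ) I(Z;U) + μ E d(X, φ(U,Z)) for a test channel P(u|y) and a decoder φ. Put r = (1-μ)((1-β)Rᶜ -
Rⁱ) + μD. The pivot is the condition (*): for all μ, β in [0,1] the infimum of the Lagrangian over
test channels and decoders is at most r.

For Rⁱ ≥ 0, (*) describes the region. If (*) holds, the triples (I(Z;U), I(Y;U) - I(Z;U), E d) form
a convex set by time sharing, so Hahn-Banach yields one test channel that nearly satisfies I(Z;U) ≥
Rⁱ, I(Y;U) - I(Z;U) ≤ Rᶜ - Rⁱ and E d ≤ D (`exists_test_channel_of_lagrangian_le`); random binning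
achieves its rates (`exists_oneShot_code`, `achievable_of_test_channel`). Conversely, a code is a
deterministic test channel on blocks. Its Lagrangian is controlled by log L, log M and D through a
Fano-type bound (`fano_identification`), and a single-letter lower bound on the Lagrangian
tensorizes to blocks (`nat_mul_le_block_lagrangian`).

(*) also describes `F ≤ 0`. The first four logarithms of ω add up to log Q / (P_XYZ Q_{U|Y}
Q_{X̂|ZU}), whose mean is the relative entropy of Q from a law satisfying the two Markov chains of a
test channel. If Q itself is such a law, this part vanishes, the α-part has mean `lagrangian`, and
Jensen's inequality gives Ω ≤ θα · `lagrangian` (`OmegaMin_le_of_lagrangian_le`). If instead Ω ≤ θαr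
for all α, θ > 0, near-minimizers are followed to a limit, with θ → 0 and then α → 0: the first
limit gives E ω ≤ αr, and the second makes the relative entropy vanish while the α-part stays at
most r (`exists_lagrangian_le_of_OmegaMin_le`).

Finally `F ≥ 0` always, because Ω is at least of order -θ as θ → 0 (`F_nonneg`). The denominator of
`F` matters only through being at least one. -/

lemma ind_le_one (P : Prop) [Decidable P] : (if P then (1 : ℝ) else 0) ≤ 1 := by
  split_ifs <;> norm_num

lemma ind_nonneg (P : Prop) [Decidable P] : 0 ≤ (if P then (1 : ℝ) else 0) := by
  split_ifs <;> norm_num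

/-! ### Sums over product mass functions -/

section Product

variable {ι T : Type*} [Fintype ι] [Fintype T]

lemma sum_pi_prod [DecidableEq ι] (g : ι → T → ℝ) :
    ∑ t : ι → T, ∏ i, g i (t i) = ∏ i, ∑ a, g i a := by
  rw [Finset.prod_univ_sum, Fintype.piFinset_univ]

lemma sum_pi_eq_one [DecidableEq ι] {p : ι → T → ℝ} (hp : ∀ i, ∑ a, p i a = 1) :
    ∑ t : ι → T, ∏ i, p i (t i) = 1 := by
  rw [sum_pi_prod]; simp [hp]

lemma sum_pi_one [DecidableEq ι] {p : ι → T → ℝ} (hp : ∀ i, ∑ a, p i a = 1) (w : ι) (G : T → ℝ) :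
    ∑ t : ι → T, (∏ i, p i (t i)) * G (t w) = ∑ a, p w a * G a := by
  have h1 : ∀ t : ι → T, (∏ i, p i (t i)) * G (t w)
      = ∏ i, (p i (t i) * if i = w then G (t i) else 1) := by
    intro t
    rw [Finset.prod_mul_distrib, Finset.prod_ite_eq' Finset.univ w (fun i => G (t i))]
    simp
  simp_rw [h1]
  rw [sum_pi_prod (fun i a => p i a * if i = w then G a else 1)]
  rw [Finset.prod_eq_single w]
  · simp
  · intro i _ hi; simp [hi, hp]
  · simp

lemma sum_pi_two [DecidableEq ι] {p : ι → T → ℝ} (hp : ∀ i, ∑ a, p i a = 1) {w m : ι} (h : w ≠ m)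
    (G : T → T → ℝ) :
    ∑ t : ι → T, (∏ i, p i (t i)) * G (t w) (t m) = ∑ a, ∑ b, p w a * p m b * G a b := by
  classical
  have key : ∀ g k : T → ℝ, ∑ t : ι → T, (∏ i, p i (t i)) * (g (t w) * k (t m))
      = (∑ a, p w a * g a) * ∑ b, p m b * k b := by
    intro g k
    have h1 : ∀ t : ι → T, (∏ i, p i (t i)) * (g (t w) * k (t m))
        = ∏ i, (p i (t i) * ((if i = w then g (t i) else 1) * if i = m then k (t i) else 1)) := by
      intro t
      rw [Finset.prod_mul_distrib, Finset.prod_mul_distrib,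
        Finset.prod_ite_eq' Finset.univ w (fun i => g (t i)),
        Finset.prod_ite_eq' Finset.univ m (fun i => k (t i))]
      simp
    simp_rw [h1]
    rw [sum_pi_prod (fun i a => p i a * ((if i = w then g a else 1) * if i = m then k a else 1))]
    rw [← Finset.mul_prod_erase Finset.univ _ (Finset.mem_univ w),
      ← Finset.mul_prod_erase (Finset.univ.erase w) _
        (Finset.mem_erase.2 ⟨h.symm, Finset.mem_univ m⟩),
      Finset.prod_eq_one (s := (Finset.univ.erase w).erase m)]
    · simp [h, h.symm]
    · intro i hi
      simp only [Finset.mem_erase, Finset.mem_univ, and_true] at hi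
      simp [hi.1, hi.2, hp]
  -- A general `G` is a linear combination of products of point indicators, to which `key` applies.
  have h2 : ∀ t : ι → T, (∏ i, p i (t i)) * G (t w) (t m) = ∑ a, ∑ b, G a b *
      ((∏ i, p i (t i)) * ((if t w = a then 1 else 0) * (if t m = b then 1 else 0))) := by
    intro t
    simp [mul_comm]
  simp_rw [h2]
  rw [Finset.sum_comm]
  refine Finset.sum_congr rfl fun a _ => ?_
  rw [Finset.sum_comm]
  refine Finset.sum_congr rfl fun b _ => ?_
  rw [← Finset.mul_sum, key (fun s => if s = a then 1 else 0) (fun s => if s = b then 1 else 0)]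
  simp [mul_comm]

/-- The second moment of a sum of independent identically distributed centred variables. -/
lemma sum_pi_sq [DecidableEq ι] {p : T → ℝ} (hp : ∑ a, p a = 1) {h : T → ℝ} (hh : ∑ a, p a * h a = 0) :
    ∑ t : ι → T, (∏ i, p (t i)) * (∑ i, h (t i)) ^ 2 = Fintype.card ι * ∑ a, p a * h a ^ 2 := by
  classical
  have h1 : ∀ t : ι → T, (∏ i, p (t i)) * (∑ i, h (t i)) ^ 2
      = ∑ i, ∑ j, (∏ i, p (t i)) * (h (t i) * h (t j)) := by
    intro t
    rw [sq, Finset.sum_mul_sum, Finset.mul_sum]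
    simp_rw [Finset.mul_sum]
  simp_rw [h1]
  rw [Finset.sum_comm]
  have h2 : ∀ i : ι, ∑ t : ι → T, ∑ j, (∏ i, p (t i)) * (h (t i) * h (t j))
      = ∑ a, p a * h a ^ 2 := by
    intro i
    rw [Finset.sum_comm, Finset.sum_eq_single i]
    · rw [sum_pi_one (p := fun _ => p) (fun _ => hp) i (fun a => h a * h a)]
      simp [sq]
    · intro j _ hj
      rw [sum_pi_two (p := fun _ => p) (fun _ => hp) hj.symm (fun a b => h a * h b)]
      have : ∀ a b, p a * p b * (h a * h b) = (p a * h a) * (p b * h b) := by intros; ring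
      simp_rw [this, ← Finset.mul_sum, hh]
      simp
    · simp
  simp [h2]

open Classical in
lemma chebyshev_pi {p : T → ℝ} (h0 : ∀ a, 0 ≤ p a) (hp : ∑ a, p a = 1) (h : T → ℝ) {m : ℝ}
    (hm : ∑ a, p a * h a = m) {n : ℕ} (hn : 0 < n) {ε : ℝ} (hε : 0 < ε) :
    ∑ t : Fin n → T, (∏ i, p (t i)) * (if n * ε ≤ |∑ i, h (t i) - n * m| then 1 else 0)
      ≤ (∑ a, p a * (h a - m) ^ 2) / (n * ε ^ 2) := by
  have hn' : (0 : ℝ) < n := by exact_mod_cast hn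
  have key := sum_pi_sq (ι := Fin n) hp (h := fun a => h a - m)
    (by simp [mul_sub, Finset.sum_sub_distrib, hm, ← Finset.sum_mul, hp])
  have hle : ∀ t : Fin n → T, (∏ i, p (t i)) * (if n * ε ≤ |∑ i, h (t i) - n * m| then 1 else 0)
      ≤ ((∏ i, p (t i)) * (∑ i, (h (t i) - m)) ^ 2) / (n * ε) ^ 2 := by
    intro t
    have hP : 0 ≤ ∏ i, p (t i) := Finset.prod_nonneg fun i _ => h0 _
    rw [mul_div_assoc]
    refine mul_le_mul_of_nonneg_left ?_ hP
    have hs : ∑ i, (h (t i) - m) = ∑ i, h (t i) - n * m := by simp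
    split_ifs with hc
    · rw [one_le_div (by positivity), hs, ← sq_abs (∑ i, h (t i) - n * m)]
      exact pow_le_pow_left₀ (by positivity) hc 2
    · positivity
  refine (Finset.sum_le_sum fun t _ => hle t).trans ?_
  rw [← Finset.sum_div, key]
  apply le_of_eq
  simp only [Fintype.card_fin]
  field_simp

end Product


lemma sum_arrow_prod {ι A B : Type*} [Fintype ι] [DecidableEq ι] [Fintype A] [Fintype B]
    (F : (ι → A) → (ι → B) → ℝ) :
    ∑ t : ι → A × B, F (fun i => (t i).1) (fun i => (t i).2) = ∑ x, ∑ y, F x y := by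
  rw [← Fintype.sum_prod_type']
  exact Fintype.sum_equiv (Equiv.arrowProdEquivProdArrow ι (fun _ => A) (fun _ => B)) _ _
    fun t => rfl

/-- Derandomization: some outcome is no worse than the average. It is used for the encoder and for
the codebook. -/
lemma exists_le_of_sum_mul_le {ι : Type*} [Fintype ι] {w f : ι → ℝ} {b : ℝ} (h0 : ∀ i, 0 ≤ w i)
    (h1 : ∑ i, w i = 1) (h : ∑ i, w i * f i ≤ b) : ∃ i, f i ≤ b := by
  by_contra! hc
  have h2 : ∑ i, w i * b < ∑ i, w i * f i := by
    obtain ⟨i, hi⟩ : ∃ i, 0 < w i := by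
      by_contra! h3
      have : ∑ i, w i ≤ 0 := Finset.sum_nonpos fun i _ => h3 i
      linarith
    exact Finset.sum_lt_sum (fun i _ => mul_le_mul_of_nonneg_left (hc i).le (h0 i))
      ⟨i, Finset.mem_univ i, mul_lt_mul_of_pos_left (hc i) hi⟩
  rw [← Finset.sum_mul, h1, one_mul] at h2
  linarith

/-! ### One-shot achievability -/

section Cover

variable {U K : Type*} [Fintype U] [Fintype K] [DecidableEq K]

open Classical in
/-- A random codebook covers: the expected defect of the normalised number of matching codewords. -/
lemma sum_codebook_defect_le {pU v : U → ℝ} (hU1 : ∑ u, pU u = 1) (hU0 : ∀ u, 0 ≤ pU u)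
    (hv0 : ∀ u, 0 ≤ v u) (hv1 : ∑ u, v u = 1) (hpos : ∀ u, 0 < v u → 0 < pU u)
    {τ η N : ℝ} (hτ : 0 < τ) (hη : 0 < η) (hN : N = Fintype.card K) (hN0 : 0 < N) :
    ∑ c : K → U, (∏ k, pU (c k)) * max 0 (1 - ∑ k, v (c k) / (N * pU (c k)))
      ≤ ∑ u, v u * (if τ * pU u < v u then 1 else 0) + η + τ / (N * η) := by
  -- The likelihood ratio `v / pU` is truncated at `τ` so that its second moment under `pU` is at
  -- most `τ`. The truncated mass is exactly the first term of the bound.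
  set g : U → ℝ := fun u => if τ * pU u < v u then 0 else v u / pU u with hg
  set q : ℝ := ∑ u, pU u * g u with hq
  have hpg : ∀ u, pU u * g u = v u - v u * (if τ * pU u < v u then 1 else 0) := by
    intro u
    simp only [hg]
    split_ifs with h
    · simp
    · rcases (hv0 u).eq_or_lt with h0 | h0
      · simp [← h0]
      · have := (hpos u h0).ne'
        field_simp
        ring
  have hq' : 1 - q = ∑ u, v u * (if τ * pU u < v u then 1 else 0) := by
    rw [hq]; simp_rw [hpg]; rw [Finset.sum_sub_distrib, hv1]; ring
  have hcent : ∑ u, pU u * (g u - q) = 0 := by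
    simp [mul_sub, Finset.sum_sub_distrib, ← Finset.sum_mul, hU1, ← hq]
  have hvar : ∑ u, pU u * (g u - q) ^ 2 ≤ τ := by
    have h1 : ∑ u, pU u * (g u - q) ^ 2 = ∑ u, pU u * g u ^ 2 - q ^ 2 := by
      have : ∀ u, pU u * (g u - q) ^ 2 = pU u * g u ^ 2 - 2 * q * (pU u * g u) + pU u * q ^ 2 := by
        intro u; ring
      simp_rw [this]
      rw [Finset.sum_add_distrib, Finset.sum_sub_distrib, ← Finset.mul_sum, ← Finset.sum_mul, hU1,
        ← hq]
      ring
    have h2 : ∑ u, pU u * g u ^ 2 ≤ ∑ u, τ * v u := by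
      refine Finset.sum_le_sum fun u _ => ?_
      simp only [hg]
      split_ifs with h
      · simp; exact mul_nonneg hτ.le (hv0 u)
      · rcases (hv0 u).eq_or_lt with h0 | h0
        · simp [← h0]
        · have hp := hpos u h0
          push Not at h
          have : pU u * (v u / pU u) ^ 2 = v u / pU u * v u := by field_simp
          rw [this]
          exact mul_le_mul_of_nonneg_right ((div_le_iff₀ hp).2 h) h0.le
    rw [← Finset.mul_sum, hv1] at h2
    nlinarith [sq_nonneg q]
  -- The defect is traded for a square by `-s ≤ η + s ^ 2 / η`, so that a variance bound suffices
  -- and `η` remains free.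
  have hpt : ∀ c : K → U, max 0 (1 - ∑ k, v (c k) / (N * pU (c k)))
      ≤ (1 - q) + η + (∑ k, (g (c k) - q)) ^ 2 / (N ^ 2 * η) := by
    intro c
    have hge : q + (∑ k, (g (c k) - q)) / N ≤ ∑ k, v (c k) / (N * pU (c k)) := by
      have h1 : q + (∑ k, (g (c k) - q)) / N = ∑ k, g (c k) / N := by
        rw [Finset.sum_sub_distrib, ← Finset.sum_div]
        simp only [Finset.sum_const, Finset.card_univ, nsmul_eq_mul, ← hN]
        field_simp
        ring
      rw [h1]
      refine Finset.sum_le_sum fun k _ => ?_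
      have : v (c k) / (N * pU (c k)) = v (c k) / pU (c k) / N := by
        rw [div_div, mul_comm]
      rw [this]
      gcongr
      simp only [hg]
      split_ifs
      · exact div_nonneg (hv0 _) (hU0 _)
      · exact le_rfl
    set s := (∑ k, (g (c k) - q)) / N with hs
    have hs2 : (∑ k, (g (c k) - q)) ^ 2 / (N ^ 2 * η) = s ^ 2 / η := by
      rw [hs, div_pow, div_div]
    have hq1 : 0 ≤ 1 - q := by
      rw [hq']
      refine Finset.sum_nonneg fun u _ => mul_nonneg (hv0 u) ?_
      split_ifs <;> norm_num
    have hs3 : -s ≤ η + s ^ 2 / η := by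
      rw [← sub_nonneg]
      have : η + s ^ 2 / η - -s = ((s + η / 2) ^ 2 + 3 / 4 * η ^ 2) / η := by
        field_simp; ring
      rw [this]; positivity
    rw [hs2]
    refine max_le (by positivity) (by linarith)
  calc ∑ c : K → U, (∏ k, pU (c k)) * max 0 (1 - ∑ k, v (c k) / (N * pU (c k)))
      ≤ ∑ c : K → U, (∏ k, pU (c k)) *
          ((1 - q) + η + (∑ k, (g (c k) - q)) ^ 2 / (N ^ 2 * η)) :=
        Finset.sum_le_sum fun c _ => mul_le_mul_of_nonneg_left (hpt c)
          (Finset.prod_nonneg fun k _ => hU0 _)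
    _ = ((1 - q) + η) + (∑ c : K → U, (∏ k, pU (c k)) * (∑ k, (g (c k) - q)) ^ 2)
          / (N ^ 2 * η) := by
        rw [Finset.sum_div]
        simp_rw [mul_add _ ((1 - q) + η)]
        rw [Finset.sum_add_distrib, ← Finset.sum_mul,
          sum_pi_eq_one (p := fun _ => pU) (fun _ => hU1), one_mul]
        simp_rw [mul_div_assoc]
    _ ≤ _ := by
        rw [sum_pi_sq (h := fun u => g u - q) hU1 hcent, ← hN, hq']
        refine add_le_add le_rfl ?_
        rw [div_le_div_iff₀ (by positivity) (by positivity)]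
        have : N * ∑ u, pU u * (g u - q) ^ 2 ≤ N * τ := mul_le_mul_of_nonneg_left hvar hN0.le
        nlinarith [mul_pos hN0 hη]

end Cover

/-! ### Random binning with a randomized encoder. -/

section OneShot

/-- The encoder of the random coding scheme: given the weights `a` of the codewords, codeword `k` is
chosen with probability at most `a k`, and the symbol `none` signals failure. -/
noncomputable def encKernel {K : Type*} [Fintype K] (a : K → ℝ) : Option K → ℝ
  | none => max 0 (1 - ∑ k, a k)
  | some k => a k / max 1 (∑ k, a k)

lemma encKernel_nonneg {K : Type*} [Fintype K] {a : K → ℝ} (ha : ∀ k, 0 ≤ a k) (o : Option K) :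
    0 ≤ encKernel a o := by
  cases o with
  | none => exact le_max_left _ _
  | some k => exact div_nonneg (ha k) (zero_le_one.trans (le_max_left _ _))

lemma encKernel_some_le {K : Type*} [Fintype K] {a : K → ℝ} (ha : ∀ k, 0 ≤ a k) (k : K) :
    encKernel a (some k) ≤ a k :=
  div_le_self (ha k) (le_max_left _ _)

lemma sum_encKernel {K : Type*} [Fintype K] (a : K → ℝ) : ∑ o, encKernel a o = 1 := by
  rw [Fintype.sum_option]
  simp only [encKernel]
  rw [← Finset.sum_div]
  rcases le_total (∑ k, a k) 1 with h | h
  · rw [max_eq_right (by linarith), max_eq_left h]; ring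
  · rw [max_eq_left (by linarith), max_eq_right h, div_self (by positivity)]; ring

open Classical in
/-- The error probability of a one-shot identification code with `M` items. -/
noncomputable def oneShotErr {A B E H S : Type*} [Fintype A] [Fintype B] [Fintype E]
    (p : A → B → ℝ) (W : A → E → ℝ) (Bad : A → H → Prop) {M : ℕ}
    (f : B → S) (g : (Fin M → S) → E → Fin M) (h : S → E → H) : ℝ :=
  ∑ w : Fin M, (1 / (M : ℝ)) * ∑ x : Fin M → A, ∑ y : Fin M → B, ∑ z : E,
    (∏ m, p (x m) (y m)) * W (x w) z *
      (let wh := g (fun m => f (y m)) z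
       if wh ≠ w ∨ Bad (x w) (h (f (y wh)) z) then 1 else 0)

variable {A B E H U : Type*} {L J : ℕ}

/-- Bin `l` contains a codeword that passes the test with `z`. -/
def BinHit (T : U → E → Prop) (c : Fin L × Fin J → U) (s : Option (Fin L)) (z : E) : Prop :=
  ∃ l j, s = some l ∧ T (c (l, j)) z

-- Item `0` is an arbitrary default. If no bin is hit, the queried item itself fails its test, which
-- is already counted in `selfError`.
open Classical in
noncomputable def binIdent (T : U → E → Prop) (c : Fin L × Fin J → U) {M : ℕ} (hM : 0 < M)
    (s : Fin M → Option (Fin L)) (z : E) : Fin M :=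
  if h : ∃ m, BinHit T c (s m) z then h.choose else ⟨0, hM⟩

-- The search is confined to the announced bin; its outcome is forced when no second codeword of
-- that bin passes the test.
open Classical in
noncomputable def binDecode [Nonempty H] (T : U → E → Prop) (φ : U → E → H) (c : Fin L × Fin J → U)
    (s : Option (Fin L)) (z : E) : H :=
  if h : ∃ k : Fin L × Fin J, s = some k.1 ∧ T (c k) z then φ (c h.choose) z
  else Classical.arbitrary H

open Classical in
/-- Failure, atypicality, or ambiguity within the bin, for the queried item. -/
noncomputable def selfError (T : U → E → Prop) (G : U → A → B → E → Prop) (c : Fin L × Fin J → U) (x : A) (y : B)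
    (z : E) : Option (Fin L × Fin J) → ℝ
  | none => 1
  | some k => (if G (c k) x y z then 0 else 1) +
      ∑ j, if j ≠ k.2 ∧ T (c (k.1, j)) z then 1 else 0

open Classical in
/-- Confusion of the queried item, encoded as the first argument, with another one. -/
noncomputable def crossError (T : U → E → Prop) (c : Fin L × Fin J → U) (z : E) :
    Option (Fin L × Fin J) → Option (Fin L × Fin J) → ℝ
  | some _, some k' => if BinHit T c (some k'.1) z then 1 else 0
  | _, _ => 0

lemma selfError_nonneg (T : U → E → Prop) (G : U → A → B → E → Prop) (c : Fin L × Fin J → U) (x : A)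
    (y : B) (z : E) (o) : 0 ≤ selfError T G c x y z o := by
  cases o with
  | none => simp [selfError]
  | some k =>
    simp only [selfError]
    refine add_nonneg (by split_ifs <;> norm_num) (Finset.sum_nonneg fun j _ => ?_)
    split_ifs <;> norm_num

lemma crossError_nonneg (T : U → E → Prop) (c : Fin L × Fin J → U) (z : E) (o o') :
    0 ≤ crossError T c z o o' := by
  cases o <;> cases o' <;> simp only [crossError, le_refl]
  split_ifs <;> norm_num

lemma crossError_le_one (T : U → E → Prop) (c : Fin L × Fin J → U) (z : E) (o o') :
    crossError T c z o o' ≤ 1 := by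
  cases o <;> cases o' <;> simp only [crossError, zero_le_one]
  split_ifs <;> norm_num

-- A union bound. If `selfError` is below one, none of its unit terms occurs, so the chosen codeword
-- is the only one in its bin passing the test and it decodes well; then only a hit in the bin of
-- another item can cause an error. The factor `pB (y w) ≤ κ` is free, being part of `G`, and later
-- controls the event that two items carry the same `y`.
open Classical in
lemma error_indicator_le [Nonempty H] {T : U → E → Prop} {G : U → A → B → E → Prop}
    {φ : U → E → H} {Bad : A → H → Prop} {pB : B → ℝ} {κ : ℝ}
    (hG : ∀ u x y z, G u x y z → T u z ∧ ¬ Bad x (φ u z) ∧ pB y ≤ κ)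
    (c : Fin L × Fin J → U) {M : ℕ} (hM : 0 < M) (f : B → Option (Fin L × Fin J))
    (w : Fin M) (x : A) (y : Fin M → B) (z : E) :
    (let wh := binIdent T c hM (fun m => (f (y m)).map Prod.fst) z
     if wh ≠ w ∨ Bad x (binDecode T φ c ((f (y wh)).map Prod.fst) z) then (1 : ℝ) else 0)
      ≤ selfError T G c x (y w) z (f (y w)) +
        ∑ m ∈ Finset.univ.erase w, (if pB (y w) ≤ κ then 1 else 0) *
          crossError T c z (f (y w)) (f (y m)) := by
  have hnn : ∀ m ∈ Finset.univ.erase w, 0 ≤ (if pB (y w) ≤ κ then (1 : ℝ) else 0) *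
      crossError T c z (f (y w)) (f (y m)) := fun m _ =>
    mul_nonneg (by split_ifs <;> norm_num) (crossError_nonneg _ _ _ _ _)
  have hs : 0 ≤ selfError T G c x (y w) z (f (y w)) := selfError_nonneg _ _ _ _ _ _ _
  by_cases h1 : 1 ≤ selfError T G c x (y w) z (f (y w))
  · have := Finset.sum_nonneg hnn
    exact (ind_le_one _).trans (by linarith)
  push Not at h1
  obtain ⟨k, hk⟩ : ∃ k, f (y w) = some k := by
    rw [← Option.isSome_iff_exists, Option.isSome_iff_ne_none]
    intro h; simp [h, selfError] at h1
  have hsum : ∀ j, (0 : ℝ) ≤ if j ≠ k.2 ∧ T (c (k.1, j)) z then 1 else 0 := fun j => ind_nonneg _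
  have hGk : G (c k) x (y w) z := by
    by_contra hc
    have := Finset.sum_nonneg fun j (_ : j ∈ Finset.univ) => hsum j
    simp only [hk, selfError, if_neg hc] at h1
    linarith
  have hj : ∀ j, T (c (k.1, j)) z → j = k.2 := by
    intro j hT
    by_contra hc
    have := Finset.single_le_sum (fun j _ => hsum j) (Finset.mem_univ j)
    rw [if_pos ⟨hc, hT⟩] at this
    simp only [hk, selfError, if_pos hGk] at h1
    linarith
  obtain ⟨hT, hB, hκ⟩ := hG _ _ _ _ hGk
  by_cases h2 : ∃ m, m ≠ w ∧ BinHit T c ((f (y m)).map Prod.fst) z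
  · obtain ⟨m, hm, hh⟩ := h2
    obtain ⟨k', hk'⟩ : ∃ k', f (y m) = some k' := by
      rw [← Option.isSome_iff_exists, Option.isSome_iff_ne_none]
      intro h
      obtain ⟨l, j, hl, -⟩ := hh
      simp [h] at hl
    have := Finset.single_le_sum hnn (Finset.mem_erase.2 ⟨hm, Finset.mem_univ m⟩)
    rw [hk'] at hh
    have h3 : (if pB (y w) ≤ κ then (1 : ℝ) else 0) * crossError T c z (f (y w)) (f (y m)) = 1 := by
      rw [if_pos hκ, hk, hk', crossError, if_pos (by simpa using hh), one_mul]
    exact (ind_le_one _).trans (by linarith)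
  · push Not at h2
    have hex : ∃ m, BinHit T c ((f (y m)).map Prod.fst) z :=
      ⟨w, k.1, k.2, by simp [hk], hT⟩
    have hid : binIdent T c hM (fun m => (f (y m)).map Prod.fst) z = w := by
      unfold binIdent
      rw [dif_pos hex]
      by_contra hc
      exact h2 _ hc hex.choose_spec
    have hdec : binDecode T φ c ((f (y w)).map Prod.fst) z = φ (c k) z := by
      unfold binDecode
      have hex' : ∃ k' : Fin L × Fin J, (f (y w)).map Prod.fst = some k'.1 ∧ T (c k') z :=
        ⟨k, by simp [hk], hT⟩
      rw [dif_pos hex']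
      obtain ⟨ha, hb⟩ := hex'.choose_spec
      have h3 : hex'.choose.1 = k.1 := by
        have ha' := ha.symm.trans (congrArg (Option.map Prod.fst) hk)
        simpa using ha'
      have h4 : hex'.choose.2 = k.2 := by
        apply hj; rw [← h3]; exact hb
      rw [Prod.ext h3 h4]
    have := Finset.sum_nonneg hnn
    simp only [hid, hdec]
    rw [if_neg (by simpa using hB)]
    linarith

end OneShot

section OneShot

variable {A B E H U : Type*} [Fintype A] [Fintype B] [Fintype E] {L J : ℕ}

-- The bound does not depend on `w`, since the items are independent and identically distributed:
-- the self error involves one item, and each of the `M - 1` cross errors involves an independent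
-- pair.
open Classical in
lemma oneShotErr_le [Nonempty H] {p : A → B → ℝ} (hp0 : ∀ x y, 0 ≤ p x y)
    (hp1 : ∑ x, ∑ y, p x y = 1) {W : A → E → ℝ} (hW0 : ∀ x z, 0 ≤ W x z)
    {T : U → E → Prop} {G : U → A → B → E → Prop}
    {φ : U → E → H} {Bad : A → H → Prop} {κ : ℝ}
    (hG : ∀ u x y z, G u x y z → T u z ∧ ¬ Bad x (φ u z) ∧ ∑ x, p x y ≤ κ)
    (c : Fin L × Fin J → U) {M : ℕ} (hM : 0 < M) (f : B → Option (Fin L × Fin J)) :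
    oneShotErr p W Bad (fun y => (f y).map Prod.fst) (binIdent T c hM) (binDecode T φ c) ≤
      ∑ x, ∑ y, ∑ z, p x y * W x z * selfError T G c x y z (f y) +
      (M - 1) * ∑ x, ∑ y, ∑ z, p x y * W x z * ∑ y', (∑ x', p x' y') *
        ((if ∑ x', p x' y ≤ κ then 1 else 0) * crossError T c z (f y) (f y')) := by
  set R : ℝ := ∑ x, ∑ y, ∑ z, p x y * W x z * selfError T G c x y z (f y) +
      (M - 1) * ∑ x, ∑ y, ∑ z, p x y * W x z * ∑ y', (∑ x', p x' y') *
        ((if ∑ x', p x' y ≤ κ then 1 else 0) * crossError T c z (f y) (f y')) with hR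
  have hpw : ∑ a : A × B, p a.1 a.2 = 1 := by rw [Fintype.sum_prod_type]; exact hp1
  have hM' : (M : ℝ) ≠ 0 := by positivity
  suffices hw : ∀ w : Fin M, ∑ x : Fin M → A, ∑ y : Fin M → B, ∑ z : E,
      (∏ m, p (x m) (y m)) * W (x w) z *
      (let wh := binIdent T c hM (fun m => (f (y m)).map Prod.fst) z
       if wh ≠ w ∨ Bad (x w) (binDecode T φ c ((f (y wh)).map Prod.fst) z) then 1 else 0) ≤ R by
    calc _ ≤ ∑ w : Fin M, (1 / (M : ℝ)) * R :=
          Finset.sum_le_sum fun w _ => mul_le_mul_of_nonneg_left (hw w) (by positivity)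
      _ = R := by simp; field_simp
  intro w
  let P1 : A × B → ℝ := fun a => ∑ z, W a.1 z * selfError T G c a.1 a.2 z (f a.2)
  let P2 : A × B → A × B → ℝ := fun a b => ∑ z, W a.1 z *
    ((if ∑ x', p x' a.2 ≤ κ then 1 else 0) * crossError T c z (f a.2) (f b.2))
  calc _ ≤ ∑ x : Fin M → A, ∑ y : Fin M → B, (∏ m, p (x m) (y m)) *
        (P1 (x w, y w) + ∑ m ∈ Finset.univ.erase w, P2 (x w, y w) (x m, y m)) := by
        refine Finset.sum_le_sum fun x _ => Finset.sum_le_sum fun y _ => ?_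
        simp only [P1, P2]
        rw [Finset.sum_comm, ← Finset.sum_add_distrib, Finset.mul_sum]
        refine Finset.sum_le_sum fun z _ => ?_
        rw [mul_assoc]
        refine mul_le_mul_of_nonneg_left ?_ (Finset.prod_nonneg fun m _ => hp0 _ _)
        rw [← Finset.mul_sum, ← mul_add]
        exact mul_le_mul_of_nonneg_left (error_indicator_le hG c hM f w (x w) y z) (hW0 _ _)
    _ = ∑ t : Fin M → A × B, (∏ m, p (t m).1 (t m).2) *
        (P1 (t w) + ∑ m ∈ Finset.univ.erase w, P2 (t w) (t m)) :=
        (sum_arrow_prod (fun x y => (∏ m, p (x m) (y m)) *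
        (P1 (x w, y w) + ∑ m ∈ Finset.univ.erase w, P2 (x w, y w) (x m, y m)))).symm
    _ = ∑ a : A × B, p a.1 a.2 * P1 a +
        ∑ m ∈ Finset.univ.erase w, ∑ a : A × B, ∑ b : A × B,
          p a.1 a.2 * p b.1 b.2 * P2 a b := by
        simp_rw [mul_add, Finset.sum_add_distrib, Finset.mul_sum]
        rw [sum_pi_one (p := fun _ a => p a.1 a.2) (fun _ => hpw) w P1, Finset.sum_comm]
        congr 1
        refine Finset.sum_congr rfl fun m hm => ?_
        exact sum_pi_two (p := fun _ a => p a.1 a.2) (fun _ => hpw)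
          (Finset.ne_of_mem_erase hm).symm P2
    _ = R := by
        rw [hR, Finset.sum_const, Finset.card_erase_of_mem (Finset.mem_univ w)]
        simp only [Finset.card_univ, Fintype.card_fin, nsmul_eq_mul]
        rw [Nat.cast_sub hM, Nat.cast_one]
        congr 1
        · rw [Fintype.sum_prod_type]
          simp only [P1, Finset.mul_sum, mul_assoc]
        · congr 1
          rw [Fintype.sum_prod_type]
          refine Finset.sum_congr rfl fun x _ => Finset.sum_congr rfl fun y _ => ?_
          simp only [P2, Finset.mul_sum, Finset.sum_mul]
          rw [Finset.sum_comm]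
          refine Finset.sum_congr rfl fun z _ => ?_
          rw [Fintype.sum_prod_type_right]
          refine Finset.sum_congr rfl fun y' _ => Finset.sum_congr rfl fun x' _ => ?_
          ring

/-- Averaging over independent random choices of the encoder at each `y`. -/
lemma exists_encoder_le [Nonempty H] {p : A → B → ℝ} (hp0 : ∀ x y, 0 ≤ p x y)
    (hp1 : ∑ x, ∑ y, p x y = 1) {W : A → E → ℝ} (hW0 : ∀ x z, 0 ≤ W x z)
    {T : U → E → Prop} {G : U → A → B → E → Prop}
    {φ : U → E → H} {Bad : A → H → Prop} {κ : ℝ} (hκ : 0 ≤ κ)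
    (hG : ∀ u x y z, G u x y z → T u z ∧ ¬ Bad x (φ u z) ∧ ∑ x, p x y ≤ κ)
    (c : Fin L × Fin J → U) {M : ℕ} (hM : 0 < M) (a : B → Fin L × Fin J → ℝ)
    (ha : ∀ y k, 0 ≤ a y k) :
    ∃ f : B → Option (Fin L × Fin J),
    oneShotErr p W Bad (fun y => (f y).map Prod.fst) (binIdent T c hM) (binDecode T φ c) ≤
      ∑ x, ∑ y, ∑ z, p x y * W x z * (∑ o, encKernel (a y) o * selfError T G c x y z o +
      (M - 1) * (κ + ∑ y', (∑ x', p x' y') *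
        ∑ o, ∑ o', encKernel (a y) o * encKernel (a y') o' * crossError T c z o o')) := by
  classical
  have hM1 : (0 : ℝ) ≤ M - 1 := by
    have : (1 : ℝ) ≤ M := by exact_mod_cast hM
    linarith
  have hsum : ∀ y, ∑ o, encKernel (a y) o = 1 := fun y => sum_encKernel _
  have hnn : ∀ y o, 0 ≤ encKernel (a y) o := fun y o => encKernel_nonneg (ha y) o
  refine exists_le_of_sum_mul_le (w := fun f => ∏ y, encKernel (a y) (f y))
    (fun f => Finset.prod_nonneg fun y _ => hnn _ _)
    (sum_pi_eq_one (p := fun y => encKernel (a y)) hsum) ?_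
  calc _ ≤ ∑ f : B → Option (Fin L × Fin J), (∏ y, encKernel (a y) (f y)) *
        (∑ x, ∑ y, ∑ z, p x y * W x z * selfError T G c x y z (f y) +
      (M - 1) * ∑ x, ∑ y, ∑ z, p x y * W x z * ∑ y', (∑ x', p x' y') *
        ((if ∑ x', p x' y ≤ κ then 1 else 0) * crossError T c z (f y) (f y'))) :=
        Finset.sum_le_sum fun f _ => mul_le_mul_of_nonneg_left
          (oneShotErr_le hp0 hp1 hW0 hG c hM f) (Finset.prod_nonneg fun y _ => hnn _ _)
    _ = ∑ x, ∑ y, ∑ z, p x y * W x z *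
        ∑ f : B → Option (Fin L × Fin J), (∏ y, encKernel (a y) (f y)) *
          selfError T G c x y z (f y) +
        (M - 1) * ∑ x, ∑ y, ∑ z, p x y * W x z * ∑ y', (∑ x', p x' y') *
          ((if ∑ x', p x' y ≤ κ then 1 else 0) *
          ∑ f : B → Option (Fin L × Fin J), (∏ y, encKernel (a y) (f y)) *
            crossError T c z (f y) (f y')) := by
        simp_rw [mul_add, Finset.sum_add_distrib]
        congr 1
        · simp_rw [Finset.mul_sum]
          rw [Finset.sum_comm]
          refine Finset.sum_congr rfl fun x _ => ?_
          rw [Finset.sum_comm]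
          refine Finset.sum_congr rfl fun y _ => ?_
          rw [Finset.sum_comm]
          refine Finset.sum_congr rfl fun z _ => Finset.sum_congr rfl fun f _ => ?_
          ring
        · have : ∀ r s : ℝ, r * ((M - 1) * s) = (M - 1) * (r * s) := fun r s => by ring
          simp_rw [this]
          rw [← Finset.mul_sum]
          congr 1
          simp_rw [Finset.mul_sum]
          rw [Finset.sum_comm]
          refine Finset.sum_congr rfl fun x _ => ?_
          rw [Finset.sum_comm]
          refine Finset.sum_congr rfl fun y _ => ?_
          rw [Finset.sum_comm]
          refine Finset.sum_congr rfl fun z _ => ?_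
          rw [Finset.sum_comm]
          refine Finset.sum_congr rfl fun y' _ => Finset.sum_congr rfl fun f _ => ?_
          ring
    _ ≤ ∑ x, ∑ y, ∑ z, p x y * W x z * (∑ o, encKernel (a y) o * selfError T G c x y z o) +
        (M - 1) * ∑ x, ∑ y, ∑ z, p x y * W x z * (κ + ∑ y', (∑ x', p x' y') *
        ∑ o, ∑ o', encKernel (a y) o * encKernel (a y') o' * crossError T c z o o') := by
        refine add_le_add (le_of_eq ?_) (mul_le_mul_of_nonneg_left ?_ hM1)
        · refine Finset.sum_congr rfl fun x _ => Finset.sum_congr rfl fun y _ =>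
            Finset.sum_congr rfl fun z _ => ?_
          rw [sum_pi_one (p := fun y => encKernel (a y)) hsum y (selfError T G c x y z)]
        · refine Finset.sum_le_sum fun x _ => Finset.sum_le_sum fun y _ =>
            Finset.sum_le_sum fun z _ =>
            mul_le_mul_of_nonneg_left ?_ (mul_nonneg (hp0 _ _) (hW0 _ _))
          -- The encoder is drawn independently at different `y`, so the average factorizes only for
          -- `y' ≠ y`. Coinciding sequences are charged fully; they have probability `pB y ≤ κ`.
          have hterm : ∀ y', (if ∑ x', p x' y ≤ κ then 1 else 0) *
              ∑ f : B → Option (Fin L × Fin J), (∏ y, encKernel (a y) (f y)) *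
                crossError T c z (f y) (f y') ≤
              (if y' = y then (if ∑ x', p x' y ≤ κ then 1 else 0) else 0) +
              ∑ o, ∑ o', encKernel (a y) o * encKernel (a y') o' * crossError T c z o o' := by
            intro y'
            have hcr : 0 ≤ ∑ o, ∑ o', encKernel (a y) o * encKernel (a y') o' *
                crossError T c z o o' :=
              Finset.sum_nonneg fun o _ => Finset.sum_nonneg fun o' _ =>
                mul_nonneg (mul_nonneg (hnn _ _) (hnn _ _)) (crossError_nonneg _ _ _ _ _)
            by_cases hy : y' = y
            · rw [if_pos hy]
              refine (mul_le_of_le_one_right (ind_nonneg _) ?_).trans (le_add_of_nonneg_right hcr)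
              rw [← sum_pi_eq_one (p := fun y => encKernel (a y)) hsum]
              exact Finset.sum_le_sum fun f _ => mul_le_of_le_one_right
                (Finset.prod_nonneg fun y _ => hnn _ _) (crossError_le_one _ _ _ _ _)
            · rw [if_neg hy, zero_add,
                sum_pi_two (p := fun y => encKernel (a y)) hsum (Ne.symm hy) (crossError T c z)]
              exact mul_le_of_le_one_left hcr (ind_le_one _)
          calc _ ≤ ∑ y', (∑ x', p x' y') *
              ((if y' = y then (if ∑ x', p x' y ≤ κ then 1 else 0) else 0) +
              ∑ o, ∑ o', encKernel (a y) o * encKernel (a y') o' * crossError T c z o o') :=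
                Finset.sum_le_sum fun y' _ => mul_le_mul_of_nonneg_left (hterm y')
                  (Finset.sum_nonneg fun x _ => hp0 _ _)
            _ ≤ _ := by
                simp_rw [mul_add]
                rw [Finset.sum_add_distrib]
                refine add_le_add ?_ le_rfl
                simp only [mul_ite, mul_zero, mul_one, Finset.sum_ite_eq', Finset.mem_univ, if_true]
                split_ifs with h
                · exact h
                · exact hκ
    _ = _ := by
        rw [Finset.mul_sum, ← Finset.sum_add_distrib]
        refine Finset.sum_congr rfl fun x _ => ?_
        rw [Finset.mul_sum, ← Finset.sum_add_distrib]
        refine Finset.sum_congr rfl fun y _ => ?_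
        rw [Finset.mul_sum, ← Finset.sum_add_distrib]
        refine Finset.sum_congr rfl fun z _ => ?_
        ring

end OneShot

section OneShot

variable {A B E U : Type*} {L J : ℕ}

open Classical in
/-- The expected error bound for a fixed codebook, in terms of the codeword weights only. -/
lemma encoder_bound_le [Fintype B] {T : U → E → Prop} {G : U → A → B → E → Prop}
    (c : Fin L × Fin J → U) (hL : 0 < L) (hJ : 0 < J) {a : B → Fin L × Fin J → ℝ}
    (ha : ∀ y k, 0 ≤ a y k) {pB : B → ℝ} (hpB : ∀ y, 0 ≤ pB y)
    (hbar : ∀ k, ∑ y, pB y * a y k ≤ 1 / (L * J)) {M' κ : ℝ} (hM' : 0 ≤ M') (x : A) (y : B)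
    (z : E) :
    ∑ o, encKernel (a y) o * selfError T G c x y z o +
      M' * (κ + ∑ y', pB y' *
        ∑ o, ∑ o', encKernel (a y) o * encKernel (a y') o' * crossError T c z o o') ≤
    max 0 (1 - ∑ k, a y k) + ∑ k, a y k * (if G (c k) x y z then 0 else 1) +
      ∑ k : Fin L × Fin J, ∑ j, (if j ≠ k.2 then
        a y k * (if T (c (k.1, j)) z then 1 else 0) else 0) +
      M' * (κ + 1 / L + 1 / L * ∑ k, ∑ k', (if k' ≠ k then
        a y k * (if T (c k') z then 1 else 0) else 0)) := by
  have hL' : (0 : ℝ) < L := by exact_mod_cast hL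
  have hJ' : (0 : ℝ) < J := by exact_mod_cast hJ
  refine add_le_add ?_ (mul_le_mul_of_nonneg_left ?_ hM')
  · rw [Fintype.sum_option, add_assoc]
    refine add_le_add (by simp [encKernel, selfError]) ?_
    rw [← Finset.sum_add_distrib]
    refine Finset.sum_le_sum fun k _ => ?_
    refine (mul_le_mul_of_nonneg_right (encKernel_some_le (ha y) k)
      (selfError_nonneg _ _ _ _ _ _ _)).trans (le_of_eq ?_)
    simp only [selfError]
    rw [mul_add, Finset.mul_sum]
    congr 1
    refine Finset.sum_congr rfl fun j _ => ?_
    by_cases h1 : j ≠ k.2 <;> by_cases h2 : T (c (k.1, j)) z <;> simp [h1, h2]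
  · rw [add_assoc]
    refine add_le_add le_rfl ?_
    set hit : Fin L → ℝ := fun l => if BinHit T c (some l) z then 1 else 0 with hhit
    have hit0 : ∀ l, 0 ≤ hit l := fun l => ind_nonneg _
    -- The bin of `k` itself is counted once, which becomes the term `1 / L`; every other hit bin
    -- contains a passing codeword different from `k`.
    have hbin : ∀ k : Fin L × Fin J, ∑ l, hit l ≤
        1 + ∑ k', (if k' ≠ k then (if T (c k') z then 1 else 0) else 0) := by
      intro k
      rw [← Finset.add_sum_erase _ _ (Finset.mem_univ k.1)]
      refine add_le_add (ind_le_one _) ?_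
      rw [Fintype.sum_prod_type]
      refine (Finset.sum_le_sum (g := fun l => ∑ j, (if (l, j) ≠ k then
        (if T (c (l, j)) z then (1 : ℝ) else 0) else 0)) fun l hl => ?_).trans
        (Finset.sum_le_sum_of_subset_of_nonneg (Finset.erase_subset _ _) fun l _ _ =>
          Finset.sum_nonneg fun j _ => by split_ifs <;> norm_num)
      have hne : ∀ j, (l, j) ≠ k := fun j h => (Finset.ne_of_mem_erase hl) (by rw [← h])
      simp only [hne, ne_eq, not_false_eq_true, if_true]
      simp only [hhit]
      split_ifs with hb
      · obtain ⟨l', j, hl', hT⟩ := hb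
        obtain rfl : l = l' := by simpa using hl'
        have := Finset.single_le_sum (f := fun j => if T (c (l, j)) z then (1 : ℝ) else 0)
          (fun j _ => ind_nonneg _) (Finset.mem_univ j)
        rwa [if_pos hT] at this
      · exact Finset.sum_nonneg fun j _ => ind_nonneg _
    -- By `hbar` an unrelated item selects a given codeword with probability at most `1 / (L * J)`,
    -- hence a given bin with probability at most `1 / L`.
    have hin : ∑ k' : Fin L × Fin J, 1 / (L * J : ℝ) * hit k'.1 = 1 / L * ∑ l, hit l := by
      rw [Fintype.sum_prod_type, Finset.mul_sum]
      refine Finset.sum_congr rfl fun l _ => ?_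
      simp
      field_simp
    have hnn : ∀ y o, 0 ≤ encKernel (a y) o := fun y o => encKernel_nonneg (ha y) o
    calc ∑ y', pB y' * ∑ o, ∑ o', encKernel (a y) o * encKernel (a y') o' * crossError T c z o o'
        = ∑ k, encKernel (a y) (some k) * ∑ k' : Fin L × Fin J,
            (∑ y', pB y' * encKernel (a y') (some k')) * hit k'.1 := by
          simp_rw [Fintype.sum_option, crossError]
          simp only [mul_zero, Finset.sum_const_zero, zero_add, Finset.mul_sum, Finset.sum_mul]
          rw [Finset.sum_comm]
          refine Finset.sum_congr rfl fun k _ => ?_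
          rw [Finset.sum_comm]
          refine Finset.sum_congr rfl fun k' _ => Finset.sum_congr rfl fun y' _ => ?_
          simp only [hhit]
          ring
      _ ≤ ∑ k, encKernel (a y) (some k) * ∑ k' : Fin L × Fin J, 1 / (L * J : ℝ) * hit k'.1 := by
          refine Finset.sum_le_sum fun k _ => mul_le_mul_of_nonneg_left ?_ (hnn _ _)
          refine Finset.sum_le_sum fun k' _ => mul_le_mul_of_nonneg_right ?_ (hit0 _)
          refine le_trans ?_ (hbar k')
          exact Finset.sum_le_sum fun y' _ =>
            mul_le_mul_of_nonneg_left (encKernel_some_le (ha y') k') (hpB y')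
      _ ≤ ∑ k, encKernel (a y) (some k) * (1 / L *
            (1 + ∑ k', (if k' ≠ k then (if T (c k') z then 1 else 0) else 0))) := by
          rw [hin]
          refine Finset.sum_le_sum fun k _ => mul_le_mul_of_nonneg_left ?_ (hnn _ _)
          exact mul_le_mul_of_nonneg_left (hbin k) (by positivity)
      _ ≤ _ := by
          simp_rw [mul_add, Finset.sum_add_distrib]
          refine add_le_add ?_ ?_
          · rw [← Finset.sum_mul, mul_one]
            refine mul_le_of_le_one_left (by positivity) ?_
            rw [← sum_encKernel (a y), Fintype.sum_option]
            exact le_add_of_nonneg_left (hnn _ _)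
          · rw [Finset.mul_sum]
            refine Finset.sum_le_sum fun k _ => ?_
            have h0 : (0 : ℝ) ≤ ∑ k', (if k' ≠ k then (if T (c k') z then 1 else 0) else 0) :=
              Finset.sum_nonneg fun k' _ => by split_ifs <;> norm_num
            calc _ ≤ a y k * (1 / L * ∑ k', (if k' ≠ k then (if T (c k') z then 1 else 0) else 0)) :=
                  mul_le_mul_of_nonneg_right (encKernel_some_le (ha y) k)
                    (mul_nonneg (by positivity) h0)
              _ = _ := by
                  rw [mul_left_comm, Finset.mul_sum]
                  simp only [mul_ite, mul_zero]

open Classical in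
/-- The average of the codeword bound over a random codebook. -/
lemma sum_codebook_bound_le [Fintype U] {T : U → E → Prop} {G : U → A → B → E → Prop} (hL : 0 < L) (hJ : 0 < J)
    {pU v : U → ℝ} (hU1 : ∑ u, pU u = 1) (hU0 : ∀ u, 0 ≤ pU u)
    (hv0 : ∀ u, 0 ≤ v u) (hv1 : ∑ u, v u = 1) (hpos : ∀ u, 0 < v u → 0 < pU u)
    {τ η ρ κ M' : ℝ} (hτ : 0 < τ) (hη : 0 < η) (hM' : 0 ≤ M') (x : A) (y : B) (z : E)
    (hρ : ∑ u, pU u * (if T u z then 1 else 0) ≤ ρ) :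
    ∑ c : Fin L × Fin J → U, (∏ k, pU (c k)) *
      (max 0 (1 - ∑ k, v (c k) / (L * J * pU (c k))) +
        ∑ k, v (c k) / (L * J * pU (c k)) * (if G (c k) x y z then 0 else 1) +
      ∑ k : Fin L × Fin J, ∑ j, (if j ≠ k.2 then
        v (c k) / (L * J * pU (c k)) * (if T (c (k.1, j)) z then 1 else 0) else 0) +
      M' * (κ + 1 / L + 1 / L * ∑ k, ∑ k', (if k' ≠ k then
        v (c k) / (L * J * pU (c k)) * (if T (c k') z then 1 else 0) else 0))) ≤
    ∑ u, v u * (if τ * pU u < v u then 1 else 0) + η + τ / (L * J * η) +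
      ∑ u, v u * (if G u x y z then 0 else 1) + (J - 1) * ρ + M' * (κ + 1 / L + J * ρ) := by
  have hL' : (0 : ℝ) < L := by exact_mod_cast hL
  have hJ' : (0 : ℝ) < J := by exact_mod_cast hJ
  have hJ1 : (1 : ℝ) ≤ J := by exact_mod_cast hJ
  have hprod1 : ∑ c : Fin L × Fin J → U, ∏ k, pU (c k) = 1 :=
    sum_pi_eq_one (p := fun _ => pU) (fun _ => hU1)
  have hcancel : ∀ u, pU u * (v u / (L * J * pU u)) = v u / (L * J) := by
    intro u
    rcases (hv0 u).eq_or_lt with h | h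
    · simp [← h]
    · have := (hpos u h).ne'
      field_simp
  -- Different codewords are independent: the importance weight of `k` averages to `1 / (L * J)` and
  -- the test at `k'` succeeds with probability at most `ρ`.
  have hpair : ∀ k k' : Fin L × Fin J, k' ≠ k →
      ∑ c : Fin L × Fin J → U, (∏ k, pU (c k)) *
        (v (c k) / (L * J * pU (c k)) * (if T (c k') z then 1 else 0)) ≤ ρ / (L * J) := by
    intro k k' hk
    rw [sum_pi_two (p := fun _ => pU) (fun _ => hU1) hk.symm
      (fun a b => v a / (L * J * pU a) * (if T b z then 1 else 0))]
    have : ∀ a b, pU a * pU b * (v a / (L * J * pU a) * (if T b z then 1 else 0))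
        = (v a / (L * J)) * (pU b * (if T b z then 1 else 0)) := by
      intro a b; rw [← hcancel]; ring
    simp_rw [this, ← Finset.mul_sum]
    rw [← Finset.sum_mul, ← Finset.sum_div, hv1, one_div, div_eq_inv_mul]
    exact mul_le_mul_of_nonneg_left hρ (by positivity)
  have hρ0 : 0 ≤ ρ := le_trans (Finset.sum_nonneg fun u _ => mul_nonneg (hU0 u) (ind_nonneg _)) hρ
  have h1 := sum_codebook_defect_le (K := Fin L × Fin J) hU1 hU0 hv0 hv1 hpos hτ hη
    (N := L * J) (by simp) (by positivity)
  have h2 : ∑ c : Fin L × Fin J → U, (∏ k, pU (c k)) *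
      ∑ k, v (c k) / (L * J * pU (c k)) * (if G (c k) x y z then 0 else 1)
      = ∑ u, v u * (if G u x y z then 0 else 1) := by
    simp_rw [Finset.mul_sum]
    rw [Finset.sum_comm]
    have : ∀ k : Fin L × Fin J, ∑ c : Fin L × Fin J → U, (∏ k, pU (c k)) *
        (v (c k) / (L * J * pU (c k)) * (if G (c k) x y z then 0 else 1))
        = 1 / (L * J) * ∑ u, v u * (if G u x y z then 0 else 1) := by
      intro k
      rw [sum_pi_one (p := fun _ => pU) (fun _ => hU1) k
        (fun a => v a / (L * J * pU a) * (if G a x y z then 0 else 1)), Finset.mul_sum]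
      refine Finset.sum_congr rfl fun u _ => ?_
      rw [← mul_assoc, hcancel]; ring
    rw [Finset.sum_congr rfl fun k _ => this k]
    rw [Finset.sum_const]
    simp only [Finset.card_univ, Fintype.card_prod, Fintype.card_fin, nsmul_eq_mul, Nat.cast_mul]
    field_simp
  have h3 : ∑ c : Fin L × Fin J → U, (∏ k, pU (c k)) *
      ∑ k : Fin L × Fin J, ∑ j, (if j ≠ k.2 then
        v (c k) / (L * J * pU (c k)) * (if T (c (k.1, j)) z then 1 else 0) else 0)
      ≤ (J - 1) * ρ := by
    simp_rw [Finset.mul_sum]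
    rw [Finset.sum_comm]
    have : ∀ k : Fin L × Fin J, ∑ c : Fin L × Fin J → U, ∑ j, (∏ k, pU (c k)) *
        (if j ≠ k.2 then v (c k) / (L * J * pU (c k)) * (if T (c (k.1, j)) z then 1 else 0) else 0)
        ≤ (J - 1) * (ρ / (L * J)) := by
      intro k
      rw [Finset.sum_comm, ← Finset.add_sum_erase _ _ (Finset.mem_univ k.2)]
      have h0 : ∑ c : Fin L × Fin J → U, (∏ k, pU (c k)) * (if k.2 ≠ k.2 then
          v (c k) / (L * J * pU (c k)) * (if T (c (k.1, k.2)) z then 1 else 0) else 0) = 0 := by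
        simp
      rw [h0, zero_add]
      refine (Finset.sum_le_card_nsmul _ _ (ρ / (L * J)) fun j hj => ?_).trans (le_of_eq ?_)
      · have hj' := Finset.ne_of_mem_erase hj
        simp only [ne_eq, hj', not_false_eq_true, if_true]
        exact hpair k (k.1, j) fun h => hj' (by rw [← h])
      · rw [Finset.card_erase_of_mem (Finset.mem_univ _)]
        simp only [Finset.card_univ, Fintype.card_fin, nsmul_eq_mul]
        rw [Nat.cast_sub hJ, Nat.cast_one]
    refine (Finset.sum_le_card_nsmul _ _ _ fun k _ => this k).trans (le_of_eq ?_)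
    simp only [Finset.card_univ, Fintype.card_prod, Fintype.card_fin, nsmul_eq_mul, Nat.cast_mul]
    field_simp
  have h4 : ∑ c : Fin L × Fin J → U, (∏ k, pU (c k)) *
      ∑ k, ∑ k', (if k' ≠ k then
        v (c k) / (L * J * pU (c k)) * (if T (c k') z then 1 else 0) else 0)
      ≤ L * J * ρ := by
    simp_rw [Finset.mul_sum]
    rw [Finset.sum_comm]
    have : ∀ k : Fin L × Fin J, ∑ c : Fin L × Fin J → U, ∑ k', (∏ k, pU (c k)) *
        (if k' ≠ k then v (c k) / (L * J * pU (c k)) * (if T (c k') z then 1 else 0) else 0)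
        ≤ ρ := by
      intro k
      rw [Finset.sum_comm]
      refine (Finset.sum_le_card_nsmul _ _ (ρ / (L * J)) fun k' _ => ?_).trans (le_of_eq ?_)
      · by_cases hk : k' = k
        · simp [hk]; positivity
        · simp only [ne_eq, hk, not_false_eq_true, if_true]
          exact hpair k k' hk
      · simp only [Finset.card_univ, Fintype.card_prod, Fintype.card_fin, nsmul_eq_mul,
          Nat.cast_mul]
        field_simp
    refine (Finset.sum_le_card_nsmul _ _ _ fun k _ => this k).trans (le_of_eq ?_)
    simp only [Finset.card_univ, Fintype.card_prod, Fintype.card_fin, nsmul_eq_mul, Nat.cast_mul]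
  have hsplit : ∀ (P a b d e : (Fin L × Fin J → U) → ℝ),
      ∑ c, P c * (a c + b c + d c + M' * (κ + 1 / L + 1 / L * e c)) =
      ∑ c, P c * a c + ∑ c, P c * b c + ∑ c, P c * d c +
        M' * ((κ + 1 / L) * ∑ c, P c + 1 / L * ∑ c, P c * e c) := by
    intro P a b d e
    simp only [Finset.mul_sum, ← Finset.sum_add_distrib]
    exact Finset.sum_congr rfl fun c _ => by ring
  rw [hsplit, hprod1, h2]
  have h5 : 1 / (L : ℝ) * ∑ c : Fin L × Fin J → U, (∏ k, pU (c k)) *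
      ∑ k, ∑ k', (if k' ≠ k then
        v (c k) / (L * J * pU (c k)) * (if T (c k') z then 1 else 0) else 0) ≤ J * ρ := by
    refine (mul_le_mul_of_nonneg_left h4 (by positivity)).trans (le_of_eq ?_)
    field_simp
  have h6 := mul_le_mul_of_nonneg_left (add_le_add (le_refl (κ + 1 / (L : ℝ))) h5) hM'
  rw [mul_one]
  linarith

end OneShot

section OneShot

variable {A B E H U : Type*} [Fintype A] [Fintype B] [Fintype E] [Fintype U] {L J : ℕ}

open Classical in
/-- One-shot achievability for content identification with lossy recovery. -/
theorem exists_oneShot_code [Nonempty H] {p : A → B → ℝ} (hp0 : ∀ x y, 0 ≤ p x y)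
    (hp1 : ∑ x, ∑ y, p x y = 1) {W : A → E → ℝ} (hW0 : ∀ x z, 0 ≤ W x z)
    (hW1 : ∀ x, ∑ z, W x z = 1) {V : U → B → ℝ} (hV0 : ∀ u y, 0 ≤ V u y)
    (hV1 : ∀ y, ∑ u, V u y = 1) {pB : B → ℝ} (hpB : ∀ y, pB y = ∑ x, p x y)
    {pU : U → ℝ} (hpU : ∀ u, pU u = ∑ y, pB y * V u y)
    {T : U → E → Prop} {G : U → A → B → E → Prop}
    {φ : U → E → H} {Bad : A → H → Prop} {κ ρ τ η : ℝ} (hκ : 0 ≤ κ) (hτ : 0 < τ) (hη : 0 < η)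
    (hG : ∀ u x y z, G u x y z → T u z ∧ ¬ Bad x (φ u z) ∧ pB y ≤ κ)
    (hρ : ∀ z, ∑ u, pU u * (if T u z then 1 else 0) ≤ ρ)
    {M : ℕ} (hM : 0 < M) (hL : 0 < L) (hJ : 0 < J) :
    ∃ (f : B → Option (Fin L)) (g : (Fin M → Option (Fin L)) → E → Fin M)
      (h : Option (Fin L) → E → H), oneShotErr p W Bad f g h ≤
        ∑ u, ∑ x, ∑ y, ∑ z, p x y * W x z * V u y * (if G u x y z then 0 else 1) +
        ∑ u, ∑ y, pB y * V u y * (if τ * pU u < V u y then 1 else 0) + η + τ / (L * J * η) +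
        (J - 1) * ρ + (M - 1) * (κ + 1 / L + J * ρ) := by
  have hL' : (0 : ℝ) < L := by exact_mod_cast hL
  have hJ' : (0 : ℝ) < J := by exact_mod_cast hJ
  have hM1 : (0 : ℝ) ≤ M - 1 := by
    have : (1 : ℝ) ≤ M := by exact_mod_cast hM
    linarith
  have hpB0 : ∀ y, 0 ≤ pB y := fun y => by
    rw [hpB]; exact Finset.sum_nonneg fun x _ => hp0 x y
  have hpB1 : ∑ y, pB y = 1 := by
    simp_rw [hpB]; rw [Finset.sum_comm]; exact hp1
  have hU0 : ∀ u, 0 ≤ pU u := fun u => by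
    rw [hpU]; exact Finset.sum_nonneg fun y _ => mul_nonneg (hpB0 y) (hV0 u y)
  have hU1 : ∑ u, pU u = 1 := by
    simp_rw [hpU]; rw [Finset.sum_comm]
    simp_rw [← Finset.mul_sum, hV1, mul_one, hpB1]
  have hpos : ∀ y, 0 < pB y → ∀ u, 0 < V u y → 0 < pU u := by
    intro y hy u hu
    rw [hpU]
    exact (mul_pos hy hu).trans_le (Finset.single_le_sum
      (f := fun y => pB y * V u y) (fun y _ => mul_nonneg (hpB0 y) (hV0 u y)) (Finset.mem_univ y))
  have hweight : ∑ x, ∑ y, ∑ z, p x y * W x z = 1 := by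
    simp_rw [← Finset.mul_sum, hW1, mul_one, hp1]
  let wt : (Fin L × Fin J → U) → B → Fin L × Fin J → ℝ :=
    fun c y k => V (c k) y / (L * J * pU (c k))
  have hwt : ∀ c y k, 0 ≤ wt c y k := fun c y k =>
    div_nonneg (hV0 _ _) (mul_nonneg (by positivity) (hU0 _))
  have hbar : ∀ c k, ∑ y, pB y * wt c y k ≤ 1 / (L * J) := by
    intro c k
    simp only [wt, ← mul_div_assoc]
    rw [← Finset.sum_div, ← hpU]
    rcases (hU0 (c k)).eq_or_lt with h | h
    · rw [← h]; simp; positivity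
    · apply le_of_eq; field_simp
  let Φ : (Fin L × Fin J → U) → A → B → E → ℝ := fun c x y z =>
    max 0 (1 - ∑ k, wt c y k) + ∑ k, wt c y k * (if G (c k) x y z then 0 else 1) +
      ∑ k : Fin L × Fin J, ∑ j, (if j ≠ k.2 then
        wt c y k * (if T (c (k.1, j)) z then 1 else 0) else 0) +
      ((M : ℝ) - 1) * (κ + 1 / L + 1 / L * ∑ k, ∑ k', (if k' ≠ k then
        wt c y k * (if T (c k') z then 1 else 0) else 0))
  obtain ⟨c, hc⟩ : ∃ c : Fin L × Fin J → U, ∑ x, ∑ y, ∑ z, p x y * W x z * Φ c x y z ≤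
      ∑ u, ∑ x, ∑ y, ∑ z, p x y * W x z * V u y * (if G u x y z then 0 else 1) +
        ∑ u, ∑ y, pB y * V u y * (if τ * pU u < V u y then 1 else 0) + η + τ / (L * J * η) +
        (J - 1) * ρ + (M - 1) * (κ + 1 / L + J * ρ) := by
    refine exists_le_of_sum_mul_le (w := fun c => ∏ k, pU (c k))
      (fun c => Finset.prod_nonneg fun k _ => hU0 _)
      (sum_pi_eq_one (p := fun _ => pU) (fun _ => hU1)) ?_
    calc _ = ∑ x, ∑ y, ∑ z, p x y * W x z * ∑ c : Fin L × Fin J → U,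
          (∏ k, pU (c k)) * Φ c x y z := by
          simp_rw [Finset.mul_sum]
          rw [Finset.sum_comm]
          refine Finset.sum_congr rfl fun x _ => ?_
          rw [Finset.sum_comm]
          refine Finset.sum_congr rfl fun y _ => ?_
          rw [Finset.sum_comm]
          refine Finset.sum_congr rfl fun z _ => Finset.sum_congr rfl fun c _ => ?_
          ring
      _ ≤ ∑ x, ∑ y, ∑ z, p x y * W x z *
          (∑ u, V u y * (if τ * pU u < V u y then 1 else 0) +
            ∑ u, V u y * (if G u x y z then 0 else 1) + (η + τ / (L * J * η) + (J - 1) * ρ +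
            (M - 1) * (κ + 1 / L + J * ρ))) := by
          refine Finset.sum_le_sum fun x _ => Finset.sum_le_sum fun y _ =>
            Finset.sum_le_sum fun z _ => ?_
          -- The codebook bound needs `pU` to be positive where `V · y` is, which is guaranteed only
          -- for `y` of positive probability.
          rcases (hp0 x y).eq_or_lt with h | h
          · simp [← h]
          · have hy : 0 < pB y := by
              rw [hpB]
              exact h.trans_le (Finset.single_le_sum (f := fun x => p x y)
                (fun x _ => hp0 x y) (Finset.mem_univ x))
            refine mul_le_mul_of_nonneg_left ?_ (mul_nonneg h.le (hW0 _ _))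
            have := sum_codebook_bound_le (κ := κ) (G := G) hL hJ hU1 hU0 (fun u => hV0 u y)
              (hV1 y) (hpos y hy) hτ hη hM1 x y z (hρ z)
            refine this.trans (le_of_eq ?_)
            ring
      _ = _ := by
          simp_rw [mul_add _ (_ + _) (_ + _ + _ + _), mul_add _ (Finset.sum _ _) (Finset.sum _ _),
            Finset.sum_add_distrib, ← Finset.sum_mul, hweight]
          have e1 : ∑ x, ∑ y, (∑ z, p x y * W x z) *
              ∑ u, V u y * (if τ * pU u < V u y then 1 else 0)
              = ∑ u, ∑ y, pB y * V u y * (if τ * pU u < V u y then 1 else 0) := by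
            simp_rw [← Finset.mul_sum, hW1, mul_one]
            rw [Finset.sum_comm]
            simp_rw [← Finset.sum_mul, ← hpB, Finset.mul_sum]
            rw [Finset.sum_comm]
            simp_rw [mul_assoc]
          have e2 : ∑ x, ∑ y, ∑ z, p x y * W x z * ∑ u, V u y * (if G u x y z then 0 else 1)
              = ∑ u, ∑ x, ∑ y, ∑ z, p x y * W x z * V u y * (if G u x y z then 0 else 1) := by
            simp_rw [Finset.mul_sum]
            rw [eq_comm, Finset.sum_comm]
            refine Finset.sum_congr rfl fun x _ => ?_
            rw [Finset.sum_comm]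
            refine Finset.sum_congr rfl fun y _ => ?_
            rw [Finset.sum_comm]
            refine Finset.sum_congr rfl fun z _ => Finset.sum_congr rfl fun u _ => ?_
            ring
          rw [e1, e2]
          ring
  obtain ⟨f, hf⟩ := exists_encoder_le (φ := φ) (Bad := Bad) hp0 hp1 hW0 hκ
    (fun u x y z h => by rw [← hpB]; exact hG u x y z h) c hM (wt c) (hwt c)
  refine ⟨_, _, _, hf.trans (le_trans ?_ hc)⟩
  refine Finset.sum_le_sum fun x _ => Finset.sum_le_sum fun y _ => Finset.sum_le_sum fun z _ =>
    mul_le_mul_of_nonneg_left ?_ (mul_nonneg (hp0 _ _) (hW0 _ _))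
  simp_rw [← hpB]
  exact encoder_bound_le c hL hJ (hwt c) hpB0 (hbar c) hM1 x y z

end OneShot

/-! ### Single-letter information quantities -/

/-- Summed `log s ≤ s - 1`. Data processing, the entropy inequalities and the Fano bound below all
come from a suitable ratio `s`. -/
lemma sum_mul_log_nonpos {ι : Type*} [Fintype ι] {w s : ι → ℝ} (hw : ∀ i, 0 ≤ w i)
    (hs : ∀ i, 0 < w i → 0 < s i) (h : ∑ i, w i * s i ≤ ∑ i, w i) :
    ∑ i, w i * Real.log (s i) ≤ 0 := by
  have h1 : ∑ i, w i * Real.log (s i) ≤ ∑ i, (w i * s i - w i) := by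
    refine Finset.sum_le_sum fun i _ => ?_
    rcases (hw i).eq_or_lt with h0 | h0
    · simp [← h0]
    · have := Real.log_le_sub_one_of_pos (hs i h0)
      nlinarith
  rw [Finset.sum_sub_distrib] at h1
  linarith

section SingleLetter

variable {Y Z Xh : Type*} [Fintype Y] [Fintype Z]

/-- The contribution of one symbol `u`, with `v y = P (u | y)`, to `I(Y;U)`. -/
noncomputable def rateY (pY : Y → ℝ) (v : Y → ℝ) : ℝ :=
  ∑ y, pY y * v y * Real.log (v y / ∑ y', pY y' * v y')

/-- The contribution of one symbol `u`, with `v y = P (u | y)`, to `I(Z;U)`. -/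
noncomputable def rateZ (p : Y → Z → ℝ) (v : Y → ℝ) : ℝ :=
  ∑ z, (∑ y, p y z * v y) *
    Real.log ((∑ y, p y z * v y) / ((∑ y, p y z) * ∑ y, (∑ z, p y z) * v y))

/-- The contribution of one symbol `u`, with `v y = P (u | y)`, to the expected distortion. -/
def cost (p : Y → Z → ℝ) (e : Y → Z → Xh → ℝ) (v : Y → ℝ) (φ : Z → Xh) : ℝ :=
  ∑ y, ∑ z, p y z * v y * e y z (φ z)

/-- `V u y` is the conditional probability of `u` given `y`. -/
structure IsTestChannel {U : Type*} [Fintype U] (V : U → Y → ℝ) : Prop where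
  nonneg : ∀ u y, 0 ≤ V u y
  sum_eq_one : ∀ y, ∑ u, V u y = 1

variable {U : Type*} [Fintype U]

lemma sum_rateY_eq {p : Y → Z → ℝ} (V : U → Y → ℝ) :
    ∑ u, rateY (fun y => ∑ z, p y z) (V u) = ∑ s : U × Y × Z, p s.2.1 s.2.2 * V s.1 s.2.1 *
      Real.log (V s.1 s.2.1 / ∑ y, (∑ z, p y z) * V s.1 y) := by
  simp only [rateY, Fintype.sum_prod_type]
  refine Finset.sum_congr rfl fun u _ => Finset.sum_congr rfl fun y _ => ?_
  rw [← Finset.sum_mul, ← Finset.sum_mul]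

lemma sum_rateZ_eq {p : Y → Z → ℝ} (V : U → Y → ℝ) :
    ∑ u, rateZ p (V u) = ∑ s : U × Y × Z, p s.2.1 s.2.2 * V s.1 s.2.1 *
      Real.log ((∑ y, p y s.2.2 * V s.1 y) /
        ((∑ y, p y s.2.2) * ∑ y, (∑ z, p y z) * V s.1 y)) := by
  simp only [rateZ, Fintype.sum_prod_type]
  refine Finset.sum_congr rfl fun u _ => ?_
  rw [Finset.sum_comm]
  refine Finset.sum_congr rfl fun z _ => ?_
  rw [← Finset.sum_mul]

lemma sum_joint_eq_one {p : Y → Z → ℝ} (hp1 : ∑ y, ∑ z, p y z = 1) {V : U → Y → ℝ}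
    (hV : IsTestChannel V) : ∑ s : U × Y × Z, p s.2.1 s.2.2 * V s.1 s.2.1 = 1 := by
  simp only [Fintype.sum_prod_type]
  rw [Finset.sum_comm, ← hp1]
  refine Finset.sum_congr rfl fun y _ => ?_
  rw [Finset.sum_comm]
  refine Finset.sum_congr rfl fun z _ => ?_
  rw [← Finset.mul_sum, hV.sum_eq_one, mul_one]

lemma joint_marginals_pos {p : Y → Z → ℝ} (hp0 : ∀ y z, 0 ≤ p y z)
    {V : U → Y → ℝ} (hV : IsTestChannel V) {u : U} {y : Y} {z : Z} (h : 0 < p y z * V u y) :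
    0 < V u y ∧ 0 < ∑ z, p y z ∧ 0 < ∑ y, p y z ∧ 0 < ∑ y, p y z * V u y ∧
      0 < ∑ y, (∑ z, p y z) * V u y := by
  have hV' : 0 < V u y := (pos_iff_pos_of_mul_pos h).1 (lt_of_le_of_ne (hp0 _ _) fun h0 => by
    simp [← h0] at h)
  have hp : 0 < p y z := by
    by_contra hc
    have := mul_nonpos_of_nonpos_of_nonneg (not_lt.1 hc) hV'.le
    linarith
  have hY : 0 < ∑ z, p y z := hp.trans_le
    (Finset.single_le_sum (f := fun z => p y z) (fun z _ => hp0 y z) (Finset.mem_univ z))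
  refine ⟨hV', hY, ?_, ?_, ?_⟩
  · exact hp.trans_le
      (Finset.single_le_sum (f := fun y => p y z) (fun y _ => hp0 y z) (Finset.mem_univ y))
  · exact h.trans_le (Finset.single_le_sum (f := fun y => p y z * V u y)
      (fun y _ => mul_nonneg (hp0 y z) (hV.nonneg u y)) (Finset.mem_univ y))
  · exact (mul_pos hY hV').trans_le (Finset.single_le_sum (f := fun y => (∑ z, p y z) * V u y)
      (fun y _ => mul_nonneg (Finset.sum_nonneg fun z _ => hp0 y z) (hV.nonneg u y))
      (Finset.mem_univ y))

/-- The data processing inequality `I(Z;U) ≤ I(Y;U)` for `U → Y → Z`. -/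
lemma sum_rateZ_le_sum_rateY {p : Y → Z → ℝ} (hp0 : ∀ y z, 0 ≤ p y z)
    (hp1 : ∑ y, ∑ z, p y z = 1) {V : U → Y → ℝ} (hV : IsTestChannel V) :
    ∑ u, rateZ p (V u) ≤ ∑ u, rateY (fun y => ∑ z, p y z) (V u) := by
  rw [sum_rateY_eq, sum_rateZ_eq, ← sub_nonpos, ← Finset.sum_sub_distrib]
  have hw : ∀ s : U × Y × Z, 0 ≤ p s.2.1 s.2.2 * V s.1 s.2.1 := fun s =>
    mul_nonneg (hp0 _ _) (hV.nonneg _ _)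
  -- The ratio is P(u | z) / P(u | y).
  refine le_trans (le_of_eq ?_) (sum_mul_log_nonpos hw
    (s := fun s => (∑ y, p y s.2.2 * V s.1 y) / ((∑ y, p y s.2.2) * V s.1 s.2.1)) ?_ ?_)
  · refine Finset.sum_congr rfl fun s _ => ?_
    rcases (hw s).eq_or_lt with h | h
    · simp [← h]
    · obtain ⟨h1, h2, h3, h4, h5⟩ := joint_marginals_pos hp0 hV h
      rw [← mul_sub, Real.log_div (by positivity) (by positivity),
        Real.log_div (by positivity) (by positivity), Real.log_div (by positivity) (by positivity),
        Real.log_mul (by positivity) (by positivity), Real.log_mul (by positivity) (by positivity)]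
      ring
  · intro s h
    obtain ⟨h1, h2, h3, h4, h5⟩ := joint_marginals_pos hp0 hV h
    positivity
  · rw [sum_joint_eq_one hp1 hV]
    calc _ ≤ ∑ s : U × Y × Z, p s.2.1 s.2.2 * (∑ y, p y s.2.2 * V s.1 y) / (∑ y, p y s.2.2) := by
          refine Finset.sum_le_sum fun s _ => ?_
          rcases (hw s).eq_or_lt with h | h
          · rw [← h, zero_mul]
            exact div_nonneg (mul_nonneg (hp0 _ _) (Finset.sum_nonneg fun y _ =>
              mul_nonneg (hp0 _ _) (hV.nonneg _ _))) (Finset.sum_nonneg fun y _ => hp0 _ _)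
          · obtain ⟨h1, h2, h3, h4, h5⟩ := joint_marginals_pos hp0 hV h
            apply le_of_eq
            field_simp
      _ = ∑ u, ∑ z, (∑ y, p y z) * (∑ y, p y z * V u y) / (∑ y, p y z) := by
          simp only [Fintype.sum_prod_type]
          refine Finset.sum_congr rfl fun u _ => ?_
          rw [Finset.sum_comm]
          refine Finset.sum_congr rfl fun z _ => ?_
          rw [← Finset.sum_div, ← Finset.sum_mul]
      _ ≤ ∑ u, ∑ z, ∑ y, p y z * V u y := by
          refine Finset.sum_le_sum fun u _ => Finset.sum_le_sum fun z _ => ?_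
          have h4 : 0 ≤ ∑ y, p y z * V u y := Finset.sum_nonneg fun y _ =>
              mul_nonneg (hp0 _ _) (hV.nonneg _ _)
          rcases (Finset.sum_nonneg fun y (_ : y ∈ Finset.univ) => hp0 y z).eq_or_lt with h | h
          · rw [← h]; simpa using h4
          · rw [mul_div_assoc, mul_div_cancel₀ _ h.ne']
      _ = 1 := by
          rw [← sum_joint_eq_one hp1 hV]
          simp only [Fintype.sum_prod_type]
          refine Finset.sum_congr rfl fun u _ => ?_
          rw [Finset.sum_comm]

/-- `I(Z;U) ≤ H(Y)` for `U → Y → Z`. -/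
lemma sum_rateZ_le_entropy {p : Y → Z → ℝ} (hp0 : ∀ y z, 0 ≤ p y z)
    (hp1 : ∑ y, ∑ z, p y z = 1) {V : U → Y → ℝ} (hV : IsTestChannel V) :
    ∑ u, rateZ p (V u) ≤ ∑ y, (∑ z, p y z) * -Real.log (∑ z, p y z) := by
  have hH : ∑ y, (∑ z, p y z) * -Real.log (∑ z, p y z) = ∑ s : U × Y × Z,
      p s.2.1 s.2.2 * V s.1 s.2.1 * -Real.log (∑ z, p s.2.1 z) := by
    simp only [Fintype.sum_prod_type]
    rw [Finset.sum_comm]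
    refine Finset.sum_congr rfl fun y _ => ?_
    rw [Finset.sum_comm, Finset.sum_mul]
    refine Finset.sum_congr rfl fun z _ => ?_
    rw [← Finset.sum_mul, ← Finset.mul_sum, hV.sum_eq_one, mul_one]
  rw [hH, sum_rateZ_eq, ← sub_nonpos, ← Finset.sum_sub_distrib]
  have hw : ∀ s : U × Y × Z, 0 ≤ p s.2.1 s.2.2 * V s.1 s.2.1 := fun s =>
    mul_nonneg (hp0 _ _) (hV.nonneg _ _)
  refine le_trans (le_of_eq ?_) (sum_mul_log_nonpos hw
    (s := fun s => (∑ y, p y s.2.2 * V s.1 y) /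
      ((∑ y, p y s.2.2) * ∑ y, (∑ z, p y z) * V s.1 y) * ∑ z, p s.2.1 z) ?_ ?_)
  · refine Finset.sum_congr rfl fun s _ => ?_
    rcases (hw s).eq_or_lt with h | h
    · simp [← h]
    · obtain ⟨h1, h2, h3, h4, h5⟩ := joint_marginals_pos hp0 hV h
      rw [Real.log_mul (by positivity) (by positivity)]
      ring
  · intro s h
    obtain ⟨h1, h2, h3, h4, h5⟩ := joint_marginals_pos hp0 hV h
    positivity
  · rw [sum_joint_eq_one hp1 hV]
    calc _ ≤ ∑ s : U × Y × Z, V s.1 s.2.1 * (∑ z, p s.2.1 z) * ((∑ y, p y s.2.2 * V s.1 y) /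
          ∑ y, (∑ z, p y z) * V s.1 y) := by
          refine Finset.sum_le_sum fun s _ => ?_
          rcases (hw s).eq_or_lt with h | h
          · rw [← h, zero_mul]
            refine mul_nonneg (mul_nonneg (hV.nonneg _ _) (Finset.sum_nonneg fun y _ => hp0 _ _))
              (div_nonneg (Finset.sum_nonneg fun y _ =>
              mul_nonneg (hp0 _ _) (hV.nonneg _ _)) (Finset.sum_nonneg fun y _ =>
                mul_nonneg (Finset.sum_nonneg fun y _ => hp0 _ _) (hV.nonneg _ _)))
          · obtain ⟨h1, h2, h3, h4, h5⟩ := joint_marginals_pos hp0 hV h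
            have h6 : p s.2.1 s.2.2 ≤ ∑ y, p y s.2.2 :=
              Finset.single_le_sum (f := fun y => p y s.2.2) (fun y _ => hp0 y _)
                (Finset.mem_univ s.2.1)
            -- The factor P(y | z) ≤ 1 is given away here; after that the terms sum to at most one.
            have h7 : p s.2.1 s.2.2 / (∑ y, p y s.2.2) ≤ 1 := (div_le_one h3).2 h6
            calc _ = p s.2.1 s.2.2 / (∑ y, p y s.2.2) * (V s.1 s.2.1 * (∑ z, p s.2.1 z) *
                  ((∑ y, p y s.2.2 * V s.1 y) / ∑ y, (∑ z, p y z) * V s.1 y)) := by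
                  field_simp
              _ ≤ _ := mul_le_of_le_one_left (by positivity) h7
      _ = ∑ u, (∑ y, (∑ z, p y z) * V u y) * ((∑ y, (∑ z, p y z) * V u y) /
            ∑ y, (∑ z, p y z) * V u y) := by
          simp only [Fintype.sum_prod_type]
          refine Finset.sum_congr rfl fun u _ => ?_
          simp_rw [← Finset.mul_sum, ← Finset.sum_div]
          rw [← Finset.sum_mul]
          congr 1
          · exact Finset.sum_congr rfl fun y _ => mul_comm _ _
          · congr 1
            rw [Finset.sum_comm]
            simp_rw [← Finset.sum_mul]
      _ ≤ ∑ u, ∑ y, (∑ z, p y z) * V u y := by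
          refine Finset.sum_le_sum fun u _ => ?_
          exact mul_le_of_le_one_right (Finset.sum_nonneg fun y _ =>
            mul_nonneg (Finset.sum_nonneg fun y _ => hp0 _ _) (hV.nonneg _ _)) (div_self_le_one _)
      _ = 1 := by
          rw [Finset.sum_comm]
          simp_rw [← Finset.mul_sum, hV.sum_eq_one, mul_one, hp1]

end SingleLetter

/-! ### Achievability with block codes -/

section Block

variable {X Y Z Xh U : Type*} [Fintype X] [Fintype Y] [Fintype Z] [Fintype U]

/-- The joint mass function of `(Y, Z)`. -/
def pairYZ (PX : X → ℝ) (PYX : X → Y → ℝ) (PZX : X → Z → ℝ) (y : Y) (z : Z) : ℝ :=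
  ∑ x, PX x * PYX x y * PZX x z

/-- The conditional expectation of the distortion given `(Y, Z)`. -/
noncomputable def condDist (PX : X → ℝ) (PYX : X → Y → ℝ) (PZX : X → Z → ℝ) (d : X → Xh → ℝ)
    (y : Y) (z : Z) (xh : Xh) : ℝ :=
  (∑ x, PX x * PYX x y * PZX x z * d x xh) / pairYZ PX PYX PZX y z

variable {PX : X → ℝ} {PYX : X → Y → ℝ} {PZX : X → Z → ℝ} {d : X → Xh → ℝ}

lemma pairYZ_nonneg (hPX : PX ∈ stdSimplex ℝ X)
    (hPYX : ∀ x, PYX x ∈ stdSimplex ℝ Y) (hPZX : ∀ x, PZX x ∈ stdSimplex ℝ Z) (y : Y) (z : Z) :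
    0 ≤ pairYZ PX PYX PZX y z :=
  Finset.sum_nonneg fun x _ => mul_nonneg (mul_nonneg (hPX.1 x) ((hPYX x).1 y)) ((hPZX x).1 z)

lemma sum_pairYZ (hPZX : ∀ x, PZX x ∈ stdSimplex ℝ Z) (y : Y) :
    ∑ z, pairYZ PX PYX PZX y z = ∑ x, PX x * PYX x y := by
  simp only [pairYZ]
  rw [Finset.sum_comm]
  simp_rw [← Finset.mul_sum, (hPZX _).2, mul_one]

lemma sum_sum_pairYZ (hPX : PX ∈ stdSimplex ℝ X)
    (hPYX : ∀ x, PYX x ∈ stdSimplex ℝ Y) (hPZX : ∀ x, PZX x ∈ stdSimplex ℝ Z) :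
    ∑ y, ∑ z, pairYZ PX PYX PZX y z = 1 := by
  simp_rw [sum_pairYZ hPZX]
  rw [Finset.sum_comm]
  simp_rw [← Finset.mul_sum, (hPYX _).2, mul_one, hPX.2]

lemma pairYZ_mul_condDist (hPX : PX ∈ stdSimplex ℝ X)
    (hPYX : ∀ x, PYX x ∈ stdSimplex ℝ Y) (hPZX : ∀ x, PZX x ∈ stdSimplex ℝ Z) (y : Y) (z : Z)
    (xh : Xh) : pairYZ PX PYX PZX y z * condDist PX PYX PZX d y z xh =
      ∑ x, PX x * PYX x y * PZX x z * d x xh := by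
  unfold condDist
  by_cases h : pairYZ PX PYX PZX y z = 0
  · have h0 := (Finset.sum_eq_zero_iff_of_nonneg fun x _ => mul_nonneg (mul_nonneg (hPX.1 x)
      ((hPYX x).1 y)) ((hPZX x).1 z)).1 h
    rw [h, zero_mul, eq_comm]
    exact Finset.sum_eq_zero fun x hx => by rw [h0 x hx, zero_mul]
  · rw [mul_div_cancel₀ _ h]

lemma sum_cost_eq (hPX : PX ∈ stdSimplex ℝ X)
    (hPYX : ∀ x, PYX x ∈ stdSimplex ℝ Y) (hPZX : ∀ x, PZX x ∈ stdSimplex ℝ Z) (V : U → Y → ℝ)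
    (φ : U → Z → Xh) :
    ∑ u, cost (pairYZ PX PYX PZX) (condDist PX PYX PZX d) (V u) (φ u) =
      ∑ s : U × X × Y × Z, PX s.2.1 * PYX s.2.1 s.2.2.1 * PZX s.2.1 s.2.2.2 * V s.1 s.2.2.1 *
        d s.2.1 (φ s.1 s.2.2.2) := by
  simp only [cost, Fintype.sum_prod_type]
  refine Finset.sum_congr rfl fun u _ => ?_
  rw [eq_comm, Finset.sum_comm]
  refine Finset.sum_congr rfl fun y _ => ?_
  rw [Finset.sum_comm]
  refine Finset.sum_congr rfl fun z _ => ?_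
  rw [mul_right_comm, pairYZ_mul_condDist hPX hPYX hPZX, Finset.sum_mul]
  refine Finset.sum_congr rfl fun x _ => ?_
  ring

lemma sum_joint_marginal (V : U → Y → ℝ) (F : U → Y → Z → ℝ) :
    ∑ s : U × X × Y × Z, PX s.2.1 * PYX s.2.1 s.2.2.1 * PZX s.2.1 s.2.2.2 * V s.1 s.2.2.1 *
      F s.1 s.2.2.1 s.2.2.2 =
    ∑ s : U × Y × Z, pairYZ PX PYX PZX s.2.1 s.2.2 * V s.1 s.2.1 * F s.1 s.2.1 s.2.2 := by
  simp only [Fintype.sum_prod_type, pairYZ]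
  refine Finset.sum_congr rfl fun u _ => ?_
  rw [Finset.sum_comm]
  refine Finset.sum_congr rfl fun y _ => ?_
  rw [Finset.sum_comm]
  refine Finset.sum_congr rfl fun z _ => ?_
  rw [Finset.sum_mul, Finset.sum_mul]

lemma sum_arrow_prod_four {ι A B C D : Type*} [Fintype ι] [DecidableEq ι] [Fintype A] [Fintype B]
    [Fintype C] [Fintype D] (F : (ι → A) → (ι → B) → (ι → C) → (ι → D) → ℝ) :
    ∑ t : ι → A × B × C × D, F (fun i => (t i).1) (fun i => (t i).2.1) (fun i => (t i).2.2.1)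
      (fun i => (t i).2.2.2) = ∑ a, ∑ b, ∑ c, ∑ e, F a b c e := by
  rw [sum_arrow_prod (fun a (s : ι → B × C × D) => F a (fun i => (s i).1) (fun i => (s i).2.1)
    (fun i => (s i).2.2))]
  refine Finset.sum_congr rfl fun a _ => ?_
  rw [sum_arrow_prod (fun b (s : ι → C × D) => F a b (fun i => (s i).1) (fun i => (s i).2))]
  refine Finset.sum_congr rfl fun b _ => ?_
  rw [sum_arrow_prod (fun c e => F a b c e)]

-- The good event fails only if one of three empirical sums deviates by `n * δ` from its mean: the
-- information density of (U, Z), the distortion, or -log P(y). Each deviation has probability O(1 /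
-- n) by Chebyshev.
open Classical in
lemma sum_block_error_le (hPX : PX ∈ stdSimplex ℝ X)
    (hPYX : ∀ x, PYX x ∈ stdSimplex ℝ Y) (hPZX : ∀ x, PZX x ∈ stdSimplex ℝ Z) {V : U → Y → ℝ}
    (hV : IsTestChannel V) (φ : U → Z → Xh) {D δ : ℝ} (hδ : 0 < δ)
    (hD : ∑ u, cost (pairYZ PX PYX PZX) (condDist PX PYX PZX d) (V u) (φ u) + δ ≤ D) :
    ∃ C : ℝ, ∀ n : ℕ, 0 < n →
      ∑ u : Fin n → U, ∑ x : Fin n → X, ∑ y : Fin n → Y, ∑ z : Fin n → Z,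
        (∏ i, PX (x i) * PYX (x i) (y i)) * (∏ i, PZX (x i) (z i)) * (∏ i, V (u i) (y i)) *
        (if Real.exp (n * (∑ u, rateZ (pairYZ PX PYX PZX) (V u) - δ)) <
            ∏ i, ((∑ y, pairYZ PX PYX PZX y (z i) * V (u i) y) /
              ((∑ y, pairYZ PX PYX PZX y (z i)) *
                ∑ y, (∑ z, pairYZ PX PYX PZX y z) * V (u i) y)) ∧
            ¬ D < blockDist d x (fun i => φ (u i) (z i)) ∧
            ∏ i, (∑ z, pairYZ PX PYX PZX (y i) z) ≤ Real.exp (-(n * (∑ y, (∑ z, pairYZ PX PYX PZX y z) *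
              -Real.log (∑ z, pairYZ PX PYX PZX y z) - δ))) then 0 else 1) ≤ C / n := by
  set p := pairYZ PX PYX PZX with hp
  have hp0 : ∀ y z, 0 ≤ p y z := pairYZ_nonneg hPX hPYX hPZX
  have hp1 : ∑ y, ∑ z, p y z = 1 := sum_sum_pairYZ hPX hPYX hPZX
  set IZ := ∑ u, rateZ p (V u) with hIZ
  set HY := ∑ y, (∑ z, p y z) * -Real.log (∑ z, p y z) with hHY
  set Db := ∑ u, cost p (condDist PX PYX PZX d) (V u) (φ u) with hDb
  let q : U × X × Y × Z → ℝ := fun s =>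
    PX s.2.1 * PYX s.2.1 s.2.2.1 * PZX s.2.1 s.2.2.2 * V s.1 s.2.2.1
  let r : U → Z → ℝ := fun u z => (∑ y, p y z * V u y) /
    ((∑ y, p y z) * ∑ y, (∑ z, p y z) * V u y)
  let h1 : U × X × Y × Z → ℝ := fun s => Real.log (r s.1 s.2.2.2)
  let h2 : U × X × Y × Z → ℝ := fun s => d s.2.1 (φ s.1 s.2.2.2)
  let h3 : U × X × Y × Z → ℝ := fun s => -Real.log (∑ z, p s.2.2.1 z)
  have hq0 : ∀ s, 0 ≤ q s := fun s => mul_nonneg (mul_nonneg (mul_nonneg (hPX.1 _)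
    ((hPYX _).1 _)) ((hPZX _).1 _)) (hV.nonneg _ _)
  have hq1 : ∑ s, q s = 1 := by
    have := sum_joint_marginal (PX := PX) (PYX := PYX) (PZX := PZX) V (fun _ _ _ => 1)
    simp only [mul_one] at this
    exact this.trans (sum_joint_eq_one hp1 hV)
  have hm1 : ∑ s, q s * h1 s = IZ := by
    rw [hIZ, sum_rateZ_eq]
    exact sum_joint_marginal (PX := PX) (PYX := PYX) (PZX := PZX) V
      (fun u y z => Real.log (r u z))
  have hm2 : ∑ s, q s * h2 s = Db := (sum_cost_eq hPX hPYX hPZX V φ).symm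
  have hm3 : ∑ s, q s * h3 s = HY := by
    rw [hHY]
    refine (sum_joint_marginal (PX := PX) (PYX := PYX) (PZX := PZX) V
      (fun u y z => -Real.log (∑ z, p y z))).trans ?_
    simp only [Fintype.sum_prod_type]
    rw [Finset.sum_comm]
    refine Finset.sum_congr rfl fun y _ => ?_
    rw [Finset.sum_comm, Finset.sum_mul]
    refine Finset.sum_congr rfl fun z _ => ?_
    rw [← Finset.sum_mul, ← Finset.mul_sum, hV.sum_eq_one, mul_one]
  refine ⟨(∑ s, q s * (h1 s - IZ) ^ 2) / δ ^ 2 + (∑ s, q s * (h2 s - Db) ^ 2) / δ ^ 2 +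
    (∑ s, q s * (h3 s - HY) ^ 2) / δ ^ 2, fun n hn => ?_⟩
  have hn' : (0 : ℝ) < n := by exact_mod_cast hn
  have c1 := chebyshev_pi hq0 hq1 h1 hm1 hn hδ
  have c2 := chebyshev_pi hq0 hq1 h2 hm2 hn hδ
  have c3 := chebyshev_pi hq0 hq1 h3 hm3 hn hδ
  rw [← sum_arrow_prod_four (fun u x y z =>
        (∏ i, PX (x i) * PYX (x i) (y i)) * (∏ i, PZX (x i) (z i)) * (∏ i, V (u i) (y i)) *
        (if Real.exp (n * (IZ - δ)) < ∏ i, r (u i) (z i) ∧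
            ¬ D < blockDist d x (fun i => φ (u i) (z i)) ∧
            ∏ i, (∑ z, p (y i) z) ≤ Real.exp (-(n * (HY - δ))) then (0 : ℝ) else 1))]
  have hpt : ∀ t : Fin n → U × X × Y × Z,
      (∏ i, PX (t i).2.1 * PYX (t i).2.1 (t i).2.2.1) * (∏ i, PZX (t i).2.1 (t i).2.2.2) *
        (∏ i, V (t i).1 (t i).2.2.1) *
        (if Real.exp (n * (IZ - δ)) < ∏ i, r (t i).1 (t i).2.2.2 ∧
            ¬ D < blockDist d (fun i => (t i).2.1) (fun i => φ (t i).1 (t i).2.2.2) ∧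
            ∏ i, (∑ z, p (t i).2.2.1 z) ≤ Real.exp (-(n * (HY - δ))) then (0 : ℝ) else 1) ≤
      (∏ i, q (t i)) * (if n * δ ≤ |∑ i, h1 (t i) - n * IZ| then 1 else 0) +
      (∏ i, q (t i)) * (if n * δ ≤ |∑ i, h2 (t i) - n * Db| then 1 else 0) +
      (∏ i, q (t i)) * (if n * δ ≤ |∑ i, h3 (t i) - n * HY| then 1 else 0) := by
    intro t
    rw [← Finset.prod_mul_distrib, ← Finset.prod_mul_distrib, ← mul_add, ← mul_add]
    rcases (Finset.prod_nonneg fun i (_ : i ∈ Finset.univ) => hq0 (t i)).eq_or_lt with h0 | h0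
    · have : ∏ i, PX (t i).2.1 * PYX (t i).2.1 (t i).2.2.1 * PZX (t i).2.1 (t i).2.2.2 *
        V (t i).1 (t i).2.2.1 = 0 := h0.symm
      rw [this]; simp
    · refine mul_le_mul_of_nonneg_left ?_ h0.le
      have hqi : ∀ i, 0 < q (t i) := fun i =>
        lt_of_le_of_ne (hq0 _) fun h => h0.ne' (Finset.prod_eq_zero (Finset.mem_univ i) h.symm)
      have hpos : ∀ i, 0 < p (t i).2.2.1 (t i).2.2.2 * V (t i).1 (t i).2.2.1 := by
        intro i
        refine (hqi i).trans_le (mul_le_mul_of_nonneg_right ?_ (hV.nonneg _ _))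
        exact Finset.single_le_sum (f := fun x => PX x * PYX x (t i).2.2.1 * PZX x (t i).2.2.2)
          (fun x _ => mul_nonneg (mul_nonneg (hPX.1 x) ((hPYX x).1 _)) ((hPZX x).1 _))
          (Finset.mem_univ (t i).2.1)
      have hr : ∀ i, 0 < r (t i).1 (t i).2.2.2 := by
        intro i
        obtain ⟨g1, g2, g3, g4, g5⟩ := joint_marginals_pos hp0 hV (hpos i)
        exact div_pos g4 (mul_pos g3 g5)
      have hY : ∀ i, 0 < ∑ z, p (t i).2.2.1 z := fun i =>
        (joint_marginals_pos hp0 hV (hpos i)).2.1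
      have i1 := ind_nonneg (n * δ ≤ |∑ i, h1 (t i) - n * IZ|)
      have i2 := ind_nonneg (n * δ ≤ |∑ i, h2 (t i) - n * Db|)
      have i3 := ind_nonneg (n * δ ≤ |∑ i, h3 (t i) - n * HY|)
      by_cases hA : Real.exp (n * (IZ - δ)) < ∏ i, r (t i).1 (t i).2.2.2
      swap
      · have hle : n * δ ≤ |∑ i, h1 (t i) - n * IZ| := by
          push Not at hA
          have h4 := Real.log_le_log (Finset.prod_pos fun i _ => hr i) hA
          rw [Real.log_exp, Real.log_prod (fun i _ => (hr i).ne')] at h4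
          have : ∑ i, h1 (t i) ≤ n * (IZ - δ) := h4
          rw [abs_sub_comm]
          exact le_trans (by linarith) (le_abs_self _)
        rw [if_pos hle]
        rw [if_neg (fun hc => hA hc.1)]
        linarith
      by_cases hB : D < blockDist d (fun i => (t i).2.1) (fun i => φ (t i).1 (t i).2.2.2)
      · have hle : n * δ ≤ |∑ i, h2 (t i) - n * Db| := by
          have h4 : D < (1 / (n : ℝ)) * ∑ i, h2 (t i) := hB
          rw [one_div, inv_mul_eq_div, lt_div_iff₀ hn'] at h4
          refine le_trans ?_ (le_abs_self _)
          nlinarith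
        rw [if_pos hle, if_neg (fun hc => hc.2.1 hB)]
        linarith
      by_cases hC : ∏ i, (∑ z, p (t i).2.2.1 z) ≤ Real.exp (-(n * (HY - δ)))
      · rw [if_pos ⟨hA, hB, hC⟩]
        linarith
      · have hle : n * δ ≤ |∑ i, h3 (t i) - n * HY| := by
          push Not at hC
          have h4 := Real.log_le_log (Real.exp_pos _) hC.le
          rw [Real.log_exp, Real.log_prod (fun i _ => (hY i).ne')] at h4
          have : ∑ i, h3 (t i) = - ∑ i, Real.log (∑ z, p (t i).2.2.1 z) := by
            simp [h3]
          rw [abs_sub_comm, this]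
          exact le_trans (by linarith) (le_abs_self _)
        rw [if_pos hle, if_neg (fun hc => hC hc.2.2)]
        linarith
  refine (Finset.sum_le_sum fun t _ => hpt t).trans ?_
  rw [Finset.sum_add_distrib, Finset.sum_add_distrib]
  refine (add_le_add (add_le_add c1 c2) c3).trans (le_of_eq ?_)
  field_simp

-- The indicator asks that the information density of (U, Y) exceed its mean by `n * δ`, so this is
-- again Chebyshev.
open Classical in
lemma sum_block_cover_le {pY : Y → ℝ} (hp0 : ∀ y, 0 ≤ pY y) (hp1 : ∑ y, pY y = 1) {V : U → Y → ℝ}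
    (hV : IsTestChannel V) {δ : ℝ} (hδ : 0 < δ) :
    ∃ C : ℝ, ∀ n : ℕ, 0 < n →
      ∑ u : Fin n → U, ∑ y : Fin n → Y, (∏ i, pY (y i)) * (∏ i, V (u i) (y i)) *
        (if Real.exp (n * (∑ u, rateY pY (V u) + δ)) * ∏ i, (∑ y, pY y * V (u i) y) <
          ∏ i, V (u i) (y i) then 1 else 0) ≤ C / n := by
  set IY := ∑ u, rateY pY (V u) with hIY
  let q : U × Y → ℝ := fun s => pY s.2 * V s.1 s.2
  let h1 : U × Y → ℝ := fun s => Real.log (V s.1 s.2 / ∑ y, pY y * V s.1 y)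
  have hq0 : ∀ s, 0 ≤ q s := fun s => mul_nonneg (hp0 _) (hV.nonneg _ _)
  have hq1 : ∑ s, q s = 1 := by
    simp only [q, Fintype.sum_prod_type]
    rw [Finset.sum_comm]
    simp_rw [← Finset.mul_sum, hV.sum_eq_one, mul_one, hp1]
  have hm1 : ∑ s, q s * h1 s = IY := by
    simp only [q, h1, Fintype.sum_prod_type, hIY, rateY]
  refine ⟨(∑ s, q s * (h1 s - IY) ^ 2) / δ ^ 2, fun n hn => ?_⟩
  have c1 := chebyshev_pi hq0 hq1 h1 hm1 hn hδ
  rw [← sum_arrow_prod (fun (u : Fin n → U) (y : Fin n → Y) => (∏ i, pY (y i)) *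
    (∏ i, V (u i) (y i)) * (if Real.exp (n * (IY + δ)) * ∏ i, (∑ y, pY y * V (u i) y) <
          ∏ i, V (u i) (y i) then (1 : ℝ) else 0))]
  refine (Finset.sum_le_sum (g := fun t : Fin n → U × Y => (∏ i, q (t i)) *
    (if n * δ ≤ |∑ i, h1 (t i) - n * IY| then 1 else 0)) fun t _ => ?_).trans
    (c1.trans (le_of_eq (by field_simp)))
  rw [← Finset.prod_mul_distrib]
  rcases (Finset.prod_nonneg fun i (_ : i ∈ Finset.univ) => hq0 (t i)).eq_or_lt with h0 | h0
  · have : ∏ i, pY (t i).2 * V (t i).1 (t i).2 = 0 := h0.symm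
    rw [this]; simp
  refine mul_le_mul_of_nonneg_left ?_ h0.le
  have hqi : ∀ i, 0 < q (t i) := fun i =>
    lt_of_le_of_ne (hq0 _) fun h => h0.ne' (Finset.prod_eq_zero (Finset.mem_univ i) h.symm)
  have hVi : ∀ i, 0 < V (t i).1 (t i).2 := fun i =>
    lt_of_le_of_ne (hV.nonneg _ _) fun h => (hqi i).ne' (by simp [q, ← h])
  have hUi : ∀ i, 0 < ∑ y, pY y * V (t i).1 y := fun i => (hqi i).trans_le
    (Finset.single_le_sum (f := fun y => pY y * V (t i).1 y)
      (fun y _ => mul_nonneg (hp0 _) (hV.nonneg _ _)) (Finset.mem_univ (t i).2))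
  split_ifs with ha hb hb
  · exact le_rfl
  · exfalso
    apply hb
    rw [← lt_div_iff₀ (Finset.prod_pos fun i _ => hUi i), ← Finset.prod_div_distrib] at ha
    have h4 := Real.log_le_log (Real.exp_pos _) ha.le
    rw [Real.log_exp, Real.log_prod (fun i _ => (div_pos (hVi i) (hUi i)).ne')] at h4
    have : n * (IY + δ) ≤ ∑ i, h1 (t i) := h4
    exact le_trans (by linarith) (le_abs_self _)
  · exact zero_le_one
  · exact le_rfl

end Block

section Block

variable {X Y Z Xh U : Type*} [Fintype X] [Fintype Y] [Fintype Z] [Fintype U]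
  {PX : X → ℝ} {PYX : X → Y → ℝ} {PZX : X → Z → ℝ} {d : X → Xh → ℝ}

/-- The failure symbol `none` needs a codeword of its own, hence `L + 1`. -/
lemma exists_code_of_oneShot {D : ℝ} {n M L : ℕ} (hM : 0 < M)
    (f : (Fin n → Y) → Option (Fin L)) (g : (Fin M → Option (Fin L)) → (Fin n → Z) → Fin M)
    (h : Option (Fin L) → (Fin n → Z) → (Fin n → Xh)) :
    ∃ C : Code Y Z Xh n, C.M = M ∧ C.L = L + 1 ∧ errProb PX PYX PZX d D C =
      oneShotErr (fun x y => ∏ i, PX (x i) * PYX (x i) (y i)) (fun x z => ∏ i, PZX (x i) (z i))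
        (fun x xh => D < blockDist d x xh) f g h := by
  refine ⟨⟨M, L + 1, hM, Nat.succ_pos L, fun y => (finSuccEquiv L).symm (f y),
    fun s z => g (fun m => finSuccEquiv L (s m)) z, fun l z => h (finSuccEquiv L l) z⟩,
    rfl, rfl, ?_⟩
  simp only [errProb, oneShotErr, Equiv.apply_symm_apply]

/-- Random coding bound for block codes. -/
theorem exists_block_code [Nonempty Xh] (hPX : PX ∈ stdSimplex ℝ X)
    (hPYX : ∀ x, PYX x ∈ stdSimplex ℝ Y) (hPZX : ∀ x, PZX x ∈ stdSimplex ℝ Z) {V : U → Y → ℝ}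
    (hV : IsTestChannel V) (φ : U → Z → Xh) {D δ : ℝ} (hδ : 0 < δ)
    (hD : ∑ u, cost (pairYZ PX PYX PZX) (condDist PX PYX PZX d) (V u) (φ u) + δ ≤ D) {IZ IY HY : ℝ}
    (hIZ : IZ = ∑ u, rateZ (pairYZ PX PYX PZX) (V u))
    (hIY : IY = ∑ u, rateY (fun y => ∑ z, pairYZ PX PYX PZX y z) (V u))
    (hHY : HY = ∑ y, (∑ z, pairYZ PX PYX PZX y z) * -Real.log (∑ z, pairYZ PX PYX PZX y z)) :
    ∃ K : ℝ, ∀ n M L J : ℕ, 0 < n → 0 < M → 0 < L → 0 < J → ∀ η : ℝ, 0 < η →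
      ∃ C : Code Y Z Xh n, C.M = M ∧ C.L = L + 1 ∧ errProb PX PYX PZX d D C ≤
        K / n + η + Real.exp (n * (IY + δ)) / (L * J * η) + (J - 1) * Real.exp (-(n * (IZ - δ))) +
        (M - 1) * (Real.exp (-(n * (HY - δ))) + 1 / L + J * Real.exp (-(n * (IZ - δ)))) := by
  classical
  set p := pairYZ PX PYX PZX with hp
  have hp0 : ∀ y z, 0 ≤ p y z := pairYZ_nonneg hPX hPYX hPZX
  have hp1 : ∑ y, ∑ z, p y z = 1 := sum_sum_pairYZ hPX hPYX hPZX
  have hpY0 : ∀ y, 0 ≤ ∑ z, p y z := fun y => Finset.sum_nonneg fun z _ => hp0 y z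
  obtain ⟨K1, hK1⟩ := sum_block_error_le hPX hPYX hPZX hV φ hδ hD
  obtain ⟨K2, hK2⟩ := sum_block_cover_le hpY0 hp1 hV hδ
  refine ⟨K1 + K2, fun n M L J hn hM hL hJ η hη => ?_⟩
  have hK1 := hK1 n hn
  have hK2 := hK2 n hn
  rw [← hp, ← hIZ, ← hHY] at hK1
  rw [← hIY] at hK2
  let r : U → Z → ℝ := fun u z => (∑ y, p y z * V u y) /
    ((∑ y, p y z) * ∑ y, (∑ z, p y z) * V u y)
  have hpU0 : ∀ u, 0 ≤ ∑ y, (∑ z, p y z) * V u y := fun u =>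
    Finset.sum_nonneg fun y _ => mul_nonneg (hpY0 y) (hV.nonneg u y)
  have hUZ0 : ∀ u z, 0 ≤ ∑ y, p y z * V u y := fun u z =>
    Finset.sum_nonneg fun y _ => mul_nonneg (hp0 y z) (hV.nonneg u y)
  have hpZ0 : ∀ z, 0 ≤ ∑ y, p y z := fun z => Finset.sum_nonneg fun y _ => hp0 y z
  have hr0 : ∀ u z, 0 ≤ r u z := fun u z =>
    div_nonneg (hUZ0 u z) (mul_nonneg (hpZ0 z) (hpU0 u))
  -- `r u z` is the density of P(u | z) with respect to P(u), so its mean under P(u) is at most one.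
  -- Markov's inequality then bounds the probability that an independent codeword passes the
  -- threshold test on `∏ r`.
  have hr1 : ∀ z, ∑ u, (∑ y, (∑ z, p y z) * V u y) * r u z ≤ 1 := by
    intro z
    calc _ ≤ ∑ u, (∑ y, p y z * V u y) / ∑ y, p y z := by
          refine Finset.sum_le_sum fun u _ => ?_
          simp only [r]
          rcases (hpU0 u).eq_or_lt with h | h
          · rw [← h, zero_mul]; exact div_nonneg (hUZ0 u z) (hpZ0 z)
          · rw [← mul_div_assoc, mul_comm, mul_div_mul_right _ _ h.ne']
      _ = (∑ y, p y z) / ∑ y, p y z := by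
          rw [← Finset.sum_div, Finset.sum_comm]
          simp_rw [← Finset.mul_sum, hV.sum_eq_one, mul_one]
      _ ≤ 1 := div_self_le_one _
  have hone := exists_oneShot_code (A := Fin n → X) (B := Fin n → Y) (E := Fin n → Z)
    (H := Fin n → Xh) (U := Fin n → U) (L := L) (J := J)
    (p := fun x y => ∏ i, PX (x i) * PYX (x i) (y i))
    (fun x y => Finset.prod_nonneg fun i _ => mul_nonneg (hPX.1 _) ((hPYX _).1 _))
    (by
      rw [← sum_arrow_prod (fun (x : Fin n → X) (y : Fin n → Y) =>
        ∏ i, PX (x i) * PYX (x i) (y i))]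
      refine sum_pi_eq_one (p := fun _ (s : X × Y) => PX s.1 * PYX s.1 s.2) fun _ => ?_
      rw [Fintype.sum_prod_type]
      simp_rw [← Finset.mul_sum, (hPYX _).2, mul_one, hPX.2])
    (W := fun x z => ∏ i, PZX (x i) (z i))
    (fun x z => Finset.prod_nonneg fun i _ => (hPZX _).1 _)
    (fun x => sum_pi_eq_one (p := fun i => PZX (x i)) fun i => (hPZX _).2)
    (V := fun u y => ∏ i, V (u i) (y i))
    (fun u y => Finset.prod_nonneg fun i _ => hV.nonneg _ _)
    (fun y => sum_pi_eq_one (p := fun i u => V u (y i)) fun i => hV.sum_eq_one _)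
    (pB := fun y => ∏ i, ∑ z, p (y i) z)
    (fun y => by
      rw [sum_pi_prod (fun i x => PX x * PYX x (y i))]
      exact Finset.prod_congr rfl fun i _ => sum_pairYZ hPZX _)
    (pU := fun u => ∏ i, ∑ y, (∑ z, p y z) * V (u i) y)
    (fun u => by
      rw [← sum_pi_prod (fun i y => (∑ z, p y z) * V (u i) y)]
      simp_rw [Finset.prod_mul_distrib])
    (T := fun u z => Real.exp (n * (IZ - δ)) < ∏ i, r (u i) (z i))
    (G := fun u x y z => Real.exp (n * (IZ - δ)) < ∏ i, r (u i) (z i) ∧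
      ¬ D < blockDist d x (fun i => φ (u i) (z i)) ∧
      ∏ i, (∑ z, p (y i) z) ≤ Real.exp (-(n * (HY - δ))))
    (φ := fun u z i => φ (u i) (z i))
    (Bad := fun x xh => D < blockDist d x xh)
    (κ := Real.exp (-(n * (HY - δ)))) (ρ := Real.exp (-(n * (IZ - δ))))
    (τ := Real.exp (n * (IY + δ))) (η := η) (Real.exp_pos _).le (Real.exp_pos _) hη
    (fun u x y z h => h)
    (fun z => by
      have hprod : ∑ u : Fin n → U, ∏ i, ((∑ y, (∑ z, p y z) * V (u i) y) * r (u i) (z i)) ≤ 1 := by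
        rw [sum_pi_prod (fun i u => (∑ y, (∑ z, p y z) * V u y) * r u (z i))]
        exact Finset.prod_le_one (fun i _ => Finset.sum_nonneg fun u _ =>
          mul_nonneg (hpU0 u) (hr0 _ _)) fun i _ => hr1 _
      calc _ ≤ ∑ u : Fin n → U, (∏ i, ((∑ y, (∑ z, p y z) * V (u i) y) * r (u i) (z i))) *
            Real.exp (-(n * (IZ - δ))) := by
            refine Finset.sum_le_sum fun u _ => ?_
            rw [Finset.prod_mul_distrib, mul_assoc]
            refine mul_le_mul_of_nonneg_left ?_ (Finset.prod_nonneg fun i _ => hpU0 _)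
            split_ifs with hc
            · rw [Real.exp_neg, ← div_eq_mul_inv, one_le_div (Real.exp_pos _)]
              exact hc.le
            · exact mul_nonneg (Finset.prod_nonneg fun i _ => hr0 _ _) (Real.exp_pos _).le
        _ ≤ _ := by
            rw [← Finset.sum_mul]
            exact mul_le_of_le_one_left (Real.exp_pos _).le hprod)
    hM hL hJ
  obtain ⟨f, g, h, hfg⟩ := hone
  obtain ⟨C, hCM, hCL, hCe⟩ := exists_code_of_oneShot (PX := PX) (PYX := PYX) (PZX := PZX) (d := d)
    (D := D) hM f g h
  refine ⟨C, hCM, hCL, hCe.trans_le (hfg.trans ?_)⟩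
  rw [add_div]
  simp only [r]
  linarith [hK1, hK2]

end Block

lemma tendsto_exp_neg_nat_mul {a : ℝ} (ha : 0 < a) :
    Tendsto (fun n : ℕ => Real.exp (-(n * a))) atTop (𝓝 0) :=
  Real.tendsto_exp_neg_atTop_nhds_zero.comp (tendsto_natCast_atTop_atTop.atTop_mul_const ha)

lemma ceil_exp_le (a : ℝ) (ha : 0 ≤ a) : (⌈Real.exp a⌉₊ : ℝ) ≤ 2 * Real.exp a := by
  have h1 := (Nat.ceil_lt_add_one (Real.exp_pos a).le).le
  have h2 := Real.one_le_exp ha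
  linarith

section Block

variable {X Y Z Xh U : Type*} [Fintype X] [Fintype Y] [Fintype Z] [Fintype U]
  {PX : X → ℝ} {PYX : X → Y → ℝ} {PZX : X → Z → ℝ} {d : X → Xh → ℝ}

/-- The exponents are chosen so that `L * J` exceeds exp(n(I(Y;U) + 2δ)), which covers the source,
while `J` stays so small that `M * J` independent codewords rarely pass the test of threshold I(Z;U)
- δ. The terms `M / L` and `M * κ` vanish because I(Z;U) ≤ I(Y;U) and I(Z;U) ≤ H(Y). With a single
item all cross terms disappear, so the bound on `Ri` is needed only for `Ri > 0`. -/
lemma random_coding_bound_le {Ri Rc δ IZ IY HY η K : ℝ} (hδ : 0 < δ) (hη : 0 < η)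
    (h1 : 0 < Ri → Ri + 3 * δ ≤ IZ) (h2 : IY - IZ + 5 * δ ≤ Rc - max Ri 0) (h3 : IZ ≤ IY)
    (h4 : IZ ≤ HY) (n : ℕ) {M L J : ℝ} (hM1 : Ri ≤ 0 → M = 1) (hM2 : M - 1 ≤ Real.exp (n * Ri))
    (hL : Real.exp (n * (Rc - δ)) ≤ L) (hJ : Real.exp (n * (IY + 3 * δ - Rc)) ≤ J)
    (hJ2 : J - 1 ≤ Real.exp (n * (IY + 3 * δ - Rc))) :
    K / n + η + Real.exp (n * (IY + δ)) / (L * J * η) + (J - 1) * Real.exp (-(n * (IZ - δ))) +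
        (M - 1) * (Real.exp (-(n * (HY - δ))) + 1 / L + J * Real.exp (-(n * (IZ - δ)))) ≤
      K / n + η + Real.exp (-(n * δ)) * (1 / η + 5) := by
  have hn : (0 : ℝ) ≤ n := Nat.cast_nonneg n
  have hmax := le_max_right Ri 0
  have hmax' := le_max_left Ri 0
  have e1 : Real.exp (n * (IY + δ)) / (L * J * η) ≤ Real.exp (-(n * δ)) * (1 / η) := by
    have hLJ : Real.exp (n * (IY + 2 * δ)) ≤ L * J := by
      refine le_trans (le_of_eq ?_)
        (mul_le_mul hL hJ (Real.exp_pos _).le ((Real.exp_pos _).le.trans hL))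
      rw [← Real.exp_add]; congr 1; ring
    rw [← div_div, ← div_eq_mul_one_div]
    refine div_le_div_of_nonneg_right ?_ hη.le
    rw [div_le_iff₀ ((Real.exp_pos _).trans_le hLJ)]
    refine le_trans (le_of_eq ?_) (mul_le_mul_of_nonneg_left hLJ (Real.exp_pos _).le)
    rw [← Real.exp_add]; congr 1; ring
  have e2 : (J - 1) * Real.exp (-(n * (IZ - δ))) ≤ Real.exp (-(n * δ)) := by
    refine (mul_le_mul_of_nonneg_right hJ2 (Real.exp_pos _).le).trans ?_
    rw [← Real.exp_add]
    apply Real.exp_le_exp.2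
    nlinarith
  have e3 : (M - 1) * (Real.exp (-(n * (HY - δ))) + 1 / L + J * Real.exp (-(n * (IZ - δ)))) ≤
      Real.exp (-(n * δ)) * 4 := by
    rcases le_or_gt Ri 0 with hR | hR
    · rw [hM1 hR]; simp [(Real.exp_pos _).le]
    · have h1 := h1 hR
      rw [max_eq_left hR.le] at h2
      have hL0 : 0 < L := (Real.exp_pos _).trans_le hL
      have hJ0 : 0 < J := (Real.exp_pos _).trans_le hJ
      have a1 : Real.exp (n * Ri) * Real.exp (-(n * (HY - δ))) ≤ Real.exp (-(n * δ)) := by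
        rw [← Real.exp_add]; apply Real.exp_le_exp.2; nlinarith
      have a2 : Real.exp (n * Ri) * (1 / L) ≤ Real.exp (-(n * δ)) := by
        have : 1 / L ≤ Real.exp (-(n * (Rc - δ))) := by
          rw [Real.exp_neg, ← one_div]
          exact one_div_le_one_div_of_le (Real.exp_pos _) hL
        refine (mul_le_mul_of_nonneg_left this (Real.exp_pos _).le).trans ?_
        rw [← Real.exp_add]; apply Real.exp_le_exp.2; nlinarith
      have a3 : Real.exp (n * Ri) * (J * Real.exp (-(n * (IZ - δ)))) ≤
          2 * Real.exp (-(n * δ)) := by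
        have hJ3 : J ≤ 1 + Real.exp (n * (IY + 3 * δ - Rc)) := by linarith
        have b1 : Real.exp (n * Ri) * Real.exp (-(n * (IZ - δ))) ≤ Real.exp (-(n * δ)) := by
          rw [← Real.exp_add]; apply Real.exp_le_exp.2; nlinarith
        have b2 : Real.exp (n * Ri) * (Real.exp (n * (IY + 3 * δ - Rc)) *
            Real.exp (-(n * (IZ - δ)))) ≤ Real.exp (-(n * δ)) := by
          rw [← Real.exp_add, ← Real.exp_add]; apply Real.exp_le_exp.2; nlinarith
        have := mul_le_mul_of_nonneg_left (mul_le_mul_of_nonneg_right hJ3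
          (Real.exp_pos (-(n * (IZ - δ)))).le) (Real.exp_pos (n * Ri)).le
        rw [add_mul, one_mul, mul_add] at this
        linarith
      have := mul_le_mul_of_nonneg_right hM2 (show 0 ≤ Real.exp (-(n * (HY - δ))) + 1 / L +
        J * Real.exp (-(n * (IZ - δ))) by positivity)
      rw [mul_add, mul_add] at this
      linarith
  linarith

lemma nat_ceil_exp_sub_one_le (a : ℝ) : (⌈Real.exp a⌉₊ : ℝ) - 1 ≤ Real.exp a := by
  linarith [Nat.ceil_lt_add_one (Real.exp_pos a).le]

/-- Achievability of the interior of the single-letter region. -/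
theorem achievable_of_test_channel [Nonempty Xh] (hPX : PX ∈ stdSimplex ℝ X)
    (hPYX : ∀ x, PYX x ∈ stdSimplex ℝ Y) (hPZX : ∀ x, PZX x ∈ stdSimplex ℝ Z) {V : U → Y → ℝ}
    (hV : IsTestChannel V) (φ : U → Z → Xh) {Ri Rc D ε : ℝ} (hε : 0 < ε)
    (h1 : 0 < Ri → Ri < ∑ u, rateZ (pairYZ PX PYX PZX) (V u))
    (h2 : ∑ u, rateY (fun y => ∑ z, pairYZ PX PYX PZX y z) (V u) -
      ∑ u, rateZ (pairYZ PX PYX PZX) (V u) < Rc - max Ri 0)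
    (h3 : ∑ u, cost (pairYZ PX PYX PZX) (condDist PX PYX PZX d) (V u) (φ u) < D) :
    Achievable PX PYX PZX d ε (Ri, Rc, D) := by
  have hp0 : ∀ y z, 0 ≤ pairYZ PX PYX PZX y z := pairYZ_nonneg hPX hPYX hPZX
  have hp1 : ∑ y, ∑ z, pairYZ PX PYX PZX y z = 1 := sum_sum_pairYZ hPX hPYX hPZX
  have hZY := sum_rateZ_le_sum_rateY hp0 hp1 hV
  have hZH := sum_rateZ_le_entropy hp0 hp1 hV
  set IZ := ∑ u, rateZ (pairYZ PX PYX PZX) (V u) with hIZ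
  set IY := ∑ u, rateY (fun y => ∑ z, pairYZ PX PYX PZX y z) (V u) with hIY
  set HY := ∑ y, (∑ z, pairYZ PX PYX PZX y z) * -Real.log (∑ z, pairYZ PX PYX PZX y z) with hHY
  set Db := ∑ u, cost (pairYZ PX PYX PZX) (condDist PX PYX PZX d) (V u) (φ u) with hDb
  obtain ⟨δ, hδ, g1, g2, g3⟩ : ∃ δ : ℝ, 0 < δ ∧ (0 < Ri → Ri + 3 * δ ≤ IZ) ∧
      IY - IZ + 5 * δ ≤ Rc - max Ri 0 ∧ Db + δ ≤ D := by
    by_cases hR : 0 < Ri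
    · refine ⟨min (min ((IZ - Ri) / 3) ((Rc - max Ri 0 - (IY - IZ)) / 5)) (D - Db), ?_, ?_, ?_, ?_⟩
      · have := h1 hR
        refine lt_min (lt_min (by linarith) (by linarith)) (by linarith)
      · intro _
        have := (min_le_left (min ((IZ - Ri) / 3) ((Rc - max Ri 0 - (IY - IZ)) / 5)) (D - Db)).trans
          (min_le_left _ _)
        linarith
      · have := (min_le_left (min ((IZ - Ri) / 3) ((Rc - max Ri 0 - (IY - IZ)) / 5)) (D - Db)).trans
          (min_le_right _ _)
        linarith
      · have := min_le_right (min ((IZ - Ri) / 3) ((Rc - max Ri 0 - (IY - IZ)) / 5)) (D - Db)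
        linarith
    · refine ⟨min ((Rc - max Ri 0 - (IY - IZ)) / 5) (D - Db), lt_min (by linarith) (by linarith),
        fun h => absurd h hR, ?_, ?_⟩
      · have := min_le_left ((Rc - max Ri 0 - (IY - IZ)) / 5) (D - Db)
        linarith
      · have := min_le_right ((Rc - max Ri 0 - (IY - IZ)) / 5) (D - Db)
        linarith
  have hRc : 0 < Rc - δ := by linarith [le_max_right Ri 0]
  obtain ⟨K, hK⟩ := exists_block_code (d := d) hPX hPYX hPZX hV φ hδ g3 hIZ hIY hHY
  have hη : 0 < ε / 2 := by positivity
  have hcode : ∀ n : ℕ, ∃ C : Code Y Z Xh n, 0 < n → Real.exp (n * Ri) ≤ C.M ∧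
      (C.L : ℝ) ≤ 3 * Real.exp (n * (Rc - δ)) ∧ errProb PX PYX PZX d D C ≤
        K / n + ε / 2 + Real.exp (-(n * δ)) * (1 / (ε / 2) + 5) := by
    intro n
    -- Blocklength zero is irrelevant for the limits; any code serves.
    rcases Nat.eq_zero_or_pos n with h0 | hn
    · subst h0
      exact ⟨⟨1, 1, one_pos, one_pos, fun _ => 0, fun _ _ => 0, fun _ _ i => i.elim0⟩,
        fun h => absurd h (lt_irrefl _)⟩
    have hceil : ∀ a : ℝ, 0 < ⌈Real.exp a⌉₊ := fun a => Nat.ceil_pos.2 (Real.exp_pos a)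
    -- For a nonpositive exponent the size is exactly one rather than a rounded exponential; `M = 1`
    -- is what removes the cross terms when `Ri ≤ 0`.
    have hsz : ∀ a : ℝ, ∃ N : ℕ, 0 < N ∧ Real.exp (n * a) ≤ N ∧ (a ≤ 0 → N = 1) ∧
        (N : ℝ) - 1 ≤ Real.exp (n * a) := by
      intro a
      rcases le_or_gt a 0 with ha | ha
      · refine ⟨1, one_pos, ?_, fun _ => rfl, by simp [(Real.exp_pos _).le]⟩
        rw [Nat.cast_one, Real.exp_le_one_iff]
        exact mul_nonpos_of_nonneg_of_nonpos (Nat.cast_nonneg n) ha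
      · exact ⟨⌈Real.exp (n * a)⌉₊, hceil _, Nat.le_ceil _, fun h => absurd h (not_le.2 ha),
          nat_ceil_exp_sub_one_le _⟩
    obtain ⟨M, hM0, hM1, hM2, hM3⟩ := hsz Ri
    obtain ⟨J, hJ0, hJ1, hJ2, hJ3⟩ := hsz (IY + 3 * δ - Rc)
    obtain ⟨C, hCM, hCL, hCe⟩ := hK n M ⌈Real.exp (n * (Rc - δ))⌉₊ J hn hM0 (hceil _) hJ0 (ε / 2) hη
    refine ⟨C, fun _ => ⟨by rw [hCM]; exact hM1, ?_, hCe.trans ?_⟩⟩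
    · rw [hCL]
      push_cast
      have h5 := ceil_exp_le (n * (Rc - δ)) (by positivity)
      have h6 : 1 ≤ Real.exp (n * (Rc - δ)) := Real.one_le_exp (by positivity)
      linarith
    · exact random_coding_bound_le hδ hη g1 g2 hZY hZH n
        (fun h => by rw [hM2 h, Nat.cast_one]) hM3 (Nat.le_ceil _) hJ1 hJ3
  choose C hC using hcode
  refine ⟨C, ?_, ?_, ?_⟩
  · refine le_liminf_of_le (by isBoundedDefault) ?_
    filter_upwards [eventually_gt_atTop 0] with n hn
    have hn' : (0 : ℝ) < n := by exact_mod_cast hn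
    rw [EReal.coe_le_coe_iff]
    have h5 := Real.log_le_log (Real.exp_pos _) (hC n hn).1
    rw [Real.log_exp] at h5
    rw [one_div, inv_mul_eq_div, le_div_iff₀ hn']
    linarith
  · refine limsup_le_of_le (by isBoundedDefault) ?_
    -- The factor `3` collects the rounding of `L` and the extra failure symbol; the `δ` left below
    -- `Rc` absorbs it.
    have hl : Tendsto (fun n : ℕ => Real.log 3 / n) atTop (𝓝 0) :=
      tendsto_const_div_atTop_nhds_zero_nat _
    filter_upwards [eventually_gt_atTop 0, hl.eventually (eventually_le_nhds hδ)] with n hn h6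
    have hn' : (0 : ℝ) < n := by exact_mod_cast hn
    rw [EReal.coe_le_coe_iff]
    have h5 := Real.log_le_log (by exact_mod_cast (C n).L_pos) (hC n hn).2.1
    rw [Real.log_mul (by norm_num) (Real.exp_pos _).ne', Real.log_exp] at h5
    rw [div_le_iff₀ hn'] at h6
    rw [one_div, inv_mul_eq_div, div_le_iff₀ hn']
    nlinarith
  · refine limsup_le_of_le (by isBoundedDefault) ?_
    have hl : Tendsto (fun n : ℕ => K / n + ε / 2 + Real.exp (-(n * δ)) * (1 / (ε / 2) + 5)) atTop
        (𝓝 (0 + ε / 2 + 0 * (1 / (ε / 2) + 5))) :=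
      ((tendsto_const_div_atTop_nhds_zero_nat K).add tendsto_const_nhds).add
        ((tendsto_exp_neg_nat_mul hδ).mul tendsto_const_nhds)
    filter_upwards [eventually_gt_atTop 0,
      hl.eventually (eventually_le_nhds (b := ε) (by linarith))] with n hn h6
    rw [EReal.coe_le_coe_iff]
    exact (hC n hn).2.2.trans h6

end Block

/-! ### From supporting hyperplanes to the region -/

section Hyperplane

variable {Y Z Xh : Type*} [Fintype Y] [Fintype Z]

/-- Homogeneity in the unnormalized vector `v` is the reason for splitting the informations by
symbols `u`: it makes both time sharing and the later reduction of the auxiliary alphabet linear. -/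
lemma rateY_smul (pY : Y → ℝ) (v : Y → ℝ) (s : ℝ) : rateY pY (s • v) = s * rateY pY v := by
  rcases eq_or_ne s 0 with rfl | hs
  · simp [rateY]
  simp only [rateY, Pi.smul_apply, smul_eq_mul, Finset.mul_sum]
  refine Finset.sum_congr rfl fun y _ => ?_
  have : ∑ y', pY y' * (s * v y') = s * ∑ y', pY y' * v y' := by
    rw [Finset.mul_sum]; exact Finset.sum_congr rfl fun _ _ => by ring
  rw [this, mul_div_mul_left _ _ hs]
  ring

lemma rateZ_smul (p : Y → Z → ℝ) (v : Y → ℝ) (s : ℝ) : rateZ p (s • v) = s * rateZ p v := by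
  rcases eq_or_ne s 0 with rfl | hs
  · simp [rateZ]
  simp only [rateZ, Pi.smul_apply, smul_eq_mul]
  rw [Finset.mul_sum]
  refine Finset.sum_congr rfl fun z _ => ?_
  have h1 : ∀ f : Y → ℝ, ∑ y, f y * (s * v y) = s * ∑ y, f y * v y := by
    intro f; rw [Finset.mul_sum]; exact Finset.sum_congr rfl fun _ _ => by ring
  rw [h1, h1, mul_left_comm (∑ y, p y z) s, mul_div_mul_left _ _ hs]
  ring

lemma cost_smul (p : Y → Z → ℝ) (e : Y → Z → Xh → ℝ) (v : Y → ℝ) (φ : Z → Xh) (s : ℝ) :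
    cost p e (s • v) φ = s * cost p e v φ := by
  simp only [cost, Pi.smul_apply, smul_eq_mul, Finset.mul_sum]
  exact Finset.sum_congr rfl fun _ _ => Finset.sum_congr rfl fun _ _ => by ring

/-- The weighted sum of the rates and the distortion of a test channel. -/
noncomputable def lagrangian {U : Type*} [Fintype U] (p : Y → Z → ℝ) (e : Y → Z → Xh → ℝ)
    (μ β : ℝ) (V : U → Y → ℝ) (φ : U → Z → Xh) : ℝ :=
  (1 - μ) * (1 - β) * ∑ u, rateY (fun y => ∑ z, p y z) (V u) - (1 - μ) * ∑ u, rateZ p (V u) +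
    μ * ∑ u, cost p e (V u) (φ u)

/-- The set of triples `(I(Z;U), I(Y;U) - I(Z;U), E d)` over all test channels. -/
def rateSet (p : Y → Z → ℝ) (e : Y → Z → Xh → ℝ) : Set (ℝ × ℝ × ℝ) :=
  {a | ∃ (k : ℕ) (V : Fin k → Y → ℝ) (φ : Fin k → Z → Xh), IsTestChannel V ∧
    a.1 = ∑ u, rateZ p (V u) ∧
    a.2.1 = ∑ u, rateY (fun y => ∑ z, p y z) (V u) - ∑ u, rateZ p (V u) ∧
    a.2.2 = ∑ u, cost p e (V u) (φ u)}

/-- Time sharing. -/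
lemma convex_rateSet (p : Y → Z → ℝ) (e : Y → Z → Xh → ℝ) : Convex ℝ (rateSet p e) := by
  rintro a ⟨k, V, φ, hV, ha1, ha2, ha3⟩ b ⟨l, W, ψ, hW, hb1, hb2, hb3⟩ s t hs ht hst
  refine ⟨k + l, Fin.append (fun u => s • V u) (fun u => t • W u), Fin.append φ ψ, ⟨?_, ?_⟩,
    ?_, ?_, ?_⟩
  · intro u y
    refine Fin.addCases (fun i => ?_) (fun i => ?_) u
    · rw [Fin.append_left]; exact mul_nonneg hs (hV.nonneg _ _)
    · rw [Fin.append_right]; exact mul_nonneg ht (hW.nonneg _ _)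
  · intro y
    rw [Fin.sum_univ_add]
    simp only [Fin.append_left, Fin.append_right, Pi.smul_apply, smul_eq_mul, ← Finset.mul_sum,
      hV.sum_eq_one, hW.sum_eq_one]
    linarith
  all_goals
    simp only [Fin.sum_univ_add, Fin.append_left, Fin.append_right, rateZ_smul, rateY_smul,
      cost_smul, ← Finset.mul_sum, Prod.fst_add, Prod.snd_add, Prod.smul_fst, Prod.smul_snd,
      smul_eq_mul, ha1, ha2, ha3, hb1, hb2, hb3]
  ring

/-- If no test channel met the three constraints, a hyperplane would separate the convex set
`rateSet` from an open orthant. Its normal has the signs forced by the orthant, and after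
normalization it is a pair `(μ, β)` whose Lagrangian violates the hypothesis. -/
lemma exists_test_channel_of_lagrangian_le {p : Y → Z → ℝ} {e : Y → Z → Xh → ℝ} {Ri Rc D : ℝ}
    (h : ∀ μ ∈ Set.Icc (0 : ℝ) 1, ∀ β ∈ Set.Icc (0 : ℝ) 1, ∀ δ > 0,
      ∃ (k : ℕ) (V : Fin k → Y → ℝ) (φ : Fin k → Z → Xh), IsTestChannel V ∧
        lagrangian p e μ β V φ ≤ (1 - μ) * ((1 - β) * Rc - Ri) + μ * D + δ) {γ : ℝ} (hγ : 0 < γ) :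
    ∃ (k : ℕ) (V : Fin k → Y → ℝ) (φ : Fin k → Z → Xh), IsTestChannel V ∧
      Ri - γ < ∑ u, rateZ p (V u) ∧
      ∑ u, rateY (fun y => ∑ z, p y z) (V u) - ∑ u, rateZ p (V u) < Rc - Ri + γ ∧
      ∑ u, cost p e (V u) (φ u) < D + γ := by
  let B : Set (ℝ × ℝ × ℝ) := Set.Ioi (Ri - γ) ×ˢ Set.Iio (Rc - Ri + γ) ×ˢ Set.Iio (D + γ)
  by_cases hdis : Disjoint B (rateSet p e)
  swap
  · obtain ⟨a, haB, k, V, φ, hV, h1, h2, h3⟩ := Set.not_disjoint_iff.1 hdis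
    obtain ⟨b1, b2, b3⟩ := haB
    exact ⟨k, V, φ, hV, h1 ▸ b1, h2 ▸ b2, h3 ▸ b3⟩
  exfalso
  obtain ⟨f, c, hfB, hfA⟩ := geometric_hahn_banach_open
    ((convex_Ioi _).prod ((convex_Iio _).prod (convex_Iio _)))
    (isOpen_Ioi.prod (isOpen_Iio.prod isOpen_Iio)) (convex_rateSet p e) hdis
  set f1 := f (1, 0, 0) with hf1
  set f2 := f (0, 1, 0) with hf2
  set f3 := f (0, 0, 1) with hf3
  have hf : ∀ x y z : ℝ, f (x, y, z) = x * f1 + y * f2 + z * f3 := by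
    intro x y z
    have : ((x, y, z) : ℝ × ℝ × ℝ) = x • ((1, 0, 0) : ℝ × ℝ × ℝ) + y • ((0, 1, 0) : ℝ × ℝ × ℝ) +
        z • ((0, 0, 1) : ℝ × ℝ × ℝ) := by simp
    rw [this, map_add, map_add, map_smul, map_smul, map_smul]
    simp [hf1, hf2, hf3]
  have hB : ∀ x y z : ℝ, 0 ≤ x → 0 ≤ y → 0 ≤ z →
      (Ri + x) * f1 + (Rc - Ri - y) * f2 + (D - z) * f3 < c := by
    intro x y z hx hy hz
    rw [← hf]
    refine hfB _ ⟨?_, ?_, ?_⟩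
    · show Ri - γ < Ri + x
      linarith
    · show Rc - Ri - y < Rc - Ri + γ
      linarith
    · show D - z < D + γ
      linarith
  have h0 := hB 0 0 0 le_rfl le_rfl le_rfl
  -- The slack at the corner. A coefficient of the wrong sign would let a move into the orthant use
  -- up this slack.
  set g := c - ((Ri + 0) * f1 + (Rc - Ri - 0) * f2 + (D - 0) * f3) with hg
  have hg0 : 0 < g := sub_pos.2 h0
  have hs1 : f1 ≤ 0 := by
    by_contra! hc
    have h1 := hB (g / f1) 0 0 (by positivity) le_rfl le_rfl
    have h2 : g / f1 * f1 = g := div_mul_cancel₀ _ hc.ne'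
    linarith
  have hs2 : 0 ≤ f2 := by
    by_contra! hc
    have h1 := hB 0 (g / -f2) 0 le_rfl (div_nonneg hg0.le (by linarith)) le_rfl
    have h2 : g / -f2 * -f2 = g := div_mul_cancel₀ _ (by linarith)
    linarith
  have hs3 : 0 ≤ f3 := by
    by_contra! hc
    have h1 := hB 0 0 (g / -f3) le_rfl le_rfl (div_nonneg hg0.le (by linarith))
    have h2 : g / -f3 * -f3 = g := div_mul_cancel₀ _ (by linarith)
    linarith
  have hlag : ∀ (k : ℕ) (V : Fin k → Y → ℝ) (φ : Fin k → Z → Xh), IsTestChannel V →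
      c ≤ (∑ u, rateZ p (V u)) * f1 + (∑ u, rateY (fun y => ∑ z, p y z) (V u) -
        ∑ u, rateZ p (V u)) * f2 + (∑ u, cost p e (V u) (φ u)) * f3 := by
    intro k V φ hV
    rw [← hf]
    exact hfA _ ⟨k, V, φ, hV, rfl, rfl, rfl⟩
  -- With all coefficients zero, the orthant gives `0 < c` and any test channel gives `c ≤ 0`.
  have hs : 0 < -f1 + f2 + f3 := by
    rcases (show 0 ≤ -f1 + f2 + f3 by linarith).eq_or_lt with h' | h'
    · have e1 : f1 = 0 := by linarith
      have e2 : f2 = 0 := by linarith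
      have e3 : f3 = 0 := by linarith
      obtain ⟨k, V, φ, hV, -⟩ := h 0 (by simp) 0 (by simp) 1 one_pos
      have h1 := hlag k V φ hV
      rw [e1, e2, e3] at h1 h0
      linarith
    · exact h'
  -- The normal is matched by S(1-μ) = -f1 + f2, S(1-μ)(1-β) = f2 and Sμ = f3. If `-f1 + f2 = 0`,
  -- then `f2 = 0` and any β works.
  obtain ⟨β, hβ, hβe⟩ : ∃ β ∈ Set.Icc (0 : ℝ) 1, (-f1 + f2) * (1 - β) = f2 := by
    rcases (show 0 ≤ -f1 + f2 by linarith).eq_or_lt with h' | h'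
    · exact ⟨0, by simp, by linarith⟩
    · refine ⟨1 - f2 / (-f1 + f2), ⟨?_, ?_⟩, ?_⟩
      · rw [sub_nonneg, div_le_one h']; linarith
      · have : 0 ≤ f2 / (-f1 + f2) := by positivity
        linarith
      · rw [sub_sub_cancel, mul_div_cancel₀ _ h'.ne']
  set S := -f1 + f2 + f3 with hS
  have hμe : S * (f3 / S) = f3 := mul_div_cancel₀ _ hs.ne'
  have hμ1 : f3 / S ∈ Set.Icc (0 : ℝ) 1 :=
    ⟨by positivity, by rw [div_le_one hs]; linarith⟩
  -- The tolerance is half the slack, rescaled by `S`, so a strict contradiction remains.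
  obtain ⟨k, V, φ, hV, hle⟩ := h (f3 / S) hμ1 β hβ (g / (2 * S)) (by positivity)
  have h1 := hlag k V φ hV
  have h2 := mul_le_mul_of_nonneg_left hle hs.le
  set μ := f3 / S
  have hμ2 : S * (1 - μ) = -f1 + f2 := by rw [mul_sub, hμe]; linarith
  have hμ3 : S * ((1 - μ) * (1 - β)) = f2 := by rw [← mul_assoc, hμ2, hβe]
  have hg2 : S * (g / (2 * S)) = g / 2 := by field_simp
  have h3 : S * lagrangian p e μ β V φ = (∑ u, rateZ p (V u)) * f1 +
      (∑ u, rateY (fun y => ∑ z, p y z) (V u) -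
        ∑ u, rateZ p (V u)) * f2 + (∑ u, cost p e (V u) (φ u)) * f3 := by
    unfold lagrangian
    linear_combination (∑ u, rateY (fun y => ∑ z, p y z) (V u)) * hμ3 -
      (∑ u, rateZ p (V u)) * hμ2 + (∑ u, cost p e (V u) (φ u)) * hμe
  have h4 : S * ((1 - μ) * ((1 - β) * Rc - Ri) + μ * D + g / (2 * S)) =
      (Ri + 0) * f1 + (Rc - Ri - 0) * f2 + (D - 0) * f3 + g / 2 := by
    linear_combination Rc * hμ3 - Ri * hμ2 + D * hμe + hg2
  rw [h3, h4] at h2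
  linarith

theorem mem_region_of_lagrangian_le {X : Type*} [Fintype X] [Nonempty Xh] {PX : X → ℝ}
    {PYX : X → Y → ℝ} {PZX : X → Z → ℝ} {d : X → Xh → ℝ} (hPX : PX ∈ stdSimplex ℝ X)
    (hPYX : ∀ x, PYX x ∈ stdSimplex ℝ Y) (hPZX : ∀ x, PZX x ∈ stdSimplex ℝ Z) {Ri Rc D : ℝ}
    (hRi : 0 ≤ Ri)
    (h : ∀ μ ∈ Set.Icc (0 : ℝ) 1, ∀ β ∈ Set.Icc (0 : ℝ) 1, ∀ δ > 0,
      ∃ (k : ℕ) (V : Fin k → Y → ℝ) (φ : Fin k → Z → Xh), IsTestChannel V ∧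
        lagrangian (pairYZ PX PYX PZX) (condDist PX PYX PZX d) μ β V φ ≤
          (1 - μ) * ((1 - β) * Rc - Ri) + μ * D + δ) :
    (Ri, Rc, D) ∈ region PX PYX PZX d := by
  refine Set.mem_iInter₂.2 fun ε hε => Metric.mem_closure_iff.2 fun γ hγ => ?_
  obtain ⟨k, V, φ, hV, h1, h2, h3⟩ := exists_test_channel_of_lagrangian_le h (half_pos hγ)
  -- The relaxed triple is achievable with strict inequalities and lies within `γ`; the closure in
  -- `epsRegion` absorbs the relaxation. Nonnegativity of `Ri` enters through `max (Ri - γ / 2) 0 ≤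
  -- Ri`.
  refine ⟨(Ri - γ / 2, Rc + γ / 2, D + γ / 2),
    achievable_of_test_channel hPX hPYX hPZX hV φ hε.1 (fun _ => h1) ?_ h3, ?_⟩
  · have : max (Ri - γ / 2) 0 ≤ Ri := max_le (by linarith) hRi
    linarith
  · simp only [Prod.dist_eq, Real.dist_eq, max_lt_iff]
    refine ⟨?_, ?_, ?_⟩ <;> rw [abs_lt] <;> constructor <;> linarith

end Hyperplane

/-! ### Entropy and the tensorization of the Lagrangian -/

section Entropy

variable {A B S : Type*} [Fintype A] [Fintype B] [Fintype S]

noncomputable def ent (m : A → ℝ) : ℝ := ∑ a, Real.negMulLog (m a)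

lemma ent_equiv (e : A ≃ B) {m : A → ℝ} {m' : B → ℝ} (h : ∀ a, m a = m' (e a)) :
    ent m = ent m' :=
  Fintype.sum_equiv e _ _ fun a => by rw [h]

lemma ent_mul {a : A → ℝ} {b : B → ℝ} (ha : ∑ i, a i = 1) (hb : ∑ j, b j = 1) :
    ent (fun s : A × B => a s.1 * b s.2) = ent a + ent b := by
  simp only [ent, Fintype.sum_prod_type, Real.negMulLog_mul]
  simp_rw [Finset.sum_add_distrib, ← Finset.mul_sum, ← Finset.sum_mul, ha, hb, one_mul]

/-- Expanding the logarithm of the ratio writes mutual information as H(A) + H(B) - H(A,B), so that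
the tensorization becomes bookkeeping of entropies. -/
lemma sum_mul_log_ratio {m : A → B → ℝ} (hm : ∀ i j, 0 ≤ m i j) {a : A → ℝ} {b : B → ℝ}
    (ha : ∀ i, ∑ j, m i j = a i) (hb : ∀ j, ∑ i, m i j = b j) :
    ∑ i, ∑ j, m i j * Real.log (m i j / (b j * a i)) =
      ent b + ent a - ent (fun s : A × B => m s.1 s.2) := by
  have h1 : ∀ i j, m i j * Real.log (m i j / (b j * a i)) =
      -Real.negMulLog (m i j) - m i j * Real.log (b j) - m i j * Real.log (a i) := by
    intro i j
    rcases (hm i j).eq_or_lt with h | h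
    · simp [← h]
    · have hi : 0 < a i := by
        rw [← ha]
        exact h.trans_le (Finset.single_le_sum (f := fun j => m i j) (fun j _ => hm i j)
          (Finset.mem_univ j))
      have hj : 0 < b j := by
        rw [← hb]
        exact h.trans_le (Finset.single_le_sum (f := fun i => m i j) (fun i _ => hm i j)
          (Finset.mem_univ i))
      rw [Real.log_div h.ne' (by positivity), Real.log_mul hj.ne' hi.ne', Real.negMulLog]
      ring
  simp_rw [h1, Finset.sum_sub_distrib, ent, Fintype.sum_prod_type, ← Finset.sum_mul, ha]
  rw [Finset.sum_comm (f := fun i j => m i j * Real.log (b j))]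
  simp_rw [← Finset.sum_mul, hb, Real.negMulLog, Finset.sum_neg_distrib, neg_mul]
  rw [Finset.sum_neg_distrib, Finset.sum_neg_distrib]
  ring

/-- Submodularity of entropy. -/
lemma ent_submodular {m : S → A → B → ℝ} (hm : ∀ s i j, 0 ≤ m s i j) :
    ent (fun s => ∑ i, ∑ j, m s i j) + ent (fun t : S × A × B => m t.1 t.2.1 t.2.2) ≤
      ent (fun t : S × A => ∑ j, m t.1 t.2 j) + ent (fun t : S × B => ∑ i, m t.1 i t.2) := by
  have hA : ∀ s i, 0 ≤ ∑ j, m s i j := fun s i => Finset.sum_nonneg fun j _ => hm s i j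
  have hB : ∀ s j, 0 ≤ ∑ i, m s i j := fun s j => Finset.sum_nonneg fun i _ => hm s i j
  have hS : ∀ s, 0 ≤ ∑ i, ∑ j, m s i j := fun s => Finset.sum_nonneg fun i _ => hA s i
  have hpos : ∀ s i j, 0 < m s i j →
      0 < ∑ j, m s i j ∧ 0 < ∑ i, m s i j ∧ 0 < ∑ i, ∑ j, m s i j := by
    intro s i j h
    have h1 : 0 < ∑ j, m s i j := h.trans_le (Finset.single_le_sum (f := fun j => m s i j)
      (fun j _ => hm s i j) (Finset.mem_univ j))
    exact ⟨h1, h.trans_le (Finset.single_le_sum (f := fun i => m s i j)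
      (fun i _ => hm s i j) (Finset.mem_univ i)), h1.trans_le (Finset.single_le_sum
      (f := fun i => ∑ j, m s i j) (fun i _ => hA s i) (Finset.mem_univ i))⟩
  -- The sum is minus the conditional mutual information of the two last components given the first.
  have key := sum_mul_log_nonpos (w := fun t : S × A × B => m t.1 t.2.1 t.2.2)
    (s := fun t => (∑ j, m t.1 t.2.1 j) * (∑ i, m t.1 i t.2.2) /
      ((∑ i, ∑ j, m t.1 i j) * m t.1 t.2.1 t.2.2)) (fun t => hm _ _ _)
    (fun t h => by obtain ⟨h1, h2, h3⟩ := hpos _ _ _ h; positivity) (by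
      calc _ ≤ ∑ t : S × A × B, (∑ j, m t.1 t.2.1 j) * (∑ i, m t.1 i t.2.2) /
            (∑ i, ∑ j, m t.1 i j) := by
            refine Finset.sum_le_sum fun t _ => ?_
            rcases (hm t.1 t.2.1 t.2.2).eq_or_lt with h | h
            · rw [← h, zero_mul]
              exact div_nonneg (mul_nonneg (hA _ _) (hB _ _)) (hS _)
            · obtain ⟨h1, h2, h3⟩ := hpos _ _ _ h
              apply le_of_eq; field_simp
        _ = ∑ s, (∑ i, ∑ j, m s i j) * (∑ i, ∑ j, m s i j) / (∑ i, ∑ j, m s i j) := by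
            simp only [Fintype.sum_prod_type]
            refine Finset.sum_congr rfl fun s _ => ?_
            simp_rw [← Finset.sum_div]
            congr 1
            conv_rhs => rw [Finset.sum_mul]
            refine Finset.sum_congr rfl fun i _ => ?_
            rw [← Finset.mul_sum]
            congr 1
            exact Finset.sum_comm
        _ ≤ ∑ s, ∑ i, ∑ j, m s i j := by
            refine Finset.sum_le_sum fun s _ => ?_
            rw [mul_div_assoc]
            exact mul_le_of_le_one_right (hS s) (div_self_le_one _)
        _ = _ := by simp only [Fintype.sum_prod_type])
  have hexp : ∑ t : S × A × B, m t.1 t.2.1 t.2.2 * Real.log ((∑ j, m t.1 t.2.1 j) *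
      (∑ i, m t.1 i t.2.2) / ((∑ i, ∑ j, m t.1 i j) * m t.1 t.2.1 t.2.2)) =
      ∑ t : S × A × B, (m t.1 t.2.1 t.2.2 * Real.log (∑ j, m t.1 t.2.1 j) +
        m t.1 t.2.1 t.2.2 * Real.log (∑ i, m t.1 i t.2.2) -
        m t.1 t.2.1 t.2.2 * Real.log (∑ i, ∑ j, m t.1 i j) +
        Real.negMulLog (m t.1 t.2.1 t.2.2)) := by
    refine Finset.sum_congr rfl fun t _ => ?_
    rcases (hm t.1 t.2.1 t.2.2).eq_or_lt with h | h
    · simp [← h]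
    · obtain ⟨h1, h2, h3⟩ := hpos _ _ _ h
      rw [Real.log_div (by positivity) (by positivity), Real.log_mul h1.ne' h2.ne',
        Real.log_mul h3.ne' h.ne', Real.negMulLog]
      ring
  have e1 : ∑ t : S × A × B, m t.1 t.2.1 t.2.2 * Real.log (∑ j, m t.1 t.2.1 j) =
      -ent (fun t : S × A => ∑ j, m t.1 t.2 j) := by
    simp only [ent, Fintype.sum_prod_type, Real.negMulLog, neg_mul, Finset.sum_neg_distrib, neg_neg,
      ← Finset.sum_mul]
  have e2 : ∑ t : S × A × B, m t.1 t.2.1 t.2.2 * Real.log (∑ i, m t.1 i t.2.2) =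
      -ent (fun t : S × B => ∑ i, m t.1 i t.2) := by
    simp only [ent, Fintype.sum_prod_type, Real.negMulLog, neg_mul, Finset.sum_neg_distrib, neg_neg]
    refine Finset.sum_congr rfl fun s _ => ?_
    rw [Finset.sum_comm]
    simp_rw [← Finset.sum_mul]
  have e3 : ∑ t : S × A × B, m t.1 t.2.1 t.2.2 * Real.log (∑ i, ∑ j, m t.1 i j) =
      -ent (fun s => ∑ i, ∑ j, m s i j) := by
    simp only [ent, Fintype.sum_prod_type, Real.negMulLog, neg_mul, Finset.sum_neg_distrib, neg_neg,
      ← Finset.sum_mul]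
  rw [hexp, Finset.sum_add_distrib, Finset.sum_sub_distrib, Finset.sum_add_distrib, e1, e2, e3]
    at key
  have e4 : ∑ t : S × A × B, Real.negMulLog (m t.1 t.2.1 t.2.2) =
    ent (fun t : S × A × B => m t.1 t.2.1 t.2.2) := rfl
  linarith

end Entropy

/-! ### Splitting the Lagrangian of a product source. -/

section Tensor

variable {Y Z U : Type*} [Fintype Y] [Fintype Z] [Fintype U]

lemma sum_rateY_eq_ent {pY : Y → ℝ} (hp : ∀ y, 0 ≤ pY y) {V : U → Y → ℝ} (hV : IsTestChannel V) :
    ∑ u, rateY pY (V u) = ent pY + ent (fun u => ∑ y, pY y * V u y) -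
      ent (fun s : U × Y => pY s.2 * V s.1 s.2) := by
  rw [← sum_mul_log_ratio (m := fun u y => pY y * V u y)
    (fun u y => mul_nonneg (hp y) (hV.nonneg u y)) (fun u => rfl)
    (fun y => by rw [← Finset.mul_sum, hV.sum_eq_one, mul_one])]
  refine Finset.sum_congr rfl fun u _ => Finset.sum_congr rfl fun y _ => ?_
  rcases eq_or_ne (pY y) 0 with h | h
  · simp [h]
  · rw [mul_div_mul_left _ _ h]

lemma sum_rateZ_eq_ent {p : Y → Z → ℝ} (hp : ∀ y z, 0 ≤ p y z) {V : U → Y → ℝ}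
    (hV : IsTestChannel V) :
    ∑ u, rateZ p (V u) = ent (fun z => ∑ y, p y z) + ent (fun u => ∑ y, (∑ z, p y z) * V u y) -
      ent (fun s : U × Z => ∑ y, p y s.2 * V s.1 y) := by
  rw [← sum_mul_log_ratio (m := fun u z => ∑ y, p y z * V u y)
    (fun u z => Finset.sum_nonneg fun y _ => mul_nonneg (hp y z) (hV.nonneg u y))
    (fun u => by rw [Finset.sum_comm]; simp_rw [← Finset.sum_mul])
    (fun z => by
      rw [Finset.sum_comm]; simp_rw [← Finset.mul_sum, hV.sum_eq_one, mul_one])]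
  rfl

variable {Y₁ Z₁ H₁ Y₂ Z₂ H₂ : Type*} [Fintype Y₁] [Fintype Z₁] [Fintype Y₂] [Fintype Z₂]

def prodPair (p₁ : Y₁ → Z₁ → ℝ) (p₂ : Y₂ → Z₂ → ℝ) : Y₁ × Y₂ → Z₁ × Z₂ → ℝ :=
  fun y z => p₁ y.1 z.1 * p₂ y.2 z.2

def addDist (e₁ : Y₁ → Z₁ → H₁ → ℝ) (e₂ : Y₂ → Z₂ → H₂ → ℝ) :
    Y₁ × Y₂ → Z₁ × Z₂ → H₁ × H₂ → ℝ :=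
  fun y z h => e₁ y.1 z.1 h.1 + e₂ y.2 z.2 h.2

/-- Splitting a test channel for a product source into test channels for the factors, with auxiliary
variables `(U, Z₂)` and `(U, Y₁)`. -/
lemma exists_split_lagrangian_le [Finite H₂] [Nonempty H₂] {p₁ : Y₁ → Z₁ → ℝ} {p₂ : Y₂ → Z₂ → ℝ}
    (hp₁ : ∀ y z, 0 ≤ p₁ y z) (hp₂ : ∀ y z, 0 ≤ p₂ y z)
    (hs₁ : ∑ y, ∑ z, p₁ y z = 1) (hs₂ : ∑ y, ∑ z, p₂ y z = 1)
    (e₁ : Y₁ → Z₁ → H₁ → ℝ) (e₂ : Y₂ → Z₂ → H₂ → ℝ) {μ β : ℝ} (hμ : μ ∈ Set.Icc (0 : ℝ) 1)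
    (hβ : β ∈ Set.Icc (0 : ℝ) 1) {V : U → Y₁ × Y₂ → ℝ} (hV : IsTestChannel V)
    (φ : U → Z₁ × Z₂ → H₁ × H₂) :
    ∃ (VA : U × Z₂ → Y₁ → ℝ) (φA : U × Z₂ → Z₁ → H₁) (VB : U × Y₁ → Y₂ → ℝ)
      (φB : U × Y₁ → Z₂ → H₂), IsTestChannel VA ∧ IsTestChannel VB ∧
      lagrangian p₁ e₁ μ β VA φA + lagrangian p₂ e₂ μ β VB φB ≤
        lagrangian (prodPair p₁ p₂) (addDist e₁ e₂) μ β V φ := by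
  set P₁ : Y₁ → ℝ := fun y => ∑ z, p₁ y z with hP₁
  set P₂ : Y₂ → ℝ := fun y => ∑ z, p₂ y z with hP₂
  have hP₁0 : ∀ y, 0 ≤ P₁ y := fun y => Finset.sum_nonneg fun z _ => hp₁ y z
  have hP₂0 : ∀ y, 0 ≤ P₂ y := fun y => Finset.sum_nonneg fun z _ => hp₂ y z
  have hp0 : ∀ y z, 0 ≤ prodPair p₁ p₂ y z := fun y z => mul_nonneg (hp₁ _ _) (hp₂ _ _)
  have hPP : ∀ y, ∑ z, prodPair p₁ p₂ y z = P₁ y.1 * P₂ y.2 := fun y => by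
    simp only [prodPair, Fintype.sum_prod_type, hP₁, hP₂, Finset.sum_mul_sum]
  have hZZ : ∀ z, ∑ y, prodPair p₁ p₂ y z = (∑ y, p₁ y z.1) * ∑ y, p₂ y z.2 := fun z => by
    simp only [prodPair, Fintype.sum_prod_type, Finset.sum_mul_sum]
  -- `VA` is P(u, z₂ | y₁) and `VB` is P(u, y₁ | y₂); both use the independence of the two factors
  -- of the source.
  let VA : U × Z₂ → Y₁ → ℝ := fun s a => ∑ b, V s.1 (a, b) * p₂ b s.2
  let VB : U × Y₁ → Y₂ → ℝ := fun s b => P₁ s.2 * V s.1 (s.2, b)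
  have hVA : IsTestChannel VA := by
    refine ⟨fun s a => Finset.sum_nonneg fun b _ => mul_nonneg (hV.nonneg _ _) (hp₂ _ _),
      fun a => ?_⟩
    simp only [VA, Fintype.sum_prod_type]
    have : ∀ u, ∑ z, ∑ b, V u (a, b) * p₂ b z = ∑ b, V u (a, b) * ∑ z, p₂ b z := fun u => by
      rw [Finset.sum_comm]; simp_rw [Finset.mul_sum]
    simp_rw [this]
    rw [Finset.sum_comm]
    simp_rw [← Finset.sum_mul, hV.sum_eq_one, one_mul]
    exact hs₂
  have hVB : IsTestChannel VB := by
    refine ⟨fun s b => mul_nonneg (hP₁0 _) (hV.nonneg _ _), fun b => ?_⟩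
    simp only [VB, Fintype.sum_prod_type]
    rw [Finset.sum_comm]
    simp_rw [← Finset.mul_sum, hV.sum_eq_one, mul_one]
    exact hs₁
  -- The second decoder does not see Z₁. Nothing is lost: given (U, Y₁, Z₂), the variable Z₁ is
  -- independent of Y₂, so a reproduction minimizing the conditional cost `g` is at least as good as
  -- one depending on Z₁.
  let g : U → Y₁ → Z₂ → H₂ → ℝ := fun u a z h => ∑ b, V u (a, b) * p₂ b z * e₂ b z h
  choose φB hφB using fun (s : U × Y₁) (z : Z₂) => Finite.exists_min (g s.1 s.2 z)
  let φA : U × Z₂ → Z₁ → H₁ := fun s z => (φ s.1 (z, s.2)).1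
  refine ⟨VA, φA, VB, φB, hVA, hVB, ?_⟩
  have hcost : ∑ s, cost p₁ e₁ (VA s) (φA s) + ∑ s, cost p₂ e₂ (VB s) (φB s) ≤
      ∑ u, cost (prodPair p₁ p₂) (addDist e₁ e₂) (V u) (φ u) := by
    simp only [Fintype.sum_prod_type]
    rw [← Finset.sum_add_distrib]
    refine Finset.sum_le_sum fun u _ => ?_
    have h1 : cost (prodPair p₁ p₂) (addDist e₁ e₂) (V u) (φ u) =
        ∑ a, ∑ b, ∑ a', ∑ b', p₁ a a' * p₂ b b' * V u (a, b) * e₁ a a' (φ u (a', b')).1 +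
        ∑ a, ∑ b, ∑ a', ∑ b', p₁ a a' * p₂ b b' * V u (a, b) * e₂ b b' (φ u (a', b')).2 := by
      simp only [cost, prodPair, addDist, Fintype.sum_prod_type, mul_add, Finset.sum_add_distrib]
    rw [h1]
    refine add_le_add (le_of_eq ?_) ?_
    · simp only [cost, VA, φA, Finset.mul_sum, Finset.sum_mul]
      rw [Finset.sum_comm]
      refine Finset.sum_congr rfl fun a _ => ?_
      calc ∑ b', ∑ a', ∑ b, p₁ a a' * (V u (a, b) * p₂ b b') * e₁ a a' (φ u (a', b')).1
          = ∑ b', ∑ b, ∑ a', p₁ a a' * (V u (a, b) * p₂ b b') * e₁ a a' (φ u (a', b')).1 :=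
            Finset.sum_congr rfl fun b' _ => Finset.sum_comm
        _ = ∑ b, ∑ b', ∑ a', p₁ a a' * (V u (a, b) * p₂ b b') * e₁ a a' (φ u (a', b')).1 :=
            Finset.sum_comm
        _ = ∑ b, ∑ a', ∑ b', p₁ a a' * (V u (a, b) * p₂ b b') * e₁ a a' (φ u (a', b')).1 :=
            Finset.sum_congr rfl fun b' _ => Finset.sum_comm
        _ = _ := Finset.sum_congr rfl fun b _ => Finset.sum_congr rfl fun a' _ =>
            Finset.sum_congr rfl fun b' _ => by ring
    · refine Finset.sum_le_sum fun a _ => ?_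
      have h2 : cost p₂ e₂ (VB (u, a)) (φB (u, a)) =
          ∑ a', ∑ b', p₁ a a' * g u a b' (φB (u, a) b') := by
        simp only [cost, VB, g, hP₁, Finset.sum_mul, Finset.mul_sum]
        calc ∑ b, ∑ b', ∑ a', p₂ b b' * (p₁ a a' * V u (a, b)) * e₂ b b' (φB (u, a) b')
            = ∑ b, ∑ a', ∑ b', p₂ b b' * (p₁ a a' * V u (a, b)) * e₂ b b' (φB (u, a) b') :=
              Finset.sum_congr rfl fun b _ => Finset.sum_comm
          _ = ∑ a', ∑ b, ∑ b', p₂ b b' * (p₁ a a' * V u (a, b)) * e₂ b b' (φB (u, a) b') :=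
              Finset.sum_comm
          _ = ∑ a', ∑ b', ∑ b, p₂ b b' * (p₁ a a' * V u (a, b)) * e₂ b b' (φB (u, a) b') :=
              Finset.sum_congr rfl fun a' _ => Finset.sum_comm
          _ = _ := Finset.sum_congr rfl fun b _ => Finset.sum_congr rfl fun a' _ =>
              Finset.sum_congr rfl fun b' _ => by ring
      have h3 : ∑ b, ∑ a', ∑ b', p₁ a a' * p₂ b b' * V u (a, b) * e₂ b b' (φ u (a', b')).2 =
          ∑ a', ∑ b', p₁ a a' * g u a b' (φ u (a', b')).2 := by
        simp only [g, Finset.mul_sum]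
        rw [Finset.sum_comm]
        refine Finset.sum_congr rfl fun a' _ => ?_
        rw [Finset.sum_comm]
        exact Finset.sum_congr rfl fun b' _ => Finset.sum_congr rfl fun b _ => by ring
      rw [h2, h3]
      exact Finset.sum_le_sum fun a' _ => Finset.sum_le_sum fun b' _ =>
        mul_le_mul_of_nonneg_left (hφB (u, a) b' _) (hp₁ _ _)
  have iY := sum_rateY_eq_ent (pY := fun y => ∑ z, prodPair p₁ p₂ y z)
    (fun y => Finset.sum_nonneg fun z _ => hp0 y z) hV
  have iZ := sum_rateZ_eq_ent hp0 hV
  have iYA := sum_rateY_eq_ent hP₁0 hVA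
  have iZA := sum_rateZ_eq_ent hp₁ hVA
  have iYB := sum_rateY_eq_ent hP₂0 hVB
  have iZB := sum_rateZ_eq_ent hp₂ hVB
  have h1 : ent (fun y => ∑ z, prodPair p₁ p₂ y z) = ent P₁ + ent P₂ := by
    simp_rw [hPP]; exact ent_mul hs₁ hs₂
  have h2 : ent (fun z => ∑ y, prodPair p₁ p₂ y z) =
      ent (fun z => ∑ y, p₁ y z) + ent (fun z => ∑ y, p₂ y z) := by
    simp_rw [hZZ]
    exact ent_mul (by rw [Finset.sum_comm]; exact hs₁) (by rw [Finset.sum_comm]; exact hs₂)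
  have h3 : ent (fun s : U × (Y₁ × Y₂) => (∑ z, prodPair p₁ p₂ s.2 z) * V s.1 s.2) =
      ent (fun s : (U × Y₁) × Y₂ => P₂ s.2 * VB s.1 s.2) := by
    refine ent_equiv (Equiv.prodAssoc U Y₁ Y₂).symm fun s => ?_
    simp only [hPP, VB, Equiv.prodAssoc_symm_apply]
    ring
  have h4 : ent (fun s : U × (Z₁ × Z₂) => ∑ y, prodPair p₁ p₂ y s.2 * V s.1 y) =
      ent (fun s : (U × Z₂) × Z₁ => ∑ y, p₁ y s.2 * VA s.1 y) := by
    refine ent_equiv ((Equiv.prodCongr (Equiv.refl U) (Equiv.prodComm Z₁ Z₂)).trans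
      (Equiv.prodAssoc U Z₂ Z₁).symm) fun s => ?_
    simp only [VA, prodPair, Fintype.sum_prod_type, Finset.mul_sum]
    exact Finset.sum_congr rfl fun a _ => Finset.sum_congr rfl fun b _ => by
      simp; ring
  -- Both sides are H(U, Y₁, Z₂). It occurs once in an I(Y;·) and once in an I(Z;·), and its
  -- cancellation makes the difference I(Y;U) - I(Z;U) exactly additive.
  have h5 : ent (fun s : (U × Z₂) × Y₁ => P₁ s.2 * VA s.1 s.2) =
      ent (fun s : (U × Y₁) × Z₂ => ∑ y, p₂ y s.2 * VB s.1 y) := by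
    refine ent_equiv ((Equiv.prodAssoc U Z₂ Y₁).trans ((Equiv.prodCongr (Equiv.refl U)
      (Equiv.prodComm Z₂ Y₁)).trans (Equiv.prodAssoc U Y₁ Z₂).symm)) fun s => ?_
    simp only [VA, VB, Finset.mul_sum]
    exact Finset.sum_congr rfl fun b _ => by simp; ring
  -- I(Y₁;Z₂|U) ≥ 0, which is what makes I(Z;U) subadditive under the splitting.
  have hsub := ent_submodular (m := fun u a z => P₁ a * VA (u, z) a)
    (fun u a z => mul_nonneg (hP₁0 a) (hVA.nonneg _ _))
  have h6 : ent (fun u => ∑ a, ∑ z, P₁ a * VA (u, z) a) =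
      ent (fun u => ∑ y, (∑ z, prodPair p₁ p₂ y z) * V u y) := by
    congr 1
    funext u
    simp only [hPP, VA, Fintype.sum_prod_type, hP₂]
    refine Finset.sum_congr rfl fun a _ => ?_
    simp_rw [Finset.mul_sum, Finset.sum_mul]
    rw [Finset.sum_comm]
    refine Finset.sum_congr rfl fun b _ => Finset.sum_congr rfl fun z _ => by ring
  have h7 : ent (fun t : U × Y₁ × Z₂ => P₁ t.2.1 * VA (t.1, t.2.2) t.2.1) =
      ent (fun s : (U × Z₂) × Y₁ => P₁ s.2 * VA s.1 s.2) := by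
    refine ent_equiv ((Equiv.prodCongr (Equiv.refl U) (Equiv.prodComm Y₁ Z₂)).trans
      (Equiv.prodAssoc U Z₂ Y₁).symm) fun s => ?_
    simp
  have h8 : ent (fun t : U × Y₁ => ∑ z, P₁ t.2 * VA (t.1, z) t.2) =
      ent (fun s : U × Y₁ => ∑ y, P₂ y * VB s y) := by
    congr 1
    funext s
    simp only [VA, VB, hP₂]
    simp_rw [Finset.mul_sum, Finset.sum_mul]
    rw [Finset.sum_comm]
    refine Finset.sum_congr rfl fun b _ => Finset.sum_congr rfl fun z _ => by ring
  have h9 : ent (fun t : U × Z₂ => ∑ a, P₁ a * VA (t.1, t.2) a) =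
      ent (fun s : U × Z₂ => ∑ y, P₁ y * VA s y) := rfl
  rw [h6, h7, h8, h9] at hsub
  rw [h1, h3] at iY
  rw [h2, h4] at iZ
  have hIeq : ∑ u, rateY (fun y => ∑ z, prodPair p₁ p₂ y z) (V u) -
      ∑ u, rateZ (prodPair p₁ p₂) (V u) =
      (∑ s, rateY P₁ (VA s) - ∑ s, rateZ p₁ (VA s)) +
      (∑ s, rateY P₂ (VB s) - ∑ s, rateZ p₂ (VB s)) := by
    rw [iY, iZ, iYA, iZA, iYB, iZB, h5]
    simp only [hP₁, hP₂]
    ring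
  have hIle : ∑ u, rateZ (prodPair p₁ p₂) (V u) ≤
      ∑ s, rateZ p₁ (VA s) + ∑ s, rateZ p₂ (VB s) := by
    rw [iZ, iZA, iZB, ← h5]
    simp only [hP₁, hP₂] at hsub ⊢
    linarith
  unfold lagrangian
  -- The Lagrangian equals (1-μ)(1-β)(I(Y;U) - I(Z;U)) - (1-μ)β I(Z;U) + μ E d. The first part
  -- splits with equality, and the subadditive part carries a nonpositive sign.
  have hb : 0 ≤ (1 - μ) * β := mul_nonneg (by linarith [hμ.2]) hβ.1
  have f1 := mul_le_mul_of_nonneg_left hIle hb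
  have f2 := mul_le_mul_of_nonneg_left hcost hμ.1
  have f3 := congrArg (fun x => (1 - μ) * (1 - β) * x) hIeq
  simp only [hP₁, hP₂] at f3 f1
  nlinarith [f1, f2, f3]

end Tensor

section Block

variable {Y Z Xh U : Type*} [Fintype Y] [Fintype Z] [Fintype U]

lemma lagrangian_equiv {Y' Z' H' U' : Type*} [Fintype Y'] [Fintype Z'] [Fintype U']
    (eU : U' ≃ U) (eY : Y' ≃ Y) (eZ : Z' ≃ Z) (eH : H' ≃ Xh) {p : Y → Z → ℝ} {p' : Y' → Z' → ℝ}
    {e : Y → Z → Xh → ℝ} {e' : Y' → Z' → H' → ℝ} (hp : ∀ y z, p' y z = p (eY y) (eZ z))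
    (he : ∀ y z h, e' y z h = e (eY y) (eZ z) (eH h)) (μ β : ℝ) (V : U → Y → ℝ)
    (φ : U → Z → Xh) :
    lagrangian p' e' μ β (fun u y => V (eU u) (eY y)) (fun u z => eH.symm (φ (eU u) (eZ z))) =
      lagrangian p e μ β V φ := by
  have hY : ∀ y, ∑ z, p' y z = ∑ z, p (eY y) z := fun y =>
    Fintype.sum_equiv eZ _ _ fun z => hp y z
  have hZ : ∀ z, ∑ y, p' y z = ∑ y, p y (eZ z) := fun z =>
    Fintype.sum_equiv eY _ _ fun y => hp y z
  have hV : ∀ u, ∑ y, (∑ z, p (eY y) z) * V u (eY y) = ∑ y, (∑ z, p y z) * V u y := fun u =>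
    Equiv.sum_comp eY (fun y => (∑ z, p y z) * V u y)
  unfold lagrangian
  congr 1
  · congr 1
    · congr 1
      refine Fintype.sum_equiv eU _ _ fun u => ?_
      simp only [rateY, hY, hV]
      exact Equiv.sum_comp eY (fun y => (∑ z, p y z) * V (eU u) y *
        Real.log (V (eU u) y / ∑ y, (∑ z, p y z) * V (eU u) y))
    · congr 1
      refine Fintype.sum_equiv eU _ _ fun u => ?_
      simp only [rateZ, hY, hV, hZ]
      simp only [hp]
      have h1 : ∀ z, ∑ y, p (eY y) z * V (eU u) (eY y) = ∑ y, p y z * V (eU u) y := fun z =>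
        Equiv.sum_comp eY (fun y => p y z * V (eU u) y)
      simp only [h1]
      exact Equiv.sum_comp eZ (fun z => (∑ y, p y z * V (eU u) y) *
        Real.log ((∑ y, p y z * V (eU u) y) /
          ((∑ y, p y z) * ∑ y, (∑ z, p y z) * V (eU u) y)))
  · congr 1
    refine Fintype.sum_equiv eU _ _ fun u => ?_
    simp only [cost]
    refine Fintype.sum_equiv eY _ _ fun y => Fintype.sum_equiv eZ _ _ fun z => ?_
    simp [hp, he]

lemma IsTestChannel.equiv {Y' U' : Type*} [Fintype Y'] [Fintype U'] {V : U → Y → ℝ}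
    (hV : IsTestChannel V) (eU : U' ≃ U) (g : Y' → Y) :
    IsTestChannel (fun u y => V (eU u) (g y)) :=
  ⟨fun _ _ => hV.nonneg _ _, fun y => (Equiv.sum_comp eU (fun u => V u (g y))).trans
    (hV.sum_eq_one _)⟩

lemma le_lagrangian_of_fin {p : Y → Z → ℝ} {e : Y → Z → Xh → ℝ} {μ β c : ℝ}
    (h : ∀ (k : ℕ) (V : Fin k → Y → ℝ) (φ : Fin k → Z → Xh), IsTestChannel V →
      c ≤ lagrangian p e μ β V φ) {V : U → Y → ℝ} (hV : IsTestChannel V) (φ : U → Z → Xh) :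
    c ≤ lagrangian p e μ β V φ := by
  rw [← lagrangian_equiv (Fintype.equivFin U).symm (Equiv.refl Y) (Equiv.refl Z) (Equiv.refl Xh)
    (p' := p) (e' := e) (fun _ _ => rfl) (fun _ _ _ => rfl)]
  exact h _ _ _ (hV.equiv _ _)

/-- The product law of a block. -/
def blockPair (p : Y → Z → ℝ) (n : ℕ) : (Fin n → Y) → (Fin n → Z) → ℝ :=
  fun y z => ∏ i, p (y i) (z i)

/-- The total distortion of a block. -/
def blockSum (e : Y → Z → Xh → ℝ) (n : ℕ) : (Fin n → Y) → (Fin n → Z) → (Fin n → Xh) → ℝ :=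
  fun y z h => ∑ i, e (y i) (z i) (h i)

lemma blockPair_nonneg {p : Y → Z → ℝ} (hp : ∀ y z, 0 ≤ p y z) (n : ℕ) (y : Fin n → Y)
    (z : Fin n → Z) : 0 ≤ blockPair p n y z := Finset.prod_nonneg fun _ _ => hp _ _

lemma sum_blockPair_right (p : Y → Z → ℝ) (n : ℕ) (y : Fin n → Y) :
    ∑ z, blockPair p n y z = ∏ i, ∑ z, p (y i) z := sum_pi_prod (fun i z => p (y i) z)

lemma sum_sum_blockPair {p : Y → Z → ℝ} (hp : ∑ y, ∑ z, p y z = 1) (n : ℕ) :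
    ∑ y, ∑ z, blockPair p n y z = 1 := by
  simp_rw [sum_blockPair_right]
  exact sum_pi_eq_one (p := fun _ y => ∑ z, p y z) fun _ => hp

/-- A lower bound for the single-letter Lagrangian tensorizes. -/
theorem nat_mul_le_block_lagrangian [Finite Xh] [Nonempty Xh] {p : Y → Z → ℝ}
    (hp0 : ∀ y z, 0 ≤ p y z) (hp1 : ∑ y, ∑ z, p y z = 1) {e : Y → Z → Xh → ℝ} {μ β c : ℝ}
    (hμ : μ ∈ Set.Icc (0 : ℝ) 1) (hβ : β ∈ Set.Icc (0 : ℝ) 1)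
    (h : ∀ (k : ℕ) (V : Fin k → Y → ℝ) (φ : Fin k → Z → Xh), IsTestChannel V →
      c ≤ lagrangian p e μ β V φ) (n : ℕ) : ∀ (k : ℕ) (V : Fin k → (Fin n → Y) → ℝ)
      (φ : Fin k → (Fin n → Z) → (Fin n → Xh)), IsTestChannel V →
      n * c ≤ lagrangian (blockPair p n) (blockSum e n) μ β V φ := by
  induction n with
  | zero =>
    intro k V φ hV
    simp only [lagrangian, rateY, rateZ, cost, blockPair, blockSum, Finset.univ_eq_empty,
      Finset.prod_empty, Finset.sum_empty, mul_zero, Fintype.sum_unique, one_mul]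
    simp
  | succ n ih =>
    intro k V φ hV
    -- A block of length `n + 1` is the product of its first letter and a block of length `n`.
    rw [← lagrangian_equiv (Equiv.refl (Fin k)) (Fin.consEquiv (fun _ : Fin (n + 1) => Y))
      (Fin.consEquiv (fun _ : Fin (n + 1) => Z)) (Fin.consEquiv (fun _ : Fin (n + 1) => Xh))
      (p' := prodPair p (blockPair p n)) (e' := addDist e (blockSum e n))
      (fun y z => by simp [prodPair, blockPair, Fin.prod_univ_succ, Fin.consEquiv])
      (fun y z h => by simp [addDist, blockSum, Fin.sum_univ_succ, Fin.consEquiv])]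
    obtain ⟨VA, φA, VB, φB, hVA, hVB, hle⟩ := exists_split_lagrangian_le hp0
      (blockPair_nonneg hp0 n) hp1 (sum_sum_blockPair hp1 n) e (blockSum e n) hμ hβ
      (hV.equiv (Equiv.refl (Fin k)) (Fin.consEquiv (fun _ : Fin (n + 1) => Y)))
      (fun u z => (Fin.consEquiv (fun _ : Fin (n + 1) => Xh)).symm
        (φ (Equiv.refl (Fin k) u) (Fin.consEquiv (fun _ : Fin (n + 1) => Z) z)))
    have h1 := le_lagrangian_of_fin h hVA φA
    have h2 := le_lagrangian_of_fin ih hVB φB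
    push_cast
    linarith

end Block

/-! ### The weak converse -/

lemma ent_le_log_card {S : Type*} [Fintype S] {m : S → ℝ} (h0 : ∀ s, 0 ≤ m s)
    (h1 : ∑ s, m s = 1) : ent m ≤ Real.log (Fintype.card S) := by
  have hne : Nonempty S := by
    by_contra hc
    rw [not_nonempty_iff] at hc
    simp at h1
  have hL : (0 : ℝ) < Fintype.card S := by exact_mod_cast Fintype.card_pos
  have key := sum_mul_log_nonpos (w := m) (s := fun s => (Fintype.card S * m s)⁻¹) h0
    (fun s hs => by positivity) (by
      rw [h1]
      calc _ ≤ ∑ _s : S, ((Fintype.card S : ℝ))⁻¹ := by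
            refine Finset.sum_le_sum fun s _ => ?_
            rcases (h0 s).eq_or_lt with h | h
            · rw [← h, zero_mul]; positivity
            · apply le_of_eq; field_simp
        _ = 1 := by simp)
  have : ∀ s, m s * Real.log ((Fintype.card S * m s)⁻¹) =
      Real.negMulLog (m s) - m s * Real.log (Fintype.card S) := by
    intro s
    rcases (h0 s).eq_or_lt with h | h
    · simp [← h]
    · rw [Real.log_inv, Real.log_mul hL.ne' h.ne', Real.negMulLog]; ring
  simp_rw [this] at key
  rw [Finset.sum_sub_distrib, ← Finset.sum_mul, h1, one_mul] at key
  exact sub_nonpos.1 key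

/-! ### Fano's inequality for an encoded database. -/

section Fano

variable {A B E H S : Type*} [Fintype A] [Fintype B] [Fintype E] [Fintype S] [DecidableEq S]

/-- The deterministic test channel of an encoder. -/
def encChannel (f : B → S) (s : S) (y : B) : ℝ := if f y = s then 1 else 0

lemma isTestChannel_encChannel (f : B → S) : IsTestChannel (encChannel f) :=
  ⟨fun _ _ => ind_nonneg _, fun _ => by simp [encChannel]⟩

lemma sum_mul_encChannel (f : B → S) (y : B) (G : S → ℝ) :
    ∑ s, encChannel f s y * G s = G (f y) := by
  simp [encChannel]

/-- The index is a function of `y`, so I(Y;S) = H(S), and entropy is at most the logarithm of the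
alphabet size. -/
lemma sum_rateY_encChannel_le {pB : B → ℝ} (hp0 : ∀ y, 0 ≤ pB y) (hp1 : ∑ y, pB y = 1)
    (f : B → S) : ∑ s, rateY pB (encChannel f s) ≤ Real.log (Fintype.card S) := by
  rw [sum_rateY_eq_ent hp0 (isTestChannel_encChannel f)]
  have h1 : ent (fun s : S × B => pB s.2 * encChannel f s.1 s.2) = ent pB := by
    simp only [ent, Fintype.sum_prod_type_right, encChannel]
    refine Finset.sum_congr rfl fun y _ => ?_
    rw [Finset.sum_eq_single (f y)]
    · simp
    · intro s _ hs; simp [hs.symm]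
    · simp
  rw [h1, add_sub_cancel_left]
  refine ent_le_log_card (fun s => Finset.sum_nonneg fun y _ =>
    mul_nonneg (hp0 y) ((isTestChannel_encChannel f).nonneg s y)) ?_
  rw [Finset.sum_comm]
  simp_rw [← Finset.mul_sum, (isTestChannel_encChannel f).sum_eq_one, mul_one, hp1]

/-- The joint mass function of the sequences `y` and the channel output `z` for the query `w`. -/
def queryLaw (pB : B → ℝ) (r : B → E → ℝ) {M : ℕ} (w : Fin M) (y : Fin M → B) (z : E) : ℝ :=
  ∏ m, if m = w then r (y m) z else pB (y m)

lemma sum_queryLaw {pB : B → ℝ} {r : B → E → ℝ} (hp1 : ∑ y, pB y = 1)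
    {M : ℕ} (w : Fin M) (G : B → E → ℝ) :
    ∑ y : Fin M → B, ∑ z, queryLaw pB r w y z * G (y w) z = ∑ b, ∑ z, r b z * G b z := by
  rw [Finset.sum_comm, Finset.sum_comm (f := fun b z => r b z * G b z)]
  refine Finset.sum_congr rfl fun z _ => ?_
  have h1 : ∀ y : Fin M → B, queryLaw pB r w y z * G (y w) z =
      ∏ m, (if m = w then r (y m) z * G (y m) z else pB (y m)) := by
    intro y
    rw [queryLaw, ← Finset.mul_prod_erase Finset.univ _ (Finset.mem_univ w),
      ← Finset.mul_prod_erase Finset.univ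
        (fun m => if m = w then r (y m) z * G (y m) z else pB (y m)) (Finset.mem_univ w)]
    have : ∏ m ∈ Finset.univ.erase w, (if m = w then r (y m) z else pB (y m)) =
        ∏ m ∈ Finset.univ.erase w, (if m = w then r (y m) z * G (y m) z else pB (y m)) :=
      Finset.prod_congr rfl fun m hm => by simp [Finset.ne_of_mem_erase hm]
    rw [this]
    simp only [if_true]
    ring
  simp_rw [h1]
  rw [sum_pi_prod (fun m b => if m = w then r b z * G b z else pB b),
    Finset.prod_eq_single w]
  · simp
  · intro m _ hm; simp [hm, hp1]
  · simp

lemma sum_codes_eq_queryLaw {p : A → B → ℝ} {W : A → E → ℝ} {M : ℕ} (w : Fin M) (y : Fin M → B)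
    (z : E) : ∑ x : Fin M → A, (∏ m, p (x m) (y m)) * W (x w) z =
      queryLaw (fun y => ∑ x, p x y) (fun y z => ∑ x, p x y * W x z) w y z := by
  have h1 : ∀ x : Fin M → A, (∏ m, p (x m) (y m)) * W (x w) z =
      ∏ m, (p (x m) (y m) * if m = w then W (x m) z else 1) := by
    intro x
    rw [Finset.prod_mul_distrib, Finset.prod_ite_eq' Finset.univ w (fun m => W (x m) z)]
    simp
  simp_rw [h1]
  rw [sum_pi_prod (fun m a => p a (y m) * if m = w then W a z else 1), queryLaw]
  refine Finset.prod_congr rfl fun m _ => ?_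
  split_ifs <;> simp

open Classical in
/-- Change of measure: the probability of correct identification when the channel output is
independent of the database is `1 / M`. -/
lemma fano_identification {pB : B → ℝ} {r : B → E → ℝ} (hr0 : ∀ y z, 0 ≤ r y z)
    (hp1 : ∑ y, pB y = 1)
    (hr : ∀ y, ∑ z, r y z = pB y) {M : ℕ} (hM : 0 < M) (f : B → S) (g : (Fin M → S) → E → Fin M) :
    (∑ w : Fin M, 1 / (M : ℝ) * ∑ y : Fin M → B, ∑ z, queryLaw pB r w y z *
      (if g (fun m => f (y m)) z = w then 1 else 0)) * Real.log M ≤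
      ∑ s, rateZ r (encChannel f s) + Real.log 2 := by
  have hM' : (0 : ℝ) < M := by exact_mod_cast hM
  have hp0 : ∀ y, 0 ≤ pB y := fun y => by rw [← hr]; exact Finset.sum_nonneg fun z _ => hr0 y z
  let rS : S → E → ℝ := fun s z => ∑ y, r y z * encChannel f s y
  let pS : S → ℝ := fun s => ∑ y, pB y * encChannel f s y
  let pZ : E → ℝ := fun z => ∑ y, r y z
  let ρ : S → E → ℝ := fun s z => rS s z / (pZ z * pS s)
  have henc : ∀ s y, 0 ≤ encChannel f s y := (isTestChannel_encChannel f).nonneg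
  have hrS0 : ∀ s z, 0 ≤ rS s z := fun s z =>
    Finset.sum_nonneg fun y _ => mul_nonneg (hr0 y z) (henc s y)
  have hpS0 : ∀ s, 0 ≤ pS s := fun s =>
    Finset.sum_nonneg fun y _ => mul_nonneg (hp0 y) (henc s y)
  have hpZ0 : ∀ z, 0 ≤ pZ z := fun z => Finset.sum_nonneg fun y _ => hr0 y z
  have hpZ1 : ∑ z, pZ z = 1 := by
    simp only [pZ]; rw [Finset.sum_comm]; simp_rw [hr, hp1]
  have hpS1 : ∑ s, pS s = 1 := by
    simp only [pS]; rw [Finset.sum_comm]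
    simp_rw [← Finset.mul_sum, (isTestChannel_encChannel f).sum_eq_one, mul_one, hp1]
  have hρpos : ∀ y z, 0 < r y z → 0 < ρ (f y) z := by
    intro y z h
    have h1 : 0 < rS (f y) z := h.trans_le (le_trans (by simp [encChannel])
      (Finset.single_le_sum (f := fun y' => r y' z * encChannel f (f y) y')
      (fun y' _ => mul_nonneg (hr0 _ _) (henc _ _)) (Finset.mem_univ y)))
    have h2 : 0 < pB y := by
      rw [← hr]
      exact h.trans_le (Finset.single_le_sum (f := fun z => r y z) (fun z _ => hr0 y z)
        (Finset.mem_univ z))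
    have h3 : 0 < pS (f y) := h2.trans_le (le_trans (by simp [encChannel])
      (Finset.single_le_sum (f := fun y' => pB y' * encChannel f (f y) y')
      (fun y' _ => mul_nonneg (hp0 _) (henc _ _)) (Finset.mem_univ y)))
    have h4 : 0 < pZ z := h.trans_le (Finset.single_le_sum (f := fun y => r y z)
      (fun y _ => hr0 y z) (Finset.mem_univ y))
    exact div_pos h1 (mul_pos h4 h3)
  have hq0 : ∀ (w : Fin M) y z, 0 ≤ queryLaw pB r w y z := fun w y z =>
    Finset.prod_nonneg fun m _ => by split_ifs; exacts [hr0 _ _, hp0 _]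
  have hrate : ∑ s, rateZ r (encChannel f s) = ∑ y, ∑ z, r y z * Real.log (ρ (f y) z) := by
    rw [sum_rateZ_eq]
    simp only [Fintype.sum_prod_type]
    rw [Finset.sum_comm]
    refine Finset.sum_congr rfl fun y _ => ?_
    rw [Finset.sum_comm]
    refine Finset.sum_congr rfl fun z _ => ?_
    simp_rw [mul_assoc, ← Finset.mul_sum]
    rw [sum_mul_encChannel f y]
    simp only [ρ, rS, pZ, pS, hr]
  -- The weight is `M` for a correct guess and `1` otherwise. Its logarithm recovers P(correct) ·
  -- log M. When the query is independent of the database its average over `w` is at most two, which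
  -- explains the `2` in the ratio and the `log 2` in the bound.
  let c : (Fin M → S) → E → Fin M → ℝ := fun s z w => if g s z = w then M else 1
  let T := Fin M × (Fin M → B) × E
  have hc0 : ∀ s z w, 0 < c s z w := fun s z w => by simp only [c]; split_ifs <;> positivity
  have hsum1 : ∑ t : T, 1 / (M : ℝ) * queryLaw pB r t.1 t.2.1 t.2.2 = 1 := by
    simp only [T, Fintype.sum_prod_type, ← Finset.mul_sum]
    have := fun w : Fin M => sum_queryLaw (r := r) hp1 w (fun _ _ => 1)
    simp only [mul_one] at this
    simp_rw [this, hr, hp1]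
    simp
    field_simp
  -- Dividing by the density `ρ` replaces the law of (indices, output) by the product law `pZ × ∏
  -- pS`, where `w` is no longer visible. The sum over `σ` groups the sequences by their indices;
  -- only inequality holds, because `rS` may vanish.
  have hinner : ∀ (w : Fin M) (z : E), ∑ y : Fin M → B, queryLaw pB r w y z *
      (c (fun m => f (y m)) z w / (2 * ρ (f (y w)) z)) ≤
      ∑ σ : Fin M → S, pZ z * (∏ m, pS (σ m)) * (c σ z w / 2) := by
    intro w z
    have h1 : ∀ y : Fin M → B, queryLaw pB r w y z *
        (c (fun m => f (y m)) z w / (2 * ρ (f (y w)) z)) =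
        ∑ σ : Fin M → S, (c σ z w / 2) * ∏ m, (encChannel f (σ m) (y m) *
          (if m = w then r (y m) z / ρ (σ m) z else pB (y m))) := by
      intro y
      rw [Finset.sum_eq_single (fun m => f (y m))]
      · have h2 : ∏ m, (encChannel f (f (y m)) (y m) *
            (if m = w then r (y m) z / ρ (f (y m)) z else pB (y m))) =
            queryLaw pB r w y z * (ρ (f (y w)) z)⁻¹ := by
          simp only [encChannel, if_true, one_mul, queryLaw]
          rw [← Finset.mul_prod_erase Finset.univ _ (Finset.mem_univ w),
            ← Finset.mul_prod_erase Finset.univ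
              (fun m => if m = w then r (y m) z else pB (y m)) (Finset.mem_univ w)]
          have : ∏ m ∈ Finset.univ.erase w,
              (if m = w then r (y m) z / ρ (f (y m)) z else pB (y m)) =
              ∏ m ∈ Finset.univ.erase w, (if m = w then r (y m) z else pB (y m)) :=
            Finset.prod_congr rfl fun m hm => by simp [Finset.ne_of_mem_erase hm]
          rw [this]
          simp only [if_true, div_eq_mul_inv]
          ring
        rw [h2, div_eq_mul_inv, mul_inv]
        ring
      · intro σ _ hσ
        obtain ⟨m, hm⟩ : ∃ m, f (y m) ≠ σ m := by
          by_contra! hcon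
          exact hσ (funext fun m => (hcon m).symm)
        rw [Finset.prod_eq_zero (Finset.mem_univ m) (by simp [encChannel, hm]), mul_zero]
      · simp
    simp_rw [h1]
    rw [Finset.sum_comm]
    refine Finset.sum_le_sum fun σ _ => ?_
    rw [← Finset.mul_sum, sum_pi_prod (fun m b => encChannel f (σ m) b *
      (if m = w then r b z / ρ (σ m) z else pB b)), mul_comm]
    refine mul_le_mul_of_nonneg_right ?_ (by have := hc0 σ z w; positivity)
    rw [← Finset.mul_prod_erase Finset.univ _ (Finset.mem_univ w),
      ← Finset.mul_prod_erase Finset.univ (fun m => pS (σ m)) (Finset.mem_univ w), ← mul_assoc]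
    have h3 : ∏ m ∈ Finset.univ.erase w, ∑ b, encChannel f (σ m) b *
        (if m = w then r b z / ρ (σ m) z else pB b) = ∏ m ∈ Finset.univ.erase w, pS (σ m) :=
      Finset.prod_congr rfl fun m hm => by
        simp only [Finset.ne_of_mem_erase hm, if_false, pS]
        exact Finset.sum_congr rfl fun b _ => mul_comm _ _
    rw [h3]
    refine mul_le_mul_of_nonneg_right ?_ (Finset.prod_nonneg fun m _ => hpS0 _)
    simp only [if_true]
    have h4 : ∑ b, encChannel f (σ w) b * (r b z / ρ (σ w) z) = rS (σ w) z / ρ (σ w) z := by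
      simp only [rS, Finset.sum_div]
      exact Finset.sum_congr rfl fun b _ => by ring
    rw [h4]
    simp only [ρ]
    rcases (hrS0 (σ w) z).eq_or_lt with h5 | h5
    · rw [← h5, zero_div]; exact mul_nonneg (hpZ0 _) (hpS0 _)
    · rw [div_div_cancel₀ h5.ne']
  have key := sum_mul_log_nonpos
    (w := fun t : T => 1 / (M : ℝ) * queryLaw pB r t.1 t.2.1 t.2.2)
    (s := fun t => c (fun m => f (t.2.1 m)) t.2.2 t.1 / (2 * ρ (f (t.2.1 t.1)) t.2.2))
    (fun t => mul_nonneg (by positivity) (hq0 _ _ _)) ?_ ?_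
  · have hlog : ∑ t : T, 1 / (M : ℝ) * queryLaw pB r t.1 t.2.1 t.2.2 *
        Real.log (c (fun m => f (t.2.1 m)) t.2.2 t.1 / (2 * ρ (f (t.2.1 t.1)) t.2.2)) =
        ∑ t : T, (1 / (M : ℝ) * (queryLaw pB r t.1 t.2.1 t.2.2 *
          (if g (fun m => f (t.2.1 m)) t.2.2 = t.1 then 1 else 0)) * Real.log M -
          1 / (M : ℝ) * queryLaw pB r t.1 t.2.1 t.2.2 * Real.log 2 -
          1 / (M : ℝ) * (queryLaw pB r t.1 t.2.1 t.2.2 * Real.log (ρ (f (t.2.1 t.1)) t.2.2))) := by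
      refine Finset.sum_congr rfl fun t _ => ?_
      rcases (hq0 t.1 t.2.1 t.2.2).eq_or_lt with h | h
      · simp [← h]
      · have hr' : 0 < r (t.2.1 t.1) t.2.2 := by
          refine lt_of_le_of_ne (hr0 _ _) fun h0 => h.ne' ?_
          exact Finset.prod_eq_zero (Finset.mem_univ t.1) (by simp [← h0])
        have hρ' := hρpos _ _ hr'
        rw [Real.log_div (hc0 _ _ _).ne' (by positivity), Real.log_mul (by norm_num) hρ'.ne']
        have : Real.log (c (fun m => f (t.2.1 m)) t.2.2 t.1) =
            (if g (fun m => f (t.2.1 m)) t.2.2 = t.1 then 1 else 0) * Real.log M := by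
          simp only [c]; split_ifs <;> simp
        rw [this]
        ring
    rw [hlog, Finset.sum_sub_distrib, Finset.sum_sub_distrib, ← Finset.sum_mul, ← Finset.sum_mul,
      hsum1, one_mul] at key
    have hlast : ∑ t : T, 1 / (M : ℝ) * (queryLaw pB r t.1 t.2.1 t.2.2 *
        Real.log (ρ (f (t.2.1 t.1)) t.2.2)) = ∑ s, rateZ r (encChannel f s) := by
      rw [hrate]
      simp only [T, Fintype.sum_prod_type, ← Finset.mul_sum]
      simp_rw [sum_queryLaw hp1 _ (fun b z => Real.log (ρ (f b) z))]
      simp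
      field_simp
    rw [hlast] at key
    simp only [T, Fintype.sum_prod_type, ← Finset.mul_sum] at key ⊢
    linarith
  · intro t h
    have hr' : 0 < r (t.2.1 t.1) t.2.2 := by
      refine lt_of_le_of_ne (hr0 _ _) fun h0 => h.ne' ?_
      have : queryLaw pB r t.1 t.2.1 t.2.2 = 0 :=
        Finset.prod_eq_zero (Finset.mem_univ t.1) (by simp [← h0])
      simp [this]
    have := hρpos _ _ hr'
    exact div_pos (hc0 _ _ _) (by positivity)
  · rw [hsum1]
    calc _ = ∑ w : Fin M, 1 / (M : ℝ) * ∑ z, ∑ y : Fin M → B, queryLaw pB r w y z *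
          (c (fun m => f (y m)) z w / (2 * ρ (f (y w)) z)) := by
          simp only [T, Fintype.sum_prod_type, mul_assoc, ← Finset.mul_sum]
          congr 1
          exact Finset.sum_congr rfl fun w _ => Finset.sum_comm
      _ ≤ ∑ w : Fin M, 1 / (M : ℝ) * ∑ z, ∑ σ : Fin M → S,
          pZ z * (∏ m, pS (σ m)) * (c σ z w / 2) :=
          Finset.sum_le_sum fun w _ => mul_le_mul_of_nonneg_left
            (Finset.sum_le_sum fun z _ => hinner w z) (by positivity)
      _ = ∑ z, ∑ σ : Fin M → S, pZ z * (∏ m, pS (σ m)) *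
          (∑ w : Fin M, c σ z w / (2 * M)) := by
          simp_rw [Finset.mul_sum]
          rw [Finset.sum_comm]
          refine Finset.sum_congr rfl fun z _ => ?_
          rw [Finset.sum_comm]
          refine Finset.sum_congr rfl fun σ _ => Finset.sum_congr rfl fun w _ => ?_
          field_simp
      _ ≤ ∑ z, ∑ σ : Fin M → S, pZ z * (∏ m, pS (σ m)) * 1 := by
          refine Finset.sum_le_sum fun z _ => Finset.sum_le_sum fun σ _ =>
            mul_le_mul_of_nonneg_left ?_
              (mul_nonneg (hpZ0 z) (Finset.prod_nonneg fun m _ => hpS0 _))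
          rw [← Finset.sum_div, div_le_one (by positivity)]
          calc _ ≤ ∑ w : Fin M, ((if g σ z = w then (M : ℝ) else 0) + 1) := by
                refine Finset.sum_le_sum fun w _ => ?_
                simp only [c]
                split_ifs <;> linarith
            _ = 2 * M := by rw [Finset.sum_add_distrib]; simp; ring
      _ = 1 := by
          simp_rw [mul_one, ← Finset.mul_sum,
            sum_pi_eq_one (ι := Fin M) (p := fun _ => pS) (fun _ => hpS1), mul_one, hpZ1]

end Fano

/-! ### Rate and distortion bounds from the error probability. -/

section OneShotConverse

variable {A B E H S : Type*} [Fintype A] [Fintype B] [Fintype E] [Fintype S] [DecidableEq S]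

open Classical in
/-- The Fano bound in terms of the error probability. -/
lemma one_sub_oneShotErr_mul_log_le {p : A → B → ℝ} (hp0 : ∀ x y, 0 ≤ p x y)
    (hp1 : ∑ x, ∑ y, p x y = 1) {W : A → E → ℝ} (hW0 : ∀ x z, 0 ≤ W x z)
    (hW1 : ∀ x, ∑ z, W x z = 1) (Bad : A → H → Prop) {M : ℕ} (hM : 0 < M)
    (f : B → S) (g : (Fin M → S) → E → Fin M) (h : S → E → H) :
    (1 - oneShotErr p W Bad f g h) * Real.log M ≤
      ∑ s, rateZ (fun y z => ∑ x, p x y * W x z) (encChannel f s) + Real.log 2 := by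
  have hM' : (0 : ℝ) < M := by exact_mod_cast hM
  have hB1 : ∑ y, ∑ x, p x y = 1 := by rw [Finset.sum_comm]; exact hp1
  have hr : ∀ y, ∑ z, ∑ x, p x y * W x z = ∑ x, p x y := fun y => by
    rw [Finset.sum_comm]; simp_rw [← Finset.mul_sum, hW1, mul_one]
  have hr0 : ∀ y z, 0 ≤ ∑ x, p x y * W x z := fun y z =>
    Finset.sum_nonneg fun x _ => mul_nonneg (hp0 x y) (hW0 x z)
  refine le_trans (mul_le_mul_of_nonneg_right ?_ (Real.log_natCast_nonneg M))
    (fano_identification hr0 hB1 hr hM f g)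
  have hone : ∑ w : Fin M, 1 / (M : ℝ) * ∑ y : Fin M → B, ∑ z,
      queryLaw (fun y => ∑ x, p x y) (fun y z => ∑ x, p x y * W x z) w y z = 1 := by
    have := fun w : Fin M => sum_queryLaw (r := fun y z => ∑ x, p x y * W x z) hB1 w
      (fun _ _ => 1)
    simp only [mul_one] at this
    simp_rw [this, hr, hB1]
    simp
    field_simp
  rw [sub_le_iff_le_add]
  refine hone.symm.le.trans ?_
  rw [oneShotErr, ← Finset.sum_add_distrib]
  refine Finset.sum_le_sum fun w _ => ?_
  rw [← mul_add]
  refine mul_le_mul_of_nonneg_left ?_ (by positivity)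
  rw [Finset.sum_comm (s := (Finset.univ : Finset (Fin M → A))), ← Finset.sum_add_distrib]
  refine Finset.sum_le_sum fun y _ => ?_
  rw [Finset.sum_comm (s := (Finset.univ : Finset (Fin M → A))), ← Finset.sum_add_distrib]
  refine Finset.sum_le_sum fun z _ => ?_
  rw [← sum_codes_eq_queryLaw, Finset.sum_mul, ← Finset.sum_add_distrib]
  refine Finset.sum_le_sum fun x _ => ?_
  rw [← mul_add]
  refine le_mul_of_one_le_right
    (mul_nonneg (Finset.prod_nonneg fun m _ => hp0 _ _) (hW0 _ _)) ?_
  dsimp only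
  by_cases hc : g (fun m => f (y m)) z = w
  · rw [if_pos hc]
    exact le_add_of_nonneg_right (ind_nonneg _)
  · rw [if_neg hc, if_pos (Or.inl hc)]
    simp

open Classical in
/-- The expected distortion is controlled by the excess-distortion probability. -/
lemma sum_dist_le {p : A → B → ℝ} (hp0 : ∀ x y, 0 ≤ p x y)
    (hp1 : ∑ x, ∑ y, p x y = 1) {W : A → E → ℝ} (hW0 : ∀ x z, 0 ≤ W x z)
    (hW1 : ∀ x, ∑ z, W x z = 1) {δ : A → H → ℝ} {D K : ℝ} (hK : ∀ x xh, δ x xh ≤ D + K)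
    {M : ℕ} (hM : 0 < M)
    (f : B → S) (g : (Fin M → S) → E → Fin M) (h : S → E → H) :
    ∑ x, ∑ y, ∑ z, p x y * W x z * δ x (h (f y) z) ≤
      D + K * oneShotErr p W (fun x xh => D < δ x xh) f g h := by
  have hM' : (0 : ℝ) < M := by exact_mod_cast hM
  have hpw : ∑ a : A × B, p a.1 a.2 = 1 := by rw [Fintype.sum_prod_type]; exact hp1
  have hav : ∀ (w : Fin M) (G : A → B → ℝ), ∑ x : Fin M → A, ∑ y : Fin M → B,
      (∏ m, p (x m) (y m)) * G (x w) (y w) = ∑ x, ∑ y, p x y * G x y := by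
    intro w G
    rw [← sum_arrow_prod (fun (x : Fin M → A) (y : Fin M → B) =>
      (∏ m, p (x m) (y m)) * G (x w) (y w)),
      sum_pi_one (p := fun _ a => p a.1 a.2) (fun _ => hpw) w (fun a : A × B => G a.1 a.2),
      Fintype.sum_prod_type]
  have hmain : ∀ w : Fin M, ∑ x, ∑ y, ∑ z, p x y * W x z * (δ x (h (f y) z) - D) ≤
      K * ∑ x : Fin M → A, ∑ y : Fin M → B, ∑ z : E, (∏ m, p (x m) (y m)) * W (x w) z *
      (let wh := g (fun m => f (y m)) z
       if wh ≠ w ∨ D < δ (x w) (h (f (y wh)) z) then 1 else 0) := by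
    intro w
    calc _ = ∑ x, ∑ y, p x y * ∑ z, W x z * (δ x (h (f y) z) - D) := by
          simp_rw [Finset.mul_sum, mul_assoc]
      _ = ∑ x : Fin M → A, ∑ y : Fin M → B, (∏ m, p (x m) (y m)) *
          ∑ z, W (x w) z * (δ (x w) (h (f (y w)) z) - D) :=
          (hav w fun x y => ∑ z, W x z * (δ x (h (f y) z) - D)).symm
      _ ≤ _ := by
          simp_rw [Finset.mul_sum]
          refine Finset.sum_le_sum fun x _ => Finset.sum_le_sum fun y _ =>
            Finset.sum_le_sum fun z _ => ?_
          rw [← mul_assoc, mul_left_comm K]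
          refine mul_le_mul_of_nonneg_left ?_
            (mul_nonneg (Finset.prod_nonneg fun m _ => hp0 _ _) (hW0 _ _))
          -- On an error the excess distortion is at most `K`. Without error the decoder has used
          -- the bin of the true item and the excess is nonpositive.
          split_ifs with hc
          · linarith [hK (x w) (h (f (y w)) z)]
          · push Not at hc
            have := hc.2
            rw [hc.1] at this
            linarith
  have hD : ∑ x, ∑ y, ∑ z, p x y * W x z * (δ x (h (f y) z) - D) =
      ∑ x, ∑ y, ∑ z, p x y * W x z * δ x (h (f y) z) - D := by
    simp_rw [mul_sub, Finset.sum_sub_distrib, ← Finset.sum_mul, ← Finset.mul_sum, hW1, mul_one,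
      hp1, one_mul]
  rw [hD] at hmain
  rw [← sub_le_iff_le_add', oneShotErr, Finset.mul_sum]
  calc _ = ∑ w : Fin M, 1 / (M : ℝ) * (∑ x, ∑ y, ∑ z, p x y * W x z * δ x (h (f y) z) - D) := by
        simp; field_simp
    _ ≤ _ := Finset.sum_le_sum fun w _ => by
        rw [mul_left_comm]
        exact mul_le_mul_of_nonneg_left (hmain w) (by positivity)

end OneShotConverse

/-! ### From codes to block test channels. -/

section BlockConverse

variable {X Y Z Xh : Type*} [Fintype X] [Fintype Y] [Fintype Z]
  {PX : X → ℝ} {PYX : X → Y → ℝ} {PZX : X → Z → ℝ} {d : X → Xh → ℝ}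

lemma sum_block_pair {n : ℕ} (y : Fin n → Y) (z : Fin n → Z) :
    ∑ x : Fin n → X, (∏ i, PX (x i) * PYX (x i) (y i)) * (∏ i, PZX (x i) (z i)) =
      blockPair (pairYZ PX PYX PZX) n y z := by
  simp_rw [← Finset.prod_mul_distrib]
  exact sum_pi_prod (fun i x => PX x * PYX x (y i) * PZX x (z i))

lemma sum_block_dist (hPX : PX ∈ stdSimplex ℝ X)
    (hPYX : ∀ x, PYX x ∈ stdSimplex ℝ Y) (hPZX : ∀ x, PZX x ∈ stdSimplex ℝ Z)
    {n : ℕ} (y : Fin n → Y) (z : Fin n → Z) (xh : Fin n → Xh) :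
    ∑ x : Fin n → X, (∏ i, PX (x i) * PYX (x i) (y i)) * (∏ i, PZX (x i) (z i)) *
      ∑ i, d (x i) (xh i) =
      blockPair (pairYZ PX PYX PZX) n y z * blockSum (condDist PX PYX PZX d) n y z xh := by
  simp only [blockSum, Finset.mul_sum]
  rw [Finset.sum_comm]
  refine Finset.sum_congr rfl fun j _ => ?_
  have h1 : ∀ x : Fin n → X, (∏ i, PX (x i) * PYX (x i) (y i)) * (∏ i, PZX (x i) (z i)) *
      d (x j) (xh j) = ∏ i, (PX (x i) * PYX (x i) (y i) * PZX (x i) (z i) *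
        if i = j then d (x i) (xh i) else 1) := by
    intro x
    conv_rhs => rw [Finset.prod_mul_distrib,
      Finset.prod_ite_eq' Finset.univ j (fun i => d (x i) (xh i)), Finset.prod_mul_distrib]
    simp
  simp_rw [h1]
  rw [sum_pi_prod (fun i x => PX x * PYX x (y i) * PZX x (z i) *
        if i = j then d x (xh i) else 1), blockPair,
    ← Finset.mul_prod_erase Finset.univ _ (Finset.mem_univ j),
    ← Finset.mul_prod_erase Finset.univ (fun i => pairYZ PX PYX PZX (y i) (z i))
      (Finset.mem_univ j)]
  have h2 : ∏ i ∈ Finset.univ.erase j, ∑ x, PX x * PYX x (y i) * PZX x (z i) *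
      (if i = j then d x (xh i) else 1) =
      ∏ i ∈ Finset.univ.erase j, pairYZ PX PYX PZX (y i) (z i) :=
    Finset.prod_congr rfl fun i hi => by simp [Finset.ne_of_mem_erase hi, pairYZ]
  rw [h2, mul_right_comm, pairYZ_mul_condDist hPX hPYX hPZX]
  simp

/-- The Lagrangian of the block test channel induced by a code. -/
lemma exists_block_lagrangian_le (hPX : PX ∈ stdSimplex ℝ X)
    (hPYX : ∀ x, PYX x ∈ stdSimplex ℝ Y) (hPZX : ∀ x, PZX x ∈ stdSimplex ℝ Z) {μ β D K : ℝ}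
    (hμ : μ ∈ Set.Icc (0 : ℝ) 1) (hβ : β ∈ Set.Icc (0 : ℝ) 1)
    (hK : ∀ x xh, d x xh ≤ D + K) {n : ℕ} (hn : 0 < n) (C : Code Y Z Xh n) :
    lagrangian (blockPair (pairYZ PX PYX PZX) n) (blockSum (condDist PX PYX PZX d) n) μ β
      (encChannel C.f) C.h ≤ (1 - μ) * (1 - β) * Real.log C.L -
        (1 - μ) * ((1 - errProb PX PYX PZX d D C) * Real.log C.M - Real.log 2) +
        μ * (n * (D + K * errProb PX PYX PZX d D C)) := by
  have hn' : (0 : ℝ) < n := by exact_mod_cast hn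
  let p : (Fin n → X) → (Fin n → Y) → ℝ := fun x y => ∏ i, PX (x i) * PYX (x i) (y i)
  let W : (Fin n → X) → (Fin n → Z) → ℝ := fun x z => ∏ i, PZX (x i) (z i)
  have hp0 : ∀ x y, 0 ≤ p x y := fun x y =>
    Finset.prod_nonneg fun i _ => mul_nonneg (hPX.1 _) ((hPYX _).1 _)
  have hp1 : ∑ x, ∑ y, p x y = 1 := by
    rw [← sum_arrow_prod (fun (x : Fin n → X) (y : Fin n → Y) => ∏ i, PX (x i) * PYX (x i) (y i))]
    refine sum_pi_eq_one (p := fun _ (s : X × Y) => PX s.1 * PYX s.1 s.2) fun _ => ?_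
    rw [Fintype.sum_prod_type]
    simp_rw [← Finset.mul_sum, (hPYX _).2, mul_one, hPX.2]
  have hW0 : ∀ x z, 0 ≤ W x z := fun x z => Finset.prod_nonneg fun i _ => (hPZX _).1 _
  have hW1 : ∀ x, ∑ z, W x z = 1 := fun x =>
    sum_pi_eq_one (p := fun i => PZX (x i)) fun i => (hPZX _).2
  have hpair : (fun y z => ∑ x, p x y * W x z) = blockPair (pairYZ PX PYX PZX) n :=
    funext fun y => funext fun z => sum_block_pair y z
  have herr : errProb PX PYX PZX d D C =
    oneShotErr p W (fun x xh => D < blockDist d x xh) C.f C.g C.h := rfl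
  have hy := sum_rateY_encChannel_le (pB := fun y => ∑ z, blockPair (pairYZ PX PYX PZX) n y z)
    (fun y => Finset.sum_nonneg fun z _ =>
      blockPair_nonneg (pairYZ_nonneg hPX hPYX hPZX) n y z)
    (sum_sum_blockPair (sum_sum_pairYZ hPX hPYX hPZX) n) C.f
  have hz := one_sub_oneShotErr_mul_log_le hp0 hp1 hW0 hW1 (fun x xh => D < blockDist d x xh)
    C.M_pos C.f C.g C.h
  have hd := sum_dist_le (δ := blockDist d) (D := D) (K := K) hp0 hp1 hW0 hW1 (fun x xh => by
      rw [blockDist, one_div, inv_mul_le_iff₀ hn']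
      calc _ ≤ ∑ _i : Fin n, (D + K) := Finset.sum_le_sum fun i _ => hK _ _
        _ = _ := by simp [mul_add]) C.M_pos C.f C.g C.h
  rw [hpair, ← herr] at hz
  rw [← herr] at hd
  rw [Fintype.card_fin] at hy
  have hcost : ∑ s, cost (blockPair (pairYZ PX PYX PZX) n) (blockSum (condDist PX PYX PZX d) n)
      (encChannel C.f s) (C.h s) =
      n * ∑ x, ∑ y, ∑ z, p x y * W x z * blockDist d x (C.h (C.f y) z) := by
    simp only [cost]
    have h1 : ∀ y z s, blockPair (pairYZ PX PYX PZX) n y z * encChannel C.f s y *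
        blockSum (condDist PX PYX PZX d) n y z (C.h s z) = encChannel C.f s y *
        (blockPair (pairYZ PX PYX PZX) n y z *
          blockSum (condDist PX PYX PZX d) n y z (C.h s z)) := fun y z s => by ring
    simp_rw [h1]
    rw [Finset.sum_comm]
    have h2 : ∀ y, ∑ s, ∑ z, encChannel C.f s y * (blockPair (pairYZ PX PYX PZX) n y z *
        blockSum (condDist PX PYX PZX d) n y z (C.h s z)) =
        ∑ z, ∑ x, p x y * W x z * ∑ i, d (x i) (C.h (C.f y) z i) := by
      intro y
      rw [Finset.sum_comm]
      refine Finset.sum_congr rfl fun z _ => ?_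
      rw [sum_mul_encChannel C.f y]
      exact (sum_block_dist hPX hPYX hPZX _ _ _).symm
    simp_rw [h2]
    rw [eq_comm, Finset.sum_comm, Finset.mul_sum]
    refine Finset.sum_congr rfl fun y _ => ?_
    rw [Finset.sum_comm, Finset.mul_sum]
    refine Finset.sum_congr rfl fun z _ => ?_
    rw [Finset.mul_sum]
    refine Finset.sum_congr rfl fun x _ => ?_
    rw [blockDist]
    field_simp
  unfold lagrangian
  have hm1 : 0 ≤ 1 - μ := by linarith [hμ.2]
  have hb1 : 0 ≤ 1 - β := by linarith [hβ.2]
  have f1 := mul_le_mul_of_nonneg_left hy (mul_nonneg hm1 hb1)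
  have f2 := mul_le_mul_of_nonneg_left hz hm1
  have f3 := mul_le_mul_of_nonneg_left (mul_le_mul_of_nonneg_left hd hn'.le) hμ.1
  rw [hcost]
  linarith

/-- The weak converse. -/
theorem exists_lagrangian_le_of_mem_region [Finite Xh] [Nonempty Xh] (hPX : PX ∈ stdSimplex ℝ X)
    (hPYX : ∀ x, PYX x ∈ stdSimplex ℝ Y) (hPZX : ∀ x, PZX x ∈ stdSimplex ℝ Z) {Ri Rc D : ℝ}
    (h : (Ri, Rc, D) ∈ region PX PYX PZX d) {μ β : ℝ}
    (hμ : μ ∈ Set.Icc (0 : ℝ) 1) (hβ : β ∈ Set.Icc (0 : ℝ) 1) {δ : ℝ} (hδ : 0 < δ) :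
    ∃ (k : ℕ) (V : Fin k → Y → ℝ) (φ : Fin k → Z → Xh), IsTestChannel V ∧
      lagrangian (pairYZ PX PYX PZX) (condDist PX PYX PZX d) μ β V φ ≤
        (1 - μ) * ((1 - β) * Rc - Ri) + μ * D + δ := by
  by_contra! hcon
  set c := (1 - μ) * ((1 - β) * Rc - Ri) + μ * D + δ with hc
  have htens := nat_mul_le_block_lagrangian (pairYZ_nonneg hPX hPYX hPZX)
    (sum_sum_pairYZ hPX hPYX hPZX) (e := condDist PX PYX PZX d) hμ hβ
    (fun k V φ hV => (hcon k V φ hV).le)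
  obtain ⟨d0, hd0⟩ : ∃ d0 : ℝ, ∀ x xh, d x xh ≤ d0 := by
    obtain ⟨m, hm⟩ := (Set.finite_range fun s : X × Xh => d s.1 s.2).bddAbove
    exact ⟨m, fun x xh => hm ⟨(x, xh), rfl⟩⟩
  -- Large enough that `d ≤ D' + K` for every `D'` within one half of `D`.
  set K := |d0| + |D| + 1 with hK
  have hm1 : 0 ≤ 1 - μ := by linarith [hμ.2]
  have hb1 : 0 ≤ 1 - β := by linarith [hβ.2]
  -- The Lagrangian of a code, divided by `n`. One `ε` is lost to the closure and one to each limit,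
  -- and a last one pays for `log 2 / n`.
  have hbound : ∀ ε ∈ Set.Ioo (0 : ℝ) (1 / 2), c ≤ (1 - μ) * (1 - β) * (Rc + 2 * ε) -
      (1 - μ) * ((1 - 2 * ε) * (Ri - 2 * ε) - ε) + μ * (D + ε + K * (2 * ε)) := by
    intro ε hε
    have hmem := Set.mem_iInter₂.1 h ε ⟨hε.1, by linarith [hε.2]⟩
    obtain ⟨⟨Ri', Rc', D'⟩, ⟨C, hC1, hC2, hC3⟩, hdist⟩ := Metric.mem_closure_iff.1 hmem ε hε.1
    simp only [Prod.dist_eq, Real.dist_eq, max_lt_iff, abs_lt] at hdist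
    obtain ⟨⟨a1, a2⟩, ⟨a3, a4⟩, a5, a6⟩ := hdist
    have E1 : ∀ᶠ n : ℕ in atTop, Ri' - ε < 1 / (n : ℝ) * Real.log (C n).M := by
      have := eventually_lt_of_lt_liminf (lt_of_lt_of_le
        (EReal.coe_lt_coe_iff.2 (show Ri' - ε < Ri' by linarith [hε.1])) hC1)
      filter_upwards [this] with n hn using EReal.coe_lt_coe_iff.1 hn
    have E2 : ∀ᶠ n : ℕ in atTop, 1 / (n : ℝ) * Real.log (C n).L < Rc' + ε := by
      have := eventually_lt_of_limsup_lt (lt_of_le_of_lt hC2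
        (EReal.coe_lt_coe_iff.2 (show Rc' < Rc' + ε by linarith [hε.1])))
      filter_upwards [this] with n hn using EReal.coe_lt_coe_iff.1 hn
    have E3 : ∀ᶠ n : ℕ in atTop, errProb PX PYX PZX d D' (C n) < 2 * ε := by
      have := eventually_lt_of_limsup_lt (lt_of_le_of_lt hC3
        (EReal.coe_lt_coe_iff.2 (show ε < 2 * ε by linarith [hε.1])))
      filter_upwards [this] with n hn using EReal.coe_lt_coe_iff.1 hn
    have E4 : ∀ᶠ n : ℕ in atTop, Real.log 2 / n < ε :=
      (tendsto_const_div_atTop_nhds_zero_nat (Real.log 2)).eventually (gt_mem_nhds hε.1)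
    obtain ⟨n, e1, e2, e3, e4, hn⟩ := (E1.and (E2.and (E3.and (E4.and
      (eventually_gt_atTop 0))))).exists
    have hn' : (0 : ℝ) < n := by exact_mod_cast hn
    have hK' : ∀ x xh, d x xh ≤ D' + K := fun x xh => by
      linarith [hd0 x xh, le_abs_self d0, neg_abs_le D, hε.2]
    have hK0 : 0 ≤ K := by positivity
    have hle := (htens n (C n).L (encChannel (C n).f) (C n).h
      (isTestChannel_encChannel _)).trans
      (exists_block_lagrangian_le hPX hPYX hPZX hμ hβ hK' hn (C n))
    set Pe := errProb PX PYX PZX d D' (C n)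
    rw [one_div, inv_mul_eq_div, lt_div_iff₀ hn'] at e1
    rw [one_div, inv_mul_eq_div, div_lt_iff₀ hn'] at e2
    rw [div_lt_iff₀ hn'] at e4
    have hM0 : 0 ≤ Real.log (C n).M := Real.log_natCast_nonneg _
    -- The order matters: `log M` is nonnegative but `Ri - 2 * ε` need not be, so the error
    -- probability is replaced only in front of `log M`.
    have g1 : (1 - 2 * ε) * ((Ri - 2 * ε) * n) ≤ (1 - Pe) * Real.log (C n).M := by
      have h1 : (1 - 2 * ε) * ((Ri - 2 * ε) * n) ≤ (1 - 2 * ε) * Real.log (C n).M := by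
        refine mul_le_mul_of_nonneg_left ?_ (by linarith [hε.2])
        refine le_trans (mul_le_mul_of_nonneg_right ?_ hn'.le) e1.le
        linarith
      exact h1.trans (mul_le_mul_of_nonneg_right (by linarith) hM0)
    have g2 : Real.log (C n).L ≤ (Rc + 2 * ε) * n :=
      e2.le.trans (mul_le_mul_of_nonneg_right (by linarith) hn'.le)
    have g3 : n * (D' + K * Pe) ≤ n * (D + ε + K * (2 * ε)) := by
      refine mul_le_mul_of_nonneg_left ?_ hn'.le
      have := mul_le_mul_of_nonneg_left e3.le hK0
      linarith
    have f1 := mul_le_mul_of_nonneg_left g2 (mul_nonneg hm1 hb1)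
    have f2 := mul_le_mul_of_nonneg_left (sub_le_sub g1 e4.le) hm1
    have f3 := mul_le_mul_of_nonneg_left g3 hμ.1
    have : n * c ≤ n * ((1 - μ) * (1 - β) * (Rc + 2 * ε) -
      (1 - μ) * ((1 - 2 * ε) * (Ri - 2 * ε) - ε) + μ * (D + ε + K * (2 * ε))) := by
      linarith
    exact le_of_mul_le_mul_left this hn'
  have hlim : Tendsto (fun ε : ℝ => (1 - μ) * (1 - β) * (Rc + 2 * ε) -
      (1 - μ) * ((1 - 2 * ε) * (Ri - 2 * ε) - ε) + μ * (D + ε + K * (2 * ε))) (𝓝[>] 0)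
      (𝓝 ((1 - μ) * (1 - β) * (Rc + 2 * 0) -
      (1 - μ) * ((1 - 2 * 0) * (Ri - 2 * 0) - 0) + μ * (D + 0 + K * (2 * 0)))) := by
    apply Tendsto.mono_left _ nhdsWithin_le_nhds
    apply Continuous.tendsto
    fun_prop
  have := ge_of_tendsto hlim (by
    filter_upwards [Ioo_mem_nhdsGT (show (0 : ℝ) < 1 / 2 by norm_num)] with ε hε using hbound ε hε)
  have hcc : c = (1 - μ) * ((1 - β) * Rc - Ri) + μ * D + δ := hc
  nlinarith

end BlockConverse

/-! ### Bounding the size of the auxiliary alphabet -/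

section Cardinality

variable {Y Z Xh ι : Type*} [Fintype Y] [Fintype Z] [Fintype ι]

/-- A nonnegative combination of more than `|Y|` nonnegative vectors can be reduced without
increasing a linear objective. -/
lemma exists_support_card_lt {v : ι → Y → ℝ} (hv0 : ∀ i y, 0 ≤ v i y) (j : ι → ℝ) {t : ι → ℝ}
    (ht : ∀ i, 0 ≤ t i) (hv : ∀ i, t i ≠ 0 → ∃ y, 0 < v i y)
    (hcard : Fintype.card Y < (Finset.univ.filter fun i => t i ≠ 0).card) :
    ∃ t' : ι → ℝ, (∀ i, 0 ≤ t' i) ∧ (∀ i, t' i ≠ 0 → t i ≠ 0) ∧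
      (∃ i, t i ≠ 0 ∧ t' i = 0) ∧
      (∀ y, ∑ i, t' i * v i y = ∑ i, t i * v i y) ∧ ∑ i, t' i * j i ≤ ∑ i, t i * j i := by
  classical
  -- More than `|Y|` vectors of `Y → ℝ` are linearly dependent; the sign of the dependence is chosen
  -- so that the objective does not increase.
  obtain ⟨g, hg0, hgv, hgj, i0, hi0⟩ : ∃ g : ι → ℝ, (∀ i, t i = 0 → g i = 0) ∧
      (∀ y, ∑ i, g i * v i y = 0) ∧ ∑ i, g i * j i ≤ 0 ∧ ∃ i, g i ≠ 0 := by
    have hdep : ¬ LinearIndependent ℝ (fun i : {i // t i ≠ 0} => v i) := by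
      intro hli
      have h1 := hli.fintype_card_le_finrank
      rw [Module.finrank_fintype_fun_eq_card, Fintype.card_subtype] at h1
      omega
    obtain ⟨g, hg, i0, hi0⟩ := Fintype.not_linearIndependent_iff.1 hdep
    let G : ι → ℝ := fun i => if h : t i ≠ 0 then g ⟨i, h⟩ else 0
    have hG0 : ∀ i, t i = 0 → G i = 0 := fun i h => by simp [G, h]
    have hGs : ∀ y, ∑ i, G i * v i y = 0 := by
      intro y
      have h1 := congrFun hg y
      simp only [Finset.sum_apply, Pi.smul_apply, smul_eq_mul, Pi.zero_apply] at h1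
      have h2 : ∑ i, G i * v i y = ∑ i ∈ Finset.univ.filter (fun i => t i ≠ 0), G i * v i y := by
        rw [Finset.sum_filter]
        refine Finset.sum_congr rfl fun i _ => ?_
        by_cases h : t i = 0 <;> simp [h, hG0]
      rw [h2, Finset.sum_subtype (p := fun i => t i ≠ 0) _ (by simp)]
      refine Eq.trans ?_ h1
      exact Finset.sum_congr rfl fun i _ => by simp [G, i.2]
    have hGi : G i0 ≠ 0 := by simpa [G, i0.2] using hi0
    rcases le_total (∑ i, G i * j i) 0 with h | h
    · exact ⟨G, hG0, hGs, h, i0, hGi⟩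
    · refine ⟨fun i => -G i, fun i hi => by simp [hG0 i hi], fun y => ?_, ?_, i0, by simpa⟩
      · simp [hGs]
      · simpa using h
  have hneg : ∃ i, g i < 0 := by
    by_contra! hc
    obtain ⟨y, hy⟩ := hv i0 fun h => hi0 (hg0 _ h)
    have h1 := (Finset.sum_eq_zero_iff_of_nonneg fun i _ => mul_nonneg (hc i) (hv0 i y)).1
      (hgv y) i0 (Finset.mem_univ _)
    exact (mul_ne_zero hi0 hy.ne') h1
  obtain ⟨i1, hi1, hmin⟩ := Finset.exists_min_image (Finset.univ.filter fun i => g i < 0)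
    (fun i => t i / -g i) (by obtain ⟨i, hi⟩ := hneg; exact ⟨i, by simpa using hi⟩)
  rw [Finset.mem_filter] at hi1
  have hgn : 0 < -g i1 := by linarith [hi1.2]
  -- The largest step that keeps all coefficients nonnegative; the coefficient of `i1` becomes zero.
  set s := t i1 / -g i1 with hs
  have hs0 : 0 ≤ s := div_nonneg (ht _) hgn.le
  refine ⟨fun i => t i + s * g i, fun i => ?_, fun i h1 h2 => h1 (by simp [h2, hg0 i h2]),
    ⟨i1, fun h => hi1.2.ne (hg0 _ h), ?_⟩, fun y => ?_, ?_⟩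
  · rcases lt_or_ge (g i) 0 with h | h
    · have h1 := hmin i (by simpa using h)
      rw [le_div_iff₀ (by linarith)] at h1
      linarith
    · exact add_nonneg (ht i) (mul_nonneg hs0 h)
  · have : s * -g i1 = t i1 := div_mul_cancel₀ _ hgn.ne'
    linarith
  · simp only [add_mul, Finset.sum_add_distrib, mul_assoc, ← Finset.mul_sum, hgv]
    simp
  · simp only [add_mul, Finset.sum_add_distrib, mul_assoc, ← Finset.mul_sum]
    nlinarith

lemma exists_support_card_le {v : ι → Y → ℝ} (hv0 : ∀ i y, 0 ≤ v i y) (j : ι → ℝ) :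
    ∀ (n : ℕ) (t : ι → ℝ), (∀ i, 0 ≤ t i) → (∀ i, t i ≠ 0 → ∃ y, 0 < v i y) →
    (Finset.univ.filter fun i => t i ≠ 0).card ≤ n →
    ∃ t' : ι → ℝ, (∀ i, 0 ≤ t' i) ∧
      (Finset.univ.filter fun i => t' i ≠ 0).card ≤ Fintype.card Y ∧
      (∀ y, ∑ i, t' i * v i y = ∑ i, t i * v i y) ∧ ∑ i, t' i * j i ≤ ∑ i, t i * j i := by
  intro n
  induction n with
  | zero => exact fun t ht _ hn => ⟨t, ht, hn.trans (Nat.zero_le _), fun _ => rfl, le_rfl⟩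
  | succ n ih =>
    intro t ht hv hn
    rcases le_or_gt (Finset.univ.filter fun i => t i ≠ 0).card (Fintype.card Y) with h | h
    · exact ⟨t, ht, h, fun _ => rfl, le_rfl⟩
    · obtain ⟨t1, h1, h2, ⟨i, hi1, hi2⟩, h3, h4⟩ := exists_support_card_lt hv0 j ht hv h
      have hlt : (Finset.univ.filter fun i => t1 i ≠ 0).card <
          (Finset.univ.filter fun i => t i ≠ 0).card := by
        refine Finset.card_lt_card ((Finset.ssubset_iff_of_subset fun a ha => ?_).2
          ⟨i, by simpa using hi1, by simpa using hi2⟩)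
        simp only [Finset.mem_filter, Finset.mem_univ, true_and] at ha ⊢
        exact h2 a ha
      obtain ⟨t', g1, g2, g3, g4⟩ := ih t1 h1 (fun a ha => hv a (h2 a ha)) (by omega)
      exact ⟨t', g1, g2, fun y => (g3 y).trans (h3 y), g4.trans h4⟩

lemma lagrangian_eq_sum (p : Y → Z → ℝ) (e : Y → Z → Xh → ℝ) (μ β : ℝ) (V : ι → Y → ℝ)
    (φ : ι → Z → Xh) : lagrangian p e μ β V φ =
      ∑ u, ((1 - μ) * (1 - β) * rateY (fun y => ∑ z, p y z) (V u) - (1 - μ) * rateZ p (V u) +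
        μ * cost p e (V u) (φ u)) := by
  simp only [lagrangian, Finset.sum_add_distrib, Finset.sum_sub_distrib, Finset.mul_sum]

/-- By homogeneity, rescaling the rows of `V` changes the Lagrangian linearly, and the only
constraint is that the rows sum to the all-one vector of `Y → ℝ`. A Carathéodory reduction therefore
leaves at most `|Y|` symbols. -/
theorem exists_lagrangian_le_card_le {p : Y → Z → ℝ} {e : Y → Z → Xh → ℝ} {μ β : ℝ}
    {V : ι → Y → ℝ} (hV : IsTestChannel V) (φ : ι → Z → Xh) :
    ∃ k ≤ Fintype.card Y, ∃ (V' : Fin k → Y → ℝ) (φ' : Fin k → Z → Xh), IsTestChannel V' ∧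
      lagrangian p e μ β V' φ' ≤ lagrangian p e μ β V φ := by
  classical
  let J : (Y → ℝ) → (Z → Xh) → ℝ := fun v f => (1 - μ) * (1 - β) *
    rateY (fun y => ∑ z, p y z) v - (1 - μ) * rateZ p v + μ * cost p e v f
  have hJ : ∀ (s : ℝ) v f, J (s • v) f = s * J v f := fun s v f => by
    simp only [J, rateY_smul, rateZ_smul, cost_smul]; ring
  -- Zero rows get weight zero, because the reduction needs nonzero vectors.
  let t : ι → ℝ := fun u => if V u = 0 then 0 else 1
  have htV : ∀ u, t u • V u = V u := fun u => by
    by_cases h : V u = 0 <;> simp [t, h]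
  obtain ⟨t', h1, h2, h3, h4⟩ := exists_support_card_le hV.nonneg (fun u => J (V u) (φ u)) _ t
    (fun u => by dsimp only [t]; split_ifs <;> norm_num)
    (fun u hu => by
      have h0 : V u ≠ 0 := fun h => hu (by simp [t, h])
      obtain ⟨y, hy⟩ := Function.ne_iff.1 h0
      exact ⟨y, lt_of_le_of_ne (hV.nonneg u y) (Ne.symm hy)⟩) le_rfl
  set S := Finset.univ.filter fun i => t' i ≠ 0 with hS
  let f : Fin S.card ≃ S := S.equivFin.symm
  have hsum : ∀ a : ι → ℝ, ∑ i : Fin S.card, t' (f i) * a (f i) = ∑ i, t' i * a i := by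
    intro a
    rw [f.sum_comp (fun i : S => t' i * a i), Finset.sum_coe_sort S (fun i => t' i * a i), hS,
      Finset.sum_filter]
    refine Finset.sum_congr rfl fun i _ => ?_
    by_cases h : t' i = 0 <;> simp [h]
  refine ⟨S.card, h2, fun i => t' (f i) • V (f i), fun i => φ (f i), ⟨fun u y => ?_, fun y => ?_⟩, ?_⟩
  · exact mul_nonneg (h1 _) (hV.nonneg _ _)
  · simp only [Pi.smul_apply, smul_eq_mul]
    rw [hsum fun i => V i y, h3, ← hV.sum_eq_one y]
    exact Finset.sum_congr rfl fun u _ => congrFun (htV u) y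
  · rw [lagrangian_eq_sum, lagrangian_eq_sum]
    change ∑ u, J (t' (f u) • V (f u)) (φ (f u)) ≤ ∑ u, J (V u) (φ u)
    simp only [hJ]
    rw [hsum fun i => J (V i) (φ i)]
    refine h4.trans (le_of_eq (Finset.sum_congr rfl fun u _ => ?_))
    rw [← hJ, htV]

end Cardinality

/-! ### Marginals of finite mass functions -/

section Law

variable {T A B : Type*} [Fintype T] {Q : T → ℝ}

lemma law_nonneg (hQ : ∀ t, 0 ≤ Q t) (f : T → A) (a : A) : 0 ≤ law Q f a := by
  classical
  exact Finset.sum_nonneg fun t _ => by split_ifs <;> simp [hQ]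

lemma le_law (hQ : ∀ t, 0 ≤ Q t) (f : T → A) (t : T) : Q t ≤ law Q f (f t) := by
  classical
  refine le_trans ?_ (Finset.single_le_sum (f := fun s => if f s = f t then Q s else 0)
    (fun s _ => by split_ifs <;> simp [hQ]) (Finset.mem_univ t))
  simp

lemma law_le_law (hQ : ∀ t, 0 ≤ Q t) (f : T → A) (g : T → B) (a : A) (b : B)
    (h : ∀ t, f t = a → g t = b) : law Q f a ≤ law Q g b := by
  classical
  refine Finset.sum_le_sum fun t _ => ?_
  by_cases h1 : f t = a
  · simp [h1, h t h1]
  · rw [if_neg h1]; split_ifs <;> simp [hQ]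

lemma law_congr (Q : T → ℝ) (f : T → A) (g : T → B) (a : A) (b : B)
    (h : ∀ t, f t = a ↔ g t = b) : law Q f a = law Q g b := by
  classical
  exact Finset.sum_congr rfl fun t _ => by simp only [h]

lemma law_eq_apply (Q : T → ℝ) (f : T → A) (t : T) (h : ∀ s, f s = f t → s = t) :
    law Q f (f t) = Q t := by
  classical
  rw [law, Finset.sum_eq_single t]
  · simp
  · intro s _ hs
    rw [if_neg fun h1 => hs (h s h1)]
  · simp

lemma law_le_one (hQ : Q ∈ stdSimplex ℝ T) (f : T → A) (a : A) : law Q f a ≤ 1 := by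
  classical
  rw [← hQ.2]
  exact Finset.sum_le_sum fun t _ => by split_ifs <;> simp [hQ.1]

lemma condLaw_pos (hQ : ∀ t, 0 ≤ Q t) (f : T → A) (g : T → B) {t : T} (ht : 0 < Q t) :
    0 < condLaw Q f g (f t) (g t) :=
  div_pos (ht.trans_le (le_law hQ (fun s => (f s, g s)) t)) (ht.trans_le (le_law hQ g t))

lemma log_condLaw (hQ : ∀ t, 0 ≤ Q t) (f : T → A) (g : T → B) {t : T} (ht : 0 < Q t) :
    Real.log (condLaw Q f g (f t) (g t)) =
      Real.log (law Q (fun s => (f s, g s)) (f t, g t)) - Real.log (law Q g (g t)) :=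
  Real.log_div (ht.trans_le (le_law hQ (fun s => (f s, g s)) t)).ne'
    (ht.trans_le (le_law hQ g t)).ne'

lemma continuous_law (f : T → A) (a : A) : Continuous fun Q : T → ℝ => law Q f a := by
  classical
  unfold law
  refine continuous_finsetSum _ fun t _ => ?_
  split_ifs <;> fun_prop

end Law

lemma logRatio_of_pos {a b : ℝ} (ha : 0 < a) (hb : 0 < b) :
    logRatio a b = ((Real.log a - Real.log b : ℝ) : EReal) := by
  rw [logRatio, ← ENNReal.ofReal_div_of_pos hb, ENNReal.log_ofReal_of_pos (div_pos ha hb),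
    Real.log_div ha.ne' hb.ne']

lemma logRatio_zero {a : ℝ} (ha : 0 < a) : logRatio a 0 = ⊤ := by
  rw [logRatio, ENNReal.ofReal_zero, ENNReal.div_zero (by simpa using ha), ENNReal.log_top]

lemma logRatio_ne_bot {a b : ℝ} (ha : 0 < a) : logRatio a b ≠ ⊥ := by
  rw [logRatio, Ne, ENNReal.log_eq_bot_iff, ENNReal.div_eq_zero_iff]
  simpa using ha

lemma coe_mul_ne_bot {c : ℝ} (hc : 0 ≤ c) {x : EReal} (hx : x ≠ ⊥) : (c : EReal) * x ≠ ⊥ := by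
  rcases hc.eq_or_lt with rfl | hc
  · simp
  induction x with
  | bot => exact absurd rfl hx
  | coe x => rw [← EReal.coe_mul]; exact EReal.coe_ne_bot _
  | top => rw [EReal.coe_mul_top_of_pos hc]; simp

/-! ### The exponent function in terms of real logarithms -/

section RealOmega

variable {X Y Z Xh U : Type*} [Fintype X] [Fintype Y] [Fintype Z] [Fintype Xh] [Fintype U]

/-- The logarithm of `Q` against `P_XYZ Q_{U|Y} Q_{X̂|ZU}`. -/
noncomputable def markovTerm (PX : X → ℝ) (PYX : X → Y → ℝ) (PZX : X → Z → ℝ)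
    (Q : X × Y × Z × U × Xh → ℝ) (t : X × Y × Z × U × Xh) : ℝ :=
  Real.log (Q t) - Real.log (jointXYZ PX PYX PZX (t.1, t.2.1, t.2.2.1))
  + Real.log (law Q (fun s => s.2.1) t.2.1)
  - Real.log (law Q (fun s => (s.2.1, s.2.2.2.1)) (t.2.1, t.2.2.2.1))
  + Real.log (law Q (fun s => (s.2.2.1, s.2.2.2.1)) (t.2.2.1, t.2.2.2.1))
  - Real.log (law Q (fun s => (s.2.2.1, s.2.2.2.1, s.2.2.2.2)) (t.2.2.1, t.2.2.2.1, t.2.2.2.2))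

/-- The part of `ω` that is proportional to `α`. -/
noncomputable def rateTerm (PX : X → ℝ) (PYX : X → Y → ℝ) (PZX : X → Z → ℝ) (d : X → Xh → ℝ) (μ β : ℝ)
    (Q : X × Y × Z × U × Xh → ℝ) (t : X × Y × Z × U × Xh) : ℝ :=
  (1 - μ) * (1 - β) *
    (Real.log (law Q (fun s => (s.2.1, s.2.2.1, s.2.2.2.1)) (t.2.1, t.2.2.1, t.2.2.2.1))
    - Real.log (law Q (fun s => s.2.2.2.1) t.2.2.2.1)
    - Real.log (law (jointXYZ PX PYX PZX) (fun s => (s.2.1, s.2.2)) (t.2.1, t.2.2.1)))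
  + (1 - μ) * (Real.log (law Q (fun s => s.2.2.1) t.2.2.1)
    + Real.log (law Q (fun s => s.2.2.2.1) t.2.2.2.1)
    - Real.log (law Q (fun s => (s.2.2.1, s.2.2.2.1)) (t.2.2.1, t.2.2.2.1)))
  + μ * d t.1 t.2.2.2.2

variable {PX : X → ℝ} {PYX : X → Y → ℝ} {PZX : X → Z → ℝ} {d : X → Xh → ℝ}

lemma jointXYZ_nonneg (hPX : PX ∈ stdSimplex ℝ X) (hPYX : ∀ x, PYX x ∈ stdSimplex ℝ Y)
    (hPZX : ∀ x, PZX x ∈ stdSimplex ℝ Z) (s : X × Y × Z) : 0 ≤ jointXYZ PX PYX PZX s :=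
  mul_nonneg (mul_nonneg (hPX.1 _) ((hPYX _).1 _)) ((hPZX _).1 _)

lemma jointXYZ_mem_stdSimplex (hPX : PX ∈ stdSimplex ℝ X) (hPYX : ∀ x, PYX x ∈ stdSimplex ℝ Y)
    (hPZX : ∀ x, PZX x ∈ stdSimplex ℝ Z) :
    jointXYZ PX PYX PZX ∈ stdSimplex ℝ (X × Y × Z) := by
  refine ⟨jointXYZ_nonneg hPX hPYX hPZX, ?_⟩
  simp only [Fintype.sum_prod_type, jointXYZ]
  simp_rw [← Finset.mul_sum, (hPZX _).2, mul_one, ← Finset.mul_sum, (hPYX _).2, mul_one]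
  exact hPX.2

/-- All marginals occurring are positive, so the `EReal` logarithms are real; the first four terms
telescope to `markovTerm`. -/
lemma omega_of_pos (hPX : PX ∈ stdSimplex ℝ X) (hPYX : ∀ x, PYX x ∈ stdSimplex ℝ Y)
    (hPZX : ∀ x, PZX x ∈ stdSimplex ℝ Z) {Q : X × Y × Z × U × Xh → ℝ} (hQ : ∀ t, 0 ≤ Q t)
    (α μ β : ℝ) {t : X × Y × Z × U × Xh} (ht : 0 < Q t)
    (hP : 0 < jointXYZ PX PYX PZX (t.1, t.2.1, t.2.2.1)) :
    omega PX PYX PZX d α μ β Q t =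
      ((markovTerm PX PYX PZX Q t + α * rateTerm PX PYX PZX d μ β Q t : ℝ) : EReal) := by
  obtain ⟨x, y, z, u, xh⟩ := t
  have hP0 := jointXYZ_nonneg hPX hPYX hPZX
  have e1 := law_congr Q (fun s : X × Y × Z × U × Xh => (s.2.2.1, s.2.1, s.2.2.2.1))
    (fun s => (s.2.1, s.2.2.1, s.2.2.2.1)) (z, y, u) (y, z, u) (by simp; tauto)
  have e2 := law_congr Q (fun s : X × Y × Z × U × Xh => ((s.1, s.2.1), (s.2.2.1, s.2.2.2.1)))
    (fun s => (s.1, s.2.1, s.2.2.1, s.2.2.2.1)) ((x, y), (z, u)) (x, y, z, u) (by simp; tauto)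
  have e3 := law_eq_apply Q (fun s : X × Y × Z × U × Xh =>
    ((s.1, s.2.1), (s.2.2.1, s.2.2.2.1, s.2.2.2.2))) (x, y, z, u, xh)
    (by rintro ⟨a, b, c, f, g⟩; simp; tauto)
  have e4 := law_congr Q (fun s : X × Y × Z × U × Xh => ((s.2.1, s.2.2.1), s.2.2.2.1))
    (fun s => (s.2.1, s.2.2.1, s.2.2.2.1)) ((y, z), u) (y, z, u) (by simp; tauto)
  have e5 := law_congr (jointXYZ PX PYX PZX) (fun s : X × Y × Z => (s.2.2, s.2.1))
    (fun s => (s.2.1, s.2.2)) (z, y) (y, z) (by simp; tauto)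
  have e6 := law_eq_apply (jointXYZ PX PYX PZX) (fun s : X × Y × Z => (s.1, s.2.1, s.2.2))
    (x, y, z) (by rintro ⟨a, b, c⟩; simp)
  dsimp only at e3 e6 hP
  have c1 := log_condLaw hQ (fun s => s.2.2.1) (fun s => (s.2.1, s.2.2.2.1)) ht
  have c2 := log_condLaw hQ (fun s => s.1) (fun s => (s.2.1, s.2.2.1, s.2.2.2.1)) ht
  have c3 := log_condLaw hQ (fun s => (s.1, s.2.1)) (fun s => (s.2.2.1, s.2.2.2.1, s.2.2.2.2)) ht
  have c4 := log_condLaw hQ (fun s => (s.1, s.2.1)) (fun s => (s.2.2.1, s.2.2.2.1)) ht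
  have c5 := log_condLaw hQ (fun s => (s.2.1, s.2.2.1)) (fun s => s.2.2.2.1) ht
  have c6 := log_condLaw hQ (fun s => s.2.2.1) (fun s => s.2.2.2.1) ht
  have c7 := log_condLaw hP0 (fun s => s.2.2) (fun s => s.2.1) hP
  have c8 := log_condLaw hP0 (fun s => s.1) (fun s => (s.2.1, s.2.2)) hP
  dsimp only at c1 c2 c3 c4 c5 c6 c7 c8
  rw [e1] at c1
  rw [e3] at c3
  rw [e2] at c4
  rw [e4] at c5
  rw [e5] at c7
  rw [e6] at c8
  unfold omega
  dsimp only
  rw [logRatio_of_pos (ht.trans_le (le_law hQ (fun s => s.2.1) _))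
      (hP.trans_le (le_law hP0 (fun s => s.2.1) _)),
    logRatio_of_pos (condLaw_pos hQ (fun s => s.2.2.1) (fun s => (s.2.1, s.2.2.2.1)) ht)
      (condLaw_pos hP0 (fun s => s.2.2) (fun s => s.2.1) hP),
    logRatio_of_pos (condLaw_pos hQ (fun s => s.1) (fun s => (s.2.1, s.2.2.1, s.2.2.2.1)) ht)
      (condLaw_pos hP0 (fun s => s.1) (fun s => (s.2.1, s.2.2)) hP),
    logRatio_of_pos (condLaw_pos hQ (fun s => (s.1, s.2.1))
      (fun s => (s.2.2.1, s.2.2.2.1, s.2.2.2.2)) ht)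
      (condLaw_pos hQ (fun s => (s.1, s.2.1)) (fun s => (s.2.2.1, s.2.2.2.1)) ht),
    logRatio_of_pos (condLaw_pos hQ (fun s => (s.2.1, s.2.2.1)) (fun s => s.2.2.2.1) ht)
      (hP.trans_le (le_law hP0 (fun s => (s.2.1, s.2.2)) _)),
    logRatio_of_pos (ht.trans_le (le_law hQ (fun s => s.2.2.1) _))
      (condLaw_pos hQ (fun s => s.2.2.1) (fun s => s.2.2.2.1) ht)]
  dsimp only
  rw [c1, c2, c3, c4, c5, c6, c7, c8]
  norm_cast
  unfold markovTerm rateTerm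
  dsimp only
  ring

/-- The term with denominator P(x | y, z) = 0 is `⊤`, and no other summand is `⊥` because its
numerator is positive. -/
lemma omega_of_eq_zero (hPX : PX ∈ stdSimplex ℝ X) (hPYX : ∀ x, PYX x ∈ stdSimplex ℝ Y)
    (hPZX : ∀ x, PZX x ∈ stdSimplex ℝ Z) {Q : X × Y × Z × U × Xh → ℝ} (hQ : ∀ t, 0 ≤ Q t)
    {α μ β : ℝ} (hα : 0 ≤ α) (hμ : μ ∈ Set.Icc (0 : ℝ) 1) (hβ : β ∈ Set.Icc (0 : ℝ) 1)
    {t : X × Y × Z × U × Xh} (ht : 0 < Q t)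
    (hP : jointXYZ PX PYX PZX (t.1, t.2.1, t.2.2.1) = 0) :
    omega PX PYX PZX d α μ β Q t = ⊤ := by
  obtain ⟨x, y, z, u, xh⟩ := t
  have hP0 := jointXYZ_nonneg hPX hPYX hPZX
  have e6 := law_eq_apply (jointXYZ PX PYX PZX) (fun s : X × Y × Z => (s.1, s.2.1, s.2.2))
    (x, y, z) (by rintro ⟨a, b, c⟩; simp)
  dsimp only at e6 hP
  have q1 := ht.trans_le (le_law hQ (fun s => s.2.1) _)
  have q2 := condLaw_pos hQ (fun s => s.2.2.1) (fun s => (s.2.1, s.2.2.2.1)) ht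
  have q3 := condLaw_pos hQ (fun s => s.1) (fun s => (s.2.1, s.2.2.1, s.2.2.2.1)) ht
  have q4 := condLaw_pos hQ (fun s => (s.1, s.2.1))
      (fun s => (s.2.2.1, s.2.2.2.1, s.2.2.2.2)) ht
  have q5 := condLaw_pos hQ (fun s => (s.2.1, s.2.2.1)) (fun s => s.2.2.2.1) ht
  have q6 := ht.trans_le (le_law hQ (fun s => s.2.2.1) _)
  unfold omega
  dsimp only at q1 q2 q3 q4 q5 q6 ⊢
  have hrest : (α : EReal) *
    ((((1 - μ) * (1 - β) : ℝ) : EReal) *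
        logRatio (condLaw Q (fun s => (s.2.1, s.2.2.1)) (fun s => s.2.2.2.1) (y, z) u)
          (law (jointXYZ PX PYX PZX) (fun s => (s.2.1, s.2.2)) (y, z))
      + ((1 - μ : ℝ) : EReal) * logRatio (law Q (fun s => s.2.2.1) z)
        (condLaw Q (fun s => s.2.2.1) (fun s => s.2.2.2.1) z u)
      + ((μ * d x xh : ℝ) : EReal)) ≠ ⊥ := by
    have hm1 : 0 ≤ 1 - μ := by linarith [hμ.2]
    have hb1 : 0 ≤ 1 - β := by linarith [hβ.2]
    refine coe_mul_ne_bot hα (EReal.add_ne_bot_iff.2 ⟨EReal.add_ne_bot_iff.2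
      ⟨coe_mul_ne_bot (mul_nonneg hm1 hb1) (logRatio_ne_bot q5),
        coe_mul_ne_bot hm1 (logRatio_ne_bot q6)⟩, EReal.coe_ne_bot _⟩)
  have hmain : logRatio (law Q (fun s => s.2.1) y) (law (jointXYZ PX PYX PZX) (fun s => s.2.1) y) +
      logRatio (condLaw Q (fun s => s.2.2.1) (fun s => (s.2.1, s.2.2.2.1)) z (y, u))
        (condLaw (jointXYZ PX PYX PZX) (fun s => s.2.2) (fun s => s.2.1) z y) +
      logRatio (condLaw Q (fun s => s.1) (fun s => (s.2.1, s.2.2.1, s.2.2.2.1)) x (y, z, u))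
        (condLaw (jointXYZ PX PYX PZX) (fun s => s.1) (fun s => (s.2.1, s.2.2)) x (y, z)) = ⊤ := by
    have hc : condLaw (jointXYZ PX PYX PZX) (fun s => s.1) (fun s => (s.2.1, s.2.2)) x (y, z) = 0 := by
      rw [condLaw, e6, hP, zero_div]
    rw [hc, logRatio_zero q3]
    exact EReal.add_top_of_ne_bot (EReal.add_ne_bot_iff.2
      ⟨logRatio_ne_bot q1, logRatio_ne_bot q2⟩)
  rw [hmain, EReal.top_add_of_ne_bot (logRatio_ne_bot q4), EReal.top_add_of_ne_bot hrest]

/-- The expectation of `exp (-θ ω)` under `Q`. -/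
noncomputable def expSum (PX : X → ℝ) (PYX : X → Y → ℝ) (PZX : X → Z → ℝ) (d : X → Xh → ℝ) (α μ β θ : ℝ)
    (Q : X × Y × Z × U × Xh → ℝ) : ℝ :=
  ∑ t, if jointXYZ PX PYX PZX (t.1, t.2.1, t.2.2.1) = 0 then 0 else
    Q t * Real.exp (-(θ * (markovTerm PX PYX PZX Q t + α * rateTerm PX PYX PZX d μ β Q t)))

lemma OmegaQ_eq (hPX : PX ∈ stdSimplex ℝ X) (hPYX : ∀ x, PYX x ∈ stdSimplex ℝ Y)
    (hPZX : ∀ x, PZX x ∈ stdSimplex ℝ Z) {Q : X × Y × Z × U × Xh → ℝ} (hQ : ∀ t, 0 ≤ Q t)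
    {α μ β θ : ℝ} (hα : 0 ≤ α) (hμ : μ ∈ Set.Icc (0 : ℝ) 1) (hβ : β ∈ Set.Icc (0 : ℝ) 1)
    (hθ : 0 < θ) : OmegaQ PX PYX PZX d α μ β θ Q =
      -ENNReal.log (ENNReal.ofReal (expSum PX PYX PZX d α μ β θ Q)) := by
  have hP0 := jointXYZ_nonneg hPX hPYX hPZX
  rw [OmegaQ, expSum, ENNReal.ofReal_sum_of_nonneg]
  · congr 2
    refine Finset.sum_congr rfl fun t _ => ?_
    rcases (hQ t).eq_or_lt with h | h
    · simp [← h]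
    rcases (hP0 (t.1, t.2.1, t.2.2.1)).eq_or_lt with h1 | h1
    · rw [omega_of_eq_zero hPX hPYX hPZX hQ hα hμ hβ h h1.symm, if_pos h1.symm,
        EReal.coe_mul_top_of_pos hθ]
      simp
    · rw [omega_of_pos hPX hPYX hPZX hQ α μ β h h1, if_neg h1.ne', ← EReal.coe_mul,
        ← EReal.coe_neg, EReal.exp_coe, ENNReal.ofReal_mul (hQ t)]
  · intro t _
    split_ifs
    · exact le_rfl
    · exact mul_nonneg (hQ t) (Real.exp_nonneg _)

lemma OmegaQ_le_coe_iff (hPX : PX ∈ stdSimplex ℝ X) (hPYX : ∀ x, PYX x ∈ stdSimplex ℝ Y)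
    (hPZX : ∀ x, PZX x ∈ stdSimplex ℝ Z) {Q : X × Y × Z × U × Xh → ℝ} (hQ : ∀ t, 0 ≤ Q t)
    {α μ β θ : ℝ} (hα : 0 ≤ α) (hμ : μ ∈ Set.Icc (0 : ℝ) 1) (hβ : β ∈ Set.Icc (0 : ℝ) 1)
    (hθ : 0 < θ) (c : ℝ) : OmegaQ PX PYX PZX d α μ β θ Q ≤ c ↔
      Real.exp (-c) ≤ expSum PX PYX PZX d α μ β θ Q := by
  rw [OmegaQ_eq hPX hPYX hPZX hQ hα hμ hβ hθ, EReal.neg_le, ← EReal.coe_neg,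
    ← EReal.exp_le_exp_iff, ENNReal.exp_log, EReal.exp_coe]
  rcases le_or_gt (expSum PX PYX PZX d α μ β θ Q) 0 with h | h
  · rw [ENNReal.ofReal_of_nonpos h]
    constructor
    · intro h1
      simp at h1
      exact absurd h1 (not_le.2 (Real.exp_pos _))
    · intro h1
      exact absurd (h1.trans h) (not_le.2 (Real.exp_pos _))
  · rw [ENNReal.ofReal_le_ofReal_iff h.le]

lemma coe_le_OmegaQ_iff (hPX : PX ∈ stdSimplex ℝ X) (hPYX : ∀ x, PYX x ∈ stdSimplex ℝ Y)
    (hPZX : ∀ x, PZX x ∈ stdSimplex ℝ Z) {Q : X × Y × Z × U × Xh → ℝ} (hQ : ∀ t, 0 ≤ Q t)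
    {α μ β θ : ℝ} (hα : 0 ≤ α) (hμ : μ ∈ Set.Icc (0 : ℝ) 1) (hβ : β ∈ Set.Icc (0 : ℝ) 1)
    (hθ : 0 < θ) (c : ℝ) : (c : EReal) ≤ OmegaQ PX PYX PZX d α μ β θ Q ↔
      expSum PX PYX PZX d α μ β θ Q ≤ Real.exp (-c) := by
  rw [OmegaQ_eq hPX hPYX hPZX hQ hα hμ hβ hθ, EReal.le_neg, ← EReal.coe_neg,
    ← EReal.exp_le_exp_iff, ENNReal.exp_log, EReal.exp_coe,
    ENNReal.ofReal_le_ofReal_iff (Real.exp_nonneg _)]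

end RealOmega

/-! ### Distributions with the two Markov chains of a test channel -/

section ProductLaw

variable {X Y Z Xh U : Type*} [Fintype X] [Fintype Y] [Fintype Z] [Fintype Xh] [Fintype U]

/-- The joint law `P_XYZ V_{U|Y} κ_{X̂|UZ}`. -/
def productLaw (PX : X → ℝ) (PYX : X → Y → ℝ) (PZX : X → Z → ℝ) (V : U → Y → ℝ)
    (κ : U → Z → Xh → ℝ) (t : X × Y × Z × U × Xh) : ℝ :=
  jointXYZ PX PYX PZX (t.1, t.2.1, t.2.2.1) * V t.2.2.2.1 t.2.1 *
    κ t.2.2.2.1 t.2.2.1 t.2.2.2.2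

variable {PX : X → ℝ} {PYX : X → Y → ℝ} {PZX : X → Z → ℝ} {d : X → Xh → ℝ}
  {V : U → Y → ℝ} {κ : U → Z → Xh → ℝ}

lemma law_jointXYZ (y : Y) (z : Z) :
    law (jointXYZ PX PYX PZX) (fun s => (s.2.1, s.2.2)) (y, z) = pairYZ PX PYX PZX y z := by
  classical
  simp only [law, Fintype.sum_prod_type, Prod.mk.injEq, ite_and, jointXYZ, pairYZ]
  simp

lemma sum_productLaw (G : X × Y × Z × U × Xh → ℝ) :
    ∑ t, productLaw PX PYX PZX V κ t * G t =
      ∑ s : U × X × Y × Z, PX s.2.1 * PYX s.2.1 s.2.2.1 * PZX s.2.1 s.2.2.2 * V s.1 s.2.2.1 *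
        ∑ xh, κ s.1 s.2.2.2 xh * G (s.2.1, s.2.2.1, s.2.2.2, s.1, xh) := by
  simp only [Fintype.sum_prod_type, productLaw, jointXYZ, Finset.mul_sum]
  conv_rhs => rw [Finset.sum_comm]
  refine Finset.sum_congr rfl fun x _ => ?_
  conv_rhs => rw [Finset.sum_comm]
  refine Finset.sum_congr rfl fun y _ => ?_
  conv_rhs => rw [Finset.sum_comm]
  refine Finset.sum_congr rfl fun z _ => ?_
  exact Finset.sum_congr rfl fun u _ => Finset.sum_congr rfl fun xh _ => by ring

lemma sum_productLaw_triple (hκ : ∀ u z, ∑ xh, κ u z xh = 1) (G : U → Y → Z → ℝ) :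
    ∑ t, productLaw PX PYX PZX V κ t * G t.2.2.2.1 t.2.1 t.2.2.1 =
      ∑ s : U × Y × Z, pairYZ PX PYX PZX s.2.1 s.2.2 * V s.1 s.2.1 * G s.1 s.2.1 s.2.2 := by
  rw [sum_productLaw, ← sum_joint_marginal]
  refine Finset.sum_congr rfl fun s _ => ?_
  dsimp only
  rw [← Finset.sum_mul, hκ, one_mul]

lemma law_productLaw {A : Type*} (hκ : ∀ u z, ∑ xh, κ u z xh = 1) [DecidableEq A]
    (g : U → Y → Z → A) (a : A) :
    law (productLaw PX PYX PZX V κ) (fun t => g t.2.2.2.1 t.2.1 t.2.2.1) a =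
      ∑ u, ∑ y, ∑ z, if g u y z = a then pairYZ PX PYX PZX y z * V u y else 0 := by
  have := sum_productLaw_triple (PX := PX) (PYX := PYX) (PZX := PZX) (V := V) hκ
    (fun u y z => if g u y z = a then 1 else 0)
  simp only [mul_ite, mul_one, mul_zero, Fintype.sum_prod_type (α₁ := U),
    Fintype.sum_prod_type (α₁ := Y) (α₂ := Z)] at this
  rw [← this]
  unfold law
  exact Finset.sum_congr rfl fun t _ => by congr

lemma productLaw_nonneg (hPX : PX ∈ stdSimplex ℝ X) (hPYX : ∀ x, PYX x ∈ stdSimplex ℝ Y)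
    (hPZX : ∀ x, PZX x ∈ stdSimplex ℝ Z) (hV : IsTestChannel V)
    (hκ : ∀ u z, κ u z ∈ stdSimplex ℝ Xh) (t : X × Y × Z × U × Xh) :
    0 ≤ productLaw PX PYX PZX V κ t :=
  mul_nonneg (mul_nonneg (jointXYZ_nonneg hPX hPYX hPZX _) (hV.nonneg _ _)) ((hκ _ _).1 _)

lemma productLaw_mem_stdSimplex (hPX : PX ∈ stdSimplex ℝ X) (hPYX : ∀ x, PYX x ∈ stdSimplex ℝ Y)
    (hPZX : ∀ x, PZX x ∈ stdSimplex ℝ Z) (hV : IsTestChannel V)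
    (hκ : ∀ u z, κ u z ∈ stdSimplex ℝ Xh) :
    productLaw PX PYX PZX V κ ∈ stdSimplex ℝ (X × Y × Z × U × Xh) := by
  refine ⟨productLaw_nonneg hPX hPYX hPZX hV hκ, ?_⟩
  have := sum_productLaw_triple (PX := PX) (PYX := PYX) (PZX := PZX) (V := V)
    (fun u z => (hκ u z).2) (fun _ _ _ => 1)
  simp only [mul_one] at this
  rw [this, sum_joint_eq_one (sum_sum_pairYZ hPX hPYX hPZX) hV]

lemma law_productLaw_Y (hV : IsTestChannel V) (hκ : ∀ u z, ∑ xh, κ u z xh = 1) (y : Y) :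
    law (productLaw PX PYX PZX V κ) (fun t => t.2.1) y = ∑ z, pairYZ PX PYX PZX y z := by
  classical
  rw [law_productLaw hκ (fun _ y _ => y) y, Finset.sum_comm]
  simp only [Finset.sum_ite_irrel, Finset.sum_const_zero, Finset.sum_ite_eq', Finset.mem_univ,
    if_true]
  rw [Finset.sum_comm]
  simp_rw [← Finset.mul_sum, hV.sum_eq_one, mul_one]

lemma law_productLaw_Z (hV : IsTestChannel V) (hκ : ∀ u z, ∑ xh, κ u z xh = 1) (z : Z) :
    law (productLaw PX PYX PZX V κ) (fun t => t.2.2.1) z = ∑ y, pairYZ PX PYX PZX y z := by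
  classical
  rw [law_productLaw hκ (fun _ _ z => z) z, Finset.sum_comm]
  simp only [Finset.sum_ite_eq', Finset.mem_univ, if_true]
  simp_rw [← Finset.mul_sum, hV.sum_eq_one, mul_one]

lemma law_productLaw_U (hκ : ∀ u z, ∑ xh, κ u z xh = 1) (u : U) :
    law (productLaw PX PYX PZX V κ) (fun t => t.2.2.2.1) u =
      ∑ y, (∑ z, pairYZ PX PYX PZX y z) * V u y := by
  classical
  rw [law_productLaw hκ (fun u _ _ => u) u]
  simp [Finset.sum_ite_irrel, Finset.sum_mul]

lemma law_productLaw_YU (hκ : ∀ u z, ∑ xh, κ u z xh = 1) (y : Y) (u : U) :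
    law (productLaw PX PYX PZX V κ) (fun t => (t.2.1, t.2.2.2.1)) (y, u) =
      (∑ z, pairYZ PX PYX PZX y z) * V u y := by
  classical
  rw [law_productLaw hκ (fun u y _ => (y, u)) (y, u)]
  simp [Finset.sum_ite_irrel, Finset.sum_mul, ite_and]

lemma law_productLaw_ZU (hκ : ∀ u z, ∑ xh, κ u z xh = 1) (z : Z) (u : U) :
    law (productLaw PX PYX PZX V κ) (fun t => (t.2.2.1, t.2.2.2.1)) (z, u) =
      ∑ y, pairYZ PX PYX PZX y z * V u y := by
  classical
  rw [law_productLaw hκ (fun u _ z => (z, u)) (z, u)]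
  simp [Finset.sum_ite_irrel, ite_and]

lemma law_productLaw_YZU (hκ : ∀ u z, ∑ xh, κ u z xh = 1) (y : Y) (z : Z) (u : U) :
    law (productLaw PX PYX PZX V κ) (fun t => (t.2.1, t.2.2.1, t.2.2.2.1)) (y, z, u) =
      pairYZ PX PYX PZX y z * V u y := by
  classical
  rw [law_productLaw hκ (fun u y z => (y, z, u)) (y, z, u)]
  simp [Finset.sum_ite_irrel, ite_and]

lemma law_productLaw_ZUXh (z : Z) (u : U) (xh : Xh) :
    law (productLaw PX PYX PZX V κ) (fun t => (t.2.2.1, t.2.2.2.1, t.2.2.2.2)) (z, u, xh) =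
      (∑ y, pairYZ PX PYX PZX y z * V u y) * κ u z xh := by
  classical
  simp only [law, Fintype.sum_prod_type, Prod.mk.injEq, ite_and, productLaw, jointXYZ, pairYZ,
    Finset.sum_ite_irrel, Finset.sum_const_zero, Finset.sum_ite_eq', Finset.mem_univ, if_true]
  rw [Finset.sum_comm]
  simp_rw [Finset.sum_mul]

lemma productLaw_pos_factors (hPX : PX ∈ stdSimplex ℝ X) (hPYX : ∀ x, PYX x ∈ stdSimplex ℝ Y)
    (hPZX : ∀ x, PZX x ∈ stdSimplex ℝ Z) (hV : IsTestChannel V)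
    (hκ : ∀ u z, κ u z ∈ stdSimplex ℝ Xh) {t : X × Y × Z × U × Xh}
    (ht : 0 < productLaw PX PYX PZX V κ t) :
    0 < jointXYZ PX PYX PZX (t.1, t.2.1, t.2.2.1) ∧ 0 < V t.2.2.2.1 t.2.1 ∧
      0 < κ t.2.2.2.1 t.2.2.1 t.2.2.2.2 := by
  have h1 := jointXYZ_nonneg hPX hPYX hPZX (t.1, t.2.1, t.2.2.1)
  have h2 := hV.nonneg t.2.2.2.1 t.2.1
  have h3 := (hκ t.2.2.2.1 t.2.2.1).1 t.2.2.2.2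
  refine ⟨h1.lt_of_ne' fun h => ?_, h2.lt_of_ne' fun h => ?_, h3.lt_of_ne' fun h => ?_⟩ <;>
    simp [productLaw, h] at ht

lemma jointXYZ_le_pairYZ (hPX : PX ∈ stdSimplex ℝ X) (hPYX : ∀ x, PYX x ∈ stdSimplex ℝ Y)
    (hPZX : ∀ x, PZX x ∈ stdSimplex ℝ Z) (x : X) (y : Y) (z : Z) :
    jointXYZ PX PYX PZX (x, y, z) ≤ pairYZ PX PYX PZX y z := by
  rw [← law_jointXYZ]
  exact le_law (jointXYZ_nonneg hPX hPYX hPZX) (fun s => (s.2.1, s.2.2)) (x, y, z)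

/-- For such a law Q_{U|Y} is `V` and Q_{X̂|ZU} is `κ`, so the logarithm compares the law with
itself. -/
lemma markovTerm_productLaw (hPX : PX ∈ stdSimplex ℝ X) (hPYX : ∀ x, PYX x ∈ stdSimplex ℝ Y)
    (hPZX : ∀ x, PZX x ∈ stdSimplex ℝ Z) (hV : IsTestChannel V)
    (hκ : ∀ u z, κ u z ∈ stdSimplex ℝ Xh) {t : X × Y × Z × U × Xh}
    (ht : 0 < productLaw PX PYX PZX V κ t) :
    markovTerm PX PYX PZX (productLaw PX PYX PZX V κ) t = 0 := by
  obtain ⟨x, y, z, u, xh⟩ := t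
  obtain ⟨h1, h2, h3⟩ := productLaw_pos_factors hPX hPYX hPZX hV hκ ht
  have hκ1 := fun u z => (hκ u z).2
  have h4 := h1.trans_le (jointXYZ_le_pairYZ hPX hPYX hPZX x y z)
  obtain ⟨-, h5, -, h6, -⟩ := joint_marginals_pos (pairYZ_nonneg hPX hPYX hPZX) hV
    (mul_pos h4 h2)
  unfold markovTerm
  dsimp only at h1 h2 h3 h5 h6 ⊢
  rw [law_productLaw_Y hV hκ1, law_productLaw_YU hκ1, law_productLaw_ZU hκ1,
    law_productLaw_ZUXh, productLaw]
  dsimp only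
  rw [Real.log_mul (mul_pos h1 h2).ne' h3.ne', Real.log_mul h1.ne' h2.ne',
    Real.log_mul h5.ne' h2.ne', Real.log_mul h6.ne' h3.ne']
  ring

/-- The expectation of the `α`-part of `ω` in terms of the mutual informations. -/
lemma sum_mul_rateTerm_productLaw (hPX : PX ∈ stdSimplex ℝ X)
    (hPYX : ∀ x, PYX x ∈ stdSimplex ℝ Y) (hPZX : ∀ x, PZX x ∈ stdSimplex ℝ Z)
    (hV : IsTestChannel V) (hκ : ∀ u z, κ u z ∈ stdSimplex ℝ Xh) (μ β : ℝ) :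
    ∑ t, productLaw PX PYX PZX V κ t *
      rateTerm PX PYX PZX d μ β (productLaw PX PYX PZX V κ) t =
      (1 - μ) * (1 - β) * ∑ u, rateY (fun y => ∑ z, pairYZ PX PYX PZX y z) (V u) -
      (1 - μ) * ∑ u, rateZ (pairYZ PX PYX PZX) (V u) +
      μ * ∑ t, productLaw PX PYX PZX V κ t * d t.1 t.2.2.2.2 := by
  have hκ1 := fun u z => (hκ u z).2
  rw [sum_rateY_eq, sum_rateZ_eq,
    ← sum_productLaw_triple hκ1 (fun u y _ => Real.log (V u y / ∑ y, (∑ z, pairYZ PX PYX PZX y z) * V u y)),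
    ← sum_productLaw_triple hκ1 (fun u _ z => Real.log ((∑ y, pairYZ PX PYX PZX y z * V u y) /
        ((∑ y, pairYZ PX PYX PZX y z) * ∑ y, (∑ z, pairYZ PX PYX PZX y z) * V u y))),
    Finset.mul_sum, Finset.mul_sum, Finset.mul_sum, ← Finset.sum_sub_distrib,
    ← Finset.sum_add_distrib]
  refine Finset.sum_congr rfl fun t _ => ?_
  rcases (productLaw_nonneg hPX hPYX hPZX hV hκ t).eq_or_lt with h | ht
  · rw [← h]; ring
  obtain ⟨x, y, z, u, xh⟩ := t
  obtain ⟨h1, h2, h3⟩ := productLaw_pos_factors hPX hPYX hPZX hV hκ ht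
  have h4 := h1.trans_le (jointXYZ_le_pairYZ hPX hPYX hPZX x y z)
  obtain ⟨-, -, h5, h6, h7⟩ := joint_marginals_pos (pairYZ_nonneg hPX hPYX hPZX) hV
    (mul_pos h4 h2)
  unfold rateTerm
  dsimp only at h1 h2 h3 h5 h6 h7 ⊢
  rw [law_productLaw_Z hV hκ1, law_productLaw_U hκ1, law_productLaw_ZU hκ1,
    law_productLaw_YZU hκ1, law_jointXYZ, Real.log_div h2.ne' h7.ne',
    Real.log_div h6.ne' (mul_pos h5 h7).ne', Real.log_mul h5.ne' h7.ne',
    Real.log_mul h4.ne' h2.ne']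
  ring

lemma sum_mul_dist_productLaw :
    ∑ t, productLaw PX PYX PZX V κ t * d t.1 t.2.2.2.2 =
      ∑ u, ∑ z, ∑ xh, κ u z xh * ∑ x, ∑ y, jointXYZ PX PYX PZX (x, y, z) * V u y * d x xh := by
  rw [sum_productLaw]
  simp only [Fintype.sum_prod_type, jointXYZ]
  refine Finset.sum_congr rfl fun u _ => ?_
  have h1 : ∀ x, ∑ y, ∑ z, PX x * PYX x y * PZX x z * V u y * ∑ xh, κ u z xh * d x xh =
      ∑ z, ∑ y, PX x * PYX x y * PZX x z * V u y * ∑ xh, κ u z xh * d x xh :=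
    fun x => Finset.sum_comm
  simp_rw [h1]
  rw [Finset.sum_comm]
  refine Finset.sum_congr rfl fun z _ => ?_
  simp_rw [Finset.mul_sum]
  rw [eq_comm, Finset.sum_comm]
  refine Finset.sum_congr rfl fun x _ => ?_
  rw [Finset.sum_comm]
  exact Finset.sum_congr rfl fun y _ => Finset.sum_congr rfl fun xh _ => by ring

lemma sum_cost_eq_sum_jointXYZ (hPX : PX ∈ stdSimplex ℝ X)
    (hPYX : ∀ x, PYX x ∈ stdSimplex ℝ Y) (hPZX : ∀ x, PZX x ∈ stdSimplex ℝ Z)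
    (φ : U → Z → Xh) :
    ∑ u, cost (pairYZ PX PYX PZX) (condDist PX PYX PZX d) (V u) (φ u) =
      ∑ u, ∑ z, ∑ x, ∑ y, jointXYZ PX PYX PZX (x, y, z) * V u y * d x (φ u z) := by
  rw [sum_cost_eq hPX hPYX hPZX]
  simp only [Fintype.sum_prod_type, jointXYZ]
  refine Finset.sum_congr rfl fun u _ => ?_
  rw [eq_comm, Finset.sum_comm]
  exact Finset.sum_congr rfl fun x _ => Finset.sum_comm

/-- A deterministic decoder is at least as good as a randomized one. -/
lemma exists_lagrangian_le_productLaw [Nonempty Xh] (hPX : PX ∈ stdSimplex ℝ X)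
    (hPYX : ∀ x, PYX x ∈ stdSimplex ℝ Y) (hPZX : ∀ x, PZX x ∈ stdSimplex ℝ Z)
    (hV : IsTestChannel V) (hκ : ∀ u z, κ u z ∈ stdSimplex ℝ Xh) {μ : ℝ} (β : ℝ) (hμ : 0 ≤ μ) :
    ∃ φ : U → Z → Xh, lagrangian (pairYZ PX PYX PZX) (condDist PX PYX PZX d) μ β V φ ≤
      ∑ t, productLaw PX PYX PZX V κ t *
        rateTerm PX PYX PZX d μ β (productLaw PX PYX PZX V κ) t := by
  have hmin := fun u z => Finite.exists_min fun xh : Xh =>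
    ∑ x, ∑ y, jointXYZ PX PYX PZX (x, y, z) * V u y * d x xh
  choose φ hφ using hmin
  refine ⟨φ, ?_⟩
  rw [sum_mul_rateTerm_productLaw hPX hPYX hPZX hV hκ, lagrangian,
    sum_cost_eq_sum_jointXYZ hPX hPYX hPZX, sum_mul_dist_productLaw]
  refine add_le_add_right (mul_le_mul_of_nonneg_left ?_ hμ) _
  refine Finset.sum_le_sum fun u _ => Finset.sum_le_sum fun z _ => ?_
  calc _ = ∑ xh, κ u z xh * ∑ x, ∑ y, jointXYZ PX PYX PZX (x, y, z) * V u y * d x (φ u z) := by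
        rw [← Finset.sum_mul, (hκ u z).2, one_mul]
    _ ≤ _ := Finset.sum_le_sum fun xh _ =>
        mul_le_mul_of_nonneg_left (hφ u z xh) ((hκ u z).1 xh)

/-- Jensen's inequality for the exponential, carried out with the tangent at the mean `m`; the
Markov part of ω vanishes on the support. -/
lemma OmegaQ_productLaw_le (hPX : PX ∈ stdSimplex ℝ X) (hPYX : ∀ x, PYX x ∈ stdSimplex ℝ Y)
    (hPZX : ∀ x, PZX x ∈ stdSimplex ℝ Z) (hV : IsTestChannel V)
    (hκ : ∀ u z, κ u z ∈ stdSimplex ℝ Xh) {α μ β θ : ℝ} (hα : 0 ≤ α)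
    (hμ : μ ∈ Set.Icc (0 : ℝ) 1) (hβ : β ∈ Set.Icc (0 : ℝ) 1) (hθ : 0 < θ) :
    OmegaQ PX PYX PZX d α μ β θ (productLaw PX PYX PZX V κ) ≤
      ((θ * α * ∑ t, productLaw PX PYX PZX V κ t *
        rateTerm PX PYX PZX d μ β (productLaw PX PYX PZX V κ) t : ℝ) : EReal) := by
  have hQ0 := productLaw_nonneg hPX hPYX hPZX hV hκ
  have hQ1 := (productLaw_mem_stdSimplex hPX hPYX hPZX hV hκ).2
  rw [OmegaQ_le_coe_iff hPX hPYX hPZX hQ0 hα hμ hβ hθ]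
  set Q := productLaw PX PYX PZX V κ with hQ
  set m := θ * α * ∑ t, Q t * rateTerm PX PYX PZX d μ β Q t with hm
  have h1 : ∑ t, Q t * (Real.exp (-m) * (1 - (θ * α * rateTerm PX PYX PZX d μ β Q t - m))) =
      Real.exp (-m) := by
    have : ∀ t, Q t * (Real.exp (-m) * (1 - (θ * α * rateTerm PX PYX PZX d μ β Q t - m))) =
        Real.exp (-m) * ((1 + m) * Q t - θ * α * (Q t * rateTerm PX PYX PZX d μ β Q t)) :=
      fun t => by ring
    simp_rw [this, ← Finset.mul_sum, Finset.sum_sub_distrib, ← Finset.mul_sum, hQ1, ← hm]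
    ring
  rw [← h1, expSum]
  refine Finset.sum_le_sum fun t _ => ?_
  rcases (hQ0 t).eq_or_lt with h | ht
  · rw [← h]; simp
  rw [if_neg (productLaw_pos_factors hPX hPYX hPZX hV hκ ht).1.ne',
    markovTerm_productLaw hPX hPYX hPZX hV hκ ht]
  refine mul_le_mul_of_nonneg_left ?_ (hQ0 t)
  have h2 : -(θ * (0 + α * rateTerm PX PYX PZX d μ β Q t)) =
      -m + -(θ * α * rateTerm PX PYX PZX d μ β Q t - m) := by ring
  rw [h2, Real.exp_add]
  refine mul_le_mul_of_nonneg_left ?_ (Real.exp_nonneg _)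
  linarith [Real.add_one_le_exp (-(θ * α * rateTerm PX PYX PZX d μ β Q t - m))]

lemma lagrangian_eq_sum_mul_rateTerm [DecidableEq Xh] (hPX : PX ∈ stdSimplex ℝ X)
    (hPYX : ∀ x, PYX x ∈ stdSimplex ℝ Y) (hPZX : ∀ x, PZX x ∈ stdSimplex ℝ Z)
    (hV : IsTestChannel V) (φ : U → Z → Xh) (μ β : ℝ) :
    lagrangian (pairYZ PX PYX PZX) (condDist PX PYX PZX d) μ β V φ =
      ∑ t, productLaw PX PYX PZX V (fun u z => Pi.single (φ u z) 1) t *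
        rateTerm PX PYX PZX d μ β
          (productLaw PX PYX PZX V (fun u z => Pi.single (φ u z) 1)) t := by
  rw [sum_mul_rateTerm_productLaw hPX hPYX hPZX hV (fun u z => single_mem_stdSimplex ℝ _),
    lagrangian, sum_cost_eq_sum_jointXYZ hPX hPYX hPZX, sum_mul_dist_productLaw]
  congr 2
  refine Finset.sum_congr rfl fun u _ => Finset.sum_congr rfl fun z _ => ?_
  simp [Pi.single_apply]

end ProductLaw

/-! ### The exponent is at most the Lagrangian. -/

section UpperBound

variable {X Y Z Xh : Type*} [Fintype X] [Fintype Y] [Fintype Z] [Fintype Xh] [Nonempty Xh]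
  {PX : X → ℝ} {PYX : X → Y → ℝ} {PZX : X → Z → ℝ} {d : X → Xh → ℝ}

lemma nonempty_of_mem_stdSimplex {A : Type*} [Fintype A] {q : A → ℝ} (hq : q ∈ stdSimplex ℝ A) :
    Nonempty A := by
  by_contra h
  rw [not_nonempty_iff] at h
  simpa using hq.2

lemma card_le_card_mul (hPX : PX ∈ stdSimplex ℝ X) (hPZX : ∀ x, PZX x ∈ stdSimplex ℝ Z) :
    Fintype.card Y ≤ Fintype.card X * Fintype.card Y * Fintype.card Z * Fintype.card Xh := by
  have hX := nonempty_of_mem_stdSimplex hPX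
  have hZ := nonempty_of_mem_stdSimplex (hPZX hX.some)
  have h1 : 0 < Fintype.card X := Fintype.card_pos
  have h2 : 0 < Fintype.card Z := Fintype.card_pos
  have h3 : 0 < Fintype.card Xh := Fintype.card_pos
  calc Fintype.card Y = 1 * Fintype.card Y * 1 * 1 := by ring
    _ ≤ _ := by gcongr <;> omega

/-- A bound on the Lagrangian of a test channel bounds `Ω`. -/
lemma OmegaMin_le_of_lagrangian_le (hPX : PX ∈ stdSimplex ℝ X)
    (hPYX : ∀ x, PYX x ∈ stdSimplex ℝ Y) (hPZX : ∀ x, PZX x ∈ stdSimplex ℝ Z)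
    {α μ β θ c : ℝ} (hα : 0 < α) (hμ : μ ∈ Set.Icc (0 : ℝ) 1) (hβ : β ∈ Set.Icc (0 : ℝ) 1)
    (hθ : 0 < θ) {k : ℕ} {V : Fin k → Y → ℝ} (hV : IsTestChannel V) (φ : Fin k → Z → Xh)
    (h : lagrangian (pairYZ PX PYX PZX) (condDist PX PYX PZX d) μ β V φ ≤ c) :
    OmegaMin PX PYX PZX d α μ β θ ≤ ((θ * α * c : ℝ) : EReal) := by
  classical
  obtain ⟨k', hk', V', φ', hV', hle⟩ := exists_lagrangian_le_card_le
    (p := pairYZ PX PYX PZX) (e := condDist PX PYX PZX d) (μ := μ) (β := β) hV φ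
  have hκ : ∀ u z, (Pi.single (φ' u z) 1 : Xh → ℝ) ∈ stdSimplex ℝ Xh :=
    fun u z => single_mem_stdSimplex ℝ _
  rw [OmegaMin]
  refine iInf₂_le_of_le k' (hk'.trans (card_le_card_mul hPX hPZX)) (iInf₂_le_of_le _
    (productLaw_mem_stdSimplex hPX hPYX hPZX hV' hκ)
    ((OmegaQ_productLaw_le hPX hPYX hPZX hV' hκ hα.le hμ hβ hθ).trans ?_))
  rw [EReal.coe_le_coe_iff, ← lagrangian_eq_sum_mul_rateTerm hPX hPYX hPZX hV']
  exact mul_le_mul_of_nonneg_left (hle.trans h) (by positivity)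

end UpperBound

/-! ### Lower bounds on the exponent function -/

section LowerBound

variable {X Y Z Xh U : Type*} [Fintype X] [Fintype Y] [Fintype Z] [Fintype Xh] [Fintype U]
  {PX : X → ℝ} {PYX : X → Y → ℝ} {PZX : X → Z → ℝ} {d : X → Xh → ℝ}
  {Q : X × Y × Z × U × Xh → ℝ}

lemma apply_le_one {T : Type*} [Fintype T] {Q : T → ℝ} (hQ : Q ∈ stdSimplex ℝ T) (t : T) :
    Q t ≤ 1 := by
  rw [← hQ.2]
  exact Finset.single_le_sum (fun s _ => hQ.1 s) (Finset.mem_univ t)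

/-- The remaining logarithms combine favourably: `P ≤ 1`, and a marginal dominates a finer one. This
lower bound and the next are the uniform control that survives limits in which `Q t` tends to zero.
-/
lemma log_le_markovTerm (hPX : PX ∈ stdSimplex ℝ X) (hPYX : ∀ x, PYX x ∈ stdSimplex ℝ Y)
    (hPZX : ∀ x, PZX x ∈ stdSimplex ℝ Z) (hQ : ∀ t, 0 ≤ Q t) {t : X × Y × Z × U × Xh}
    (ht : 0 < Q t) : Real.log (Q t) ≤ markovTerm PX PYX PZX Q t := by
  have h1 := Real.log_nonpos (jointXYZ_nonneg hPX hPYX hPZX _)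
    (apply_le_one (jointXYZ_mem_stdSimplex hPX hPYX hPZX) (t.1, t.2.1, t.2.2.1))
  have h2 := Real.log_le_log (ht.trans_le (le_law hQ (fun s => (s.2.1, s.2.2.2.1)) t))
    (law_le_law hQ (fun s => (s.2.1, s.2.2.2.1)) (fun s => s.2.1) (t.2.1, t.2.2.2.1) t.2.1
      (fun s h => (Prod.mk.inj h).1))
  have h3 := Real.log_le_log
    (ht.trans_le (le_law hQ (fun s => (s.2.2.1, s.2.2.2.1, s.2.2.2.2)) t))
    (law_le_law hQ (fun s => (s.2.2.1, s.2.2.2.1, s.2.2.2.2)) (fun s => (s.2.2.1, s.2.2.2.1))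
      (t.2.2.1, t.2.2.2.1, t.2.2.2.2) (t.2.2.1, t.2.2.2.1)
      (fun s h => by simp only [Prod.mk.injEq] at h ⊢; tauto))
  unfold markovTerm
  linarith

/-- One `log (Q t)` comes from the first bracket and two from the second; the distortion is
nonnegative. -/
lemma log_le_rateTerm (hPX : PX ∈ stdSimplex ℝ X) (hPYX : ∀ x, PYX x ∈ stdSimplex ℝ Y)
    (hPZX : ∀ x, PZX x ∈ stdSimplex ℝ Z) (hd : ∀ x xh, 0 ≤ d x xh)
    (hQ : Q ∈ stdSimplex ℝ (X × Y × Z × U × Xh)) {μ β : ℝ}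
    (hμ : μ ∈ Set.Icc (0 : ℝ) 1) (hβ : β ∈ Set.Icc (0 : ℝ) 1) {t : X × Y × Z × U × Xh}
    (ht : 0 < Q t) : 3 * Real.log (Q t) ≤ rateTerm PX PYX PZX d μ β Q t := by
  have hm1 : 0 ≤ 1 - μ := by linarith [hμ.2]
  have hb1 : 0 ≤ 1 - β := by linarith [hβ.2]
  have h0 := Real.log_nonpos ht.le (apply_le_one hQ t)
  have h1 := Real.log_nonpos (law_nonneg (jointXYZ_nonneg hPX hPYX hPZX) _ _)
    (law_le_one (jointXYZ_mem_stdSimplex hPX hPYX hPZX) (fun s => (s.2.1, s.2.2))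
      (t.2.1, t.2.2.1))
  have h2 := Real.log_nonpos (law_nonneg hQ.1 _ _) (law_le_one hQ (fun s => s.2.2.2.1) t.2.2.2.1)
  have h3 := Real.log_nonpos (law_nonneg hQ.1 _ _)
    (law_le_one hQ (fun s => (s.2.2.1, s.2.2.2.1)) (t.2.2.1, t.2.2.2.1))
  have h4 := Real.log_le_log ht (le_law hQ.1 (fun s => (s.2.1, s.2.2.1, s.2.2.2.1)) t)
  have h5 := Real.log_le_log ht (le_law hQ.1 (fun s => s.2.2.1) t)
  have h6 := Real.log_le_log ht (le_law hQ.1 (fun s => s.2.2.2.1) t)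
  have e1 : Real.log (Q t) ≤ (1 - μ) * (1 - β) *
      (Real.log (law Q (fun s => (s.2.1, s.2.2.1, s.2.2.2.1)) (t.2.1, t.2.2.1, t.2.2.2.1))
      - Real.log (law Q (fun s => s.2.2.2.1) t.2.2.2.1)
      - Real.log (law (jointXYZ PX PYX PZX) (fun s => (s.2.1, s.2.2)) (t.2.1, t.2.2.1))) := by
    have hc : (1 - μ) * (1 - β) ≤ 1 := mul_le_one₀ (by linarith [hμ.1]) hb1 (by linarith [hβ.1])
    refine le_trans ?_ (mul_le_mul_of_nonneg_left (show Real.log (Q t) ≤ _ by linarith)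
      (mul_nonneg hm1 hb1))
    nlinarith
  have e2 : 2 * Real.log (Q t) ≤ (1 - μ) * (Real.log (law Q (fun s => s.2.2.1) t.2.2.1)
    + Real.log (law Q (fun s => s.2.2.2.1) t.2.2.2.1)
    - Real.log (law Q (fun s => (s.2.2.1, s.2.2.2.1)) (t.2.2.1, t.2.2.2.1))) := by
    refine le_trans ?_ (mul_le_mul_of_nonneg_left (show 2 * Real.log (Q t) ≤ _ by linarith) hm1)
    nlinarith [hμ.1]
  have e3 := mul_nonneg hμ.1 (hd t.1 t.2.2.2.2)
  unfold rateTerm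
  linarith

/-- Only `s < 0` is delicate. There `exp (-(θ * s))` is at most `q` to the power `-1/2` when `θ * C
≤ 1 / 2`, so half a power of `q` is left to tame the logarithm. The resulting bound is uniform in
`θ` and tends to zero with `q`. -/
lemma mul_log_le_mul_exp {q s θ C : ℝ} (hq : 0 ≤ q) (hq1 : q ≤ 1) (hC : 0 ≤ C) (hθ : 0 ≤ θ)
    (hθC : θ * C ≤ 1 / 2) (hs : 0 < q → C * Real.log q ≤ s) :
    C * (2 * (√q * Real.log √q)) ≤ q * (s * Real.exp (-(θ * s))) := by
  rcases hq.eq_or_lt with rfl | hq0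
  · simp
  have hs := hs hq0
  have hl : Real.log q ≤ 0 := Real.log_nonpos hq hq1
  have hlog : Real.log √q = Real.log q / 2 := Real.log_sqrt hq
  have hsq : 0 < √q := Real.sqrt_pos.2 hq0
  have hL : C * (2 * (√q * Real.log √q)) = √q * (C * Real.log q) := by rw [hlog]; ring
  rw [hL]
  have hCl : C * Real.log q ≤ 0 := mul_nonpos_of_nonneg_of_nonpos hC hl
  rcases le_or_gt 0 s with h | h
  · exact (mul_nonpos_of_nonneg_of_nonpos hsq.le hCl).trans
      (mul_nonneg hq (mul_nonneg h (Real.exp_nonneg _)))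
  have hexp : q * Real.exp (-(θ * s)) ≤ √q := by
    have h1 : Real.exp (-(θ * s)) ≤ Real.exp (-(Real.log √q)) := by
      rw [Real.exp_le_exp, hlog]
      have := mul_le_mul_of_nonneg_left hs hθ
      nlinarith
    rw [Real.exp_neg (Real.log √q), Real.exp_log hsq] at h1
    calc q * Real.exp (-(θ * s)) ≤ q * (√q)⁻¹ := mul_le_mul_of_nonneg_left h1 hq
      _ = √q := by
        nth_rewrite 1 [← Real.mul_self_sqrt hq]
        field_simp
  calc √q * (C * Real.log q) ≤ q * Real.exp (-(θ * s)) * (C * Real.log q) :=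
        mul_le_mul_of_nonpos_right hexp hCl
    _ ≤ q * Real.exp (-(θ * s)) * s :=
        mul_le_mul_of_nonneg_left hs (mul_nonneg hq (Real.exp_nonneg _))
    _ = _ := by ring

lemma neg_one_le_sqrt_mul_log (q : ℝ) : -1 ≤ √q * Real.log √q := by
  rcases (Real.sqrt_nonneg q).eq_or_lt with h | h
  · rw [← h]; simp
  have h1 := mul_le_mul_of_nonneg_left (Real.one_sub_inv_le_log_of_pos h) h.le
  rw [mul_sub, mul_inv_cancel₀ h.ne'] at h1
  linarith

/-- The expectation of `ω exp (-θ ω)` under `Q`. -/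
noncomputable def tiltSum (PX : X → ℝ) (PYX : X → Y → ℝ) (PZX : X → Z → ℝ) (d : X → Xh → ℝ)
    (α μ β θ : ℝ) (Q : X × Y × Z × U × Xh → ℝ) : ℝ :=
  ∑ t, if jointXYZ PX PYX PZX (t.1, t.2.1, t.2.2.1) = 0 then 0 else
    Q t * ((markovTerm PX PYX PZX Q t + α * rateTerm PX PYX PZX d μ β Q t) *
      Real.exp (-(θ * (markovTerm PX PYX PZX Q t + α * rateTerm PX PYX PZX d μ β Q t))))

/-- The pointwise inequality exp(-x)(1 + x) ≤ 1. It converts a lower bound on `expSum` into an upper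
bound on `tiltSum` after division by `θ`. -/
lemma expSum_add_le (hQ : ∀ t, 0 ≤ Q t) (α μ β θ : ℝ) :
    expSum PX PYX PZX d α μ β θ Q + θ * tiltSum PX PYX PZX d α μ β θ Q ≤
      ∑ t, if jointXYZ PX PYX PZX (t.1, t.2.1, t.2.2.1) = 0 then 0 else Q t := by
  rw [expSum, tiltSum, Finset.mul_sum, ← Finset.sum_add_distrib]
  refine Finset.sum_le_sum fun t _ => ?_
  split_ifs with h
  · simp
  set s := markovTerm PX PYX PZX Q t + α * rateTerm PX PYX PZX d μ β Q t
  have h1 : Real.exp (-(θ * s)) * (1 + θ * s) ≤ 1 := by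
    calc _ ≤ Real.exp (-(θ * s)) * Real.exp (θ * s) :=
          mul_le_mul_of_nonneg_left (by linarith [Real.add_one_le_exp (θ * s)])
            (Real.exp_nonneg _)
      _ = 1 := by rw [← Real.exp_add]; simp
  have h2 := mul_le_mul_of_nonneg_left h1 (hQ t)
  linarith

lemma sum_support_le_one (hQ : Q ∈ stdSimplex ℝ (X × Y × Z × U × Xh)) :
    (∑ t, if jointXYZ PX PYX PZX (t.1, t.2.1, t.2.2.1) = 0 then 0 else Q t) ≤ 1 := by
  rw [← hQ.2]
  exact Finset.sum_le_sum fun t _ => by split_ifs <;> simp [hQ.1 t]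

lemma log_le_omega (hPX : PX ∈ stdSimplex ℝ X) (hPYX : ∀ x, PYX x ∈ stdSimplex ℝ Y)
    (hPZX : ∀ x, PZX x ∈ stdSimplex ℝ Z) (hd : ∀ x xh, 0 ≤ d x xh)
    (hQ : Q ∈ stdSimplex ℝ (X × Y × Z × U × Xh)) {α μ β : ℝ} (hα : 0 ≤ α)
    (hμ : μ ∈ Set.Icc (0 : ℝ) 1) (hβ : β ∈ Set.Icc (0 : ℝ) 1) {t : X × Y × Z × U × Xh}
    (ht : 0 < Q t) : (1 + 3 * α) * Real.log (Q t) ≤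
      markovTerm PX PYX PZX Q t + α * rateTerm PX PYX PZX d μ β Q t := by
  have h1 := log_le_markovTerm hPX hPYX hPZX hQ.1 ht
  have h2 := mul_le_mul_of_nonneg_left (log_le_rateTerm hPX hPYX hPZX hd hQ hμ hβ ht) hα
  linarith

lemma le_tiltSum (hPX : PX ∈ stdSimplex ℝ X) (hPYX : ∀ x, PYX x ∈ stdSimplex ℝ Y)
    (hPZX : ∀ x, PZX x ∈ stdSimplex ℝ Z) (hd : ∀ x xh, 0 ≤ d x xh)
    (hQ : Q ∈ stdSimplex ℝ (X × Y × Z × U × Xh)) {α μ β θ : ℝ} (hα : 0 ≤ α)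
    (hμ : μ ∈ Set.Icc (0 : ℝ) 1) (hβ : β ∈ Set.Icc (0 : ℝ) 1) (hθ : 0 ≤ θ)
    (hθα : θ * (1 + 3 * α) ≤ 1 / 2) :
    -(Fintype.card (X × Y × Z × U × Xh) * ((1 + 3 * α) * 2)) ≤
      tiltSum PX PYX PZX d α μ β θ Q := by
  have : -(Fintype.card (X × Y × Z × U × Xh) * ((1 + 3 * α) * 2)) =
      ∑ _t : X × Y × Z × U × Xh, -((1 + 3 * α) * 2) := by
    rw [Finset.sum_const, Finset.card_univ, nsmul_eq_mul, mul_neg]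
  rw [this, tiltSum]
  refine Finset.sum_le_sum fun t _ => ?_
  split_ifs with h
  · linarith
  refine le_trans ?_ (mul_log_le_mul_exp (hQ.1 t) (apply_le_one hQ t) (by linarith) hθ hθα
    fun ht => log_le_omega hPX hPYX hPZX hd hQ hα hμ hβ ht)
  have := mul_le_mul_of_nonneg_left (neg_one_le_sqrt_mul_log (Q t))
    (show 0 ≤ (1 + 3 * α) * 2 by linarith)
  linarith

end LowerBound

/-! ### Nonnegativity of the exponent function. -/

section SignOfF

variable {X Y Z Xh : Type*} [Fintype X] [Fintype Y] [Fintype Z] [Fintype Xh]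
  {PX : X → ℝ} {PYX : X → Y → ℝ} {PZX : X → Z → ℝ} {d : X → Xh → ℝ}

/-- `tiltSum` bounds the deviation of `expSum` from one, uniformly in `Q` because the auxiliary
alphabet is bounded. The threshold `1 / 8` is `θ * (1 + 3 * α) ≤ 1 / 2` at `α = 1`. -/
lemma exists_le_OmegaMin (hPX : PX ∈ stdSimplex ℝ X) (hPYX : ∀ x, PYX x ∈ stdSimplex ℝ Y)
    (hPZX : ∀ x, PZX x ∈ stdSimplex ℝ Z) (hd : ∀ x xh, 0 ≤ d x xh) :
    ∃ c : ℝ, 0 ≤ c ∧ ∀ θ, 0 < θ → θ ≤ 1 / 8 →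
      ((-(θ * c) : ℝ) : EReal) ≤ OmegaMin PX PYX PZX d 1 0 0 θ := by
  set K := Fintype.card X * Fintype.card Y * Fintype.card Z * Fintype.card Xh with hK
  set N := Fintype.card X * (Fintype.card Y * (Fintype.card Z * (K * Fintype.card Xh))) with hN
  refine ⟨N * 8, by positivity, fun θ hθ hθ8 => ?_⟩
  refine le_iInf₂ fun k hk => le_iInf₂ fun Q hQ => ?_
  rw [coe_le_OmegaQ_iff hPX hPYX hPZX hQ.1 zero_le_one (by simp) (by simp) hθ]
  have h1 := expSum_add_le (PX := PX) (PYX := PYX) (PZX := PZX) (d := d) hQ.1 1 0 0 θ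
  have h2 := sum_support_le_one (PX := PX) (PYX := PYX) (PZX := PZX) hQ
  have h3 := le_tiltSum hPX hPYX hPZX hd hQ (α := 1) (μ := 0) (β := 0) (θ := θ) zero_le_one
    (by simp) (by simp) hθ.le (by linarith)
  have hcard : (Fintype.card (X × Y × Z × Fin k × Xh) : ℝ) ≤ N := by
    simp only [Fintype.card_prod, Fintype.card_fin]
    rw [hN]
    norm_cast
    gcongr
  have h4 : -(N * 8 : ℝ) ≤ tiltSum PX PYX PZX d 1 0 0 θ Q := by linarith
  have h5 := mul_le_mul_of_nonneg_left h4 hθ.le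
  rw [neg_neg]
  linarith [Real.add_one_le_exp (θ * (N * 8))]

lemma Fparam_le_F {α μ β θ : ℝ} (hα : 0 < α) (hμ : μ ∈ Set.Icc (0 : ℝ) 1)
    (hβ : β ∈ Set.Icc (0 : ℝ) 1) (hθ : 0 < θ) (Ri Rc D : ℝ) :
    Fparam PX PYX PZX d α μ β θ Ri Rc D ≤ F PX PYX PZX d Ri Rc D :=
  le_iSup₂_of_le α hα (le_iSup₂_of_le θ hθ (le_iSup₂_of_le μ hμ (le_iSup₂_of_le β hβ le_rfl)))

lemma one_le_denominator {α μ β θ : ℝ} (hα : 0 < α) (hμ : μ ∈ Set.Icc (0 : ℝ) 1)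
    (hβ : β ∈ Set.Icc (0 : ℝ) 1) (hθ : 0 < θ) :
    1 ≤ 1 + 5 * θ + θ * α * (1 - μ) * (3 - β) := by
  have h1 : 0 ≤ θ * α * (1 - μ) * (3 - β) :=
    mul_nonneg (mul_nonneg (by positivity) (by linarith [hμ.2])) (by linarith [hβ.2])
  linarith

lemma Fparam_nonpos_iff {α μ β θ : ℝ} (hα : 0 < α) (hμ : μ ∈ Set.Icc (0 : ℝ) 1)
    (hβ : β ∈ Set.Icc (0 : ℝ) 1) (hθ : 0 < θ) (Ri Rc D : ℝ) :
    Fparam PX PYX PZX d α μ β θ Ri Rc D ≤ 0 ↔ OmegaMin PX PYX PZX d α μ β θ ≤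
      ((θ * α * ((1 - μ) * ((1 - β) * Rc - Ri) + μ * D) : ℝ) : EReal) := by
  have hden : (0 : EReal) < ((1 + 5 * θ + θ * α * (1 - μ) * (3 - β) : ℝ) : EReal) := by
    exact_mod_cast one_pos.trans_le (one_le_denominator hα hμ hβ hθ)
  rw [Fparam, ← EReal.sub_nonpos (y := ((_ : ℝ) : EReal))]
  constructor
  · intro h
    by_contra! hc
    exact absurd h (not_le.2 (EReal.div_pos hc hden (EReal.coe_ne_top _)))
  · exact fun h => EReal.div_nonpos_of_nonpos_of_nonneg h hden.le

lemma F_nonneg (hPX : PX ∈ stdSimplex ℝ X) (hPYX : ∀ x, PYX x ∈ stdSimplex ℝ Y)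
    (hPZX : ∀ x, PZX x ∈ stdSimplex ℝ Z) (hd : ∀ x xh, 0 ≤ d x xh) (Ri Rc D : ℝ) :
    0 ≤ F PX PYX PZX d Ri Rc D := by
  obtain ⟨c, hc0, hc⟩ := exists_le_OmegaMin hPX hPYX hPZX hd
  refine EReal.ge_of_forall_gt_iff_ge.1 fun z hz => ?_
  have hz' : z < 0 := by exact_mod_cast hz
  set a := c + |Rc - Ri| + 1 with ha
  have ha0 : 0 < a := by positivity
  -- At α = 1, μ = β = 0 the numerator of the rate function is at least -θ(c + |Rc - Ri|), hence at
  -- least `z` for this `θ`. Dividing by a number at least one preserves the bound, as `z` is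
  -- negative.
  set θ := min (1 / 8) (-z / a) with hθdef
  have hθ : 0 < θ := lt_min (by norm_num) (div_pos (by linarith) ha0)
  have h0 : (0 : ℝ) ∈ Set.Icc (0 : ℝ) 1 := by simp
  refine le_trans ?_ (Fparam_le_F one_pos h0 h0 hθ Ri Rc D)
  have hden := one_le_denominator one_pos h0 h0 hθ
  have hθa : θ * a ≤ -z := by
    have := min_le_right (1 / 8) (-z / a)
    rwa [← hθdef, le_div_iff₀ ha0] at this
  rw [Fparam, EReal.le_div_iff_mul_le (by exact_mod_cast one_pos.trans_le hden)
    (EReal.coe_ne_top _)]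
  refine le_trans ?_ (EReal.sub_le_sub (hc θ hθ (min_le_left _ _)) le_rfl)
  rw [← EReal.coe_mul, ← EReal.coe_sub, EReal.coe_le_coe_iff]
  have h1 : θ * (Rc - Ri) ≤ θ * |Rc - Ri| := mul_le_mul_of_nonneg_left (le_abs_self _) hθ.le
  have h2 := mul_le_mul_of_nonpos_left hden hz'.le
  have h3 : θ * a = θ * c + θ * |Rc - Ri| + θ := by rw [ha]; ring
  linarith

end SignOfF

/-! ### Limits of near-minimizers of the exponent function -/

section Compactness

/-- The alphabet size may change with `n` but is bounded, so one size recurs infinitely often;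
compactness of the simplex for that size does the rest. -/
lemma exists_subseq_stdSimplex {K : ℕ} {T : ℕ → Type*} [∀ k, Fintype (T k)]
    {S : ℕ → ∀ k, (T k → ℝ) → Prop} (h : ∀ n, ∃ k ≤ K, ∃ Q ∈ stdSimplex ℝ (T k), S n k Q) :
    ∃ k ≤ K, ∃ φ : ℕ → ℕ, Tendsto φ atTop atTop ∧ ∃ Q : ℕ → T k → ℝ,
      (∀ n, Q n ∈ stdSimplex ℝ (T k)) ∧ (∀ n, S (φ n) k (Q n)) ∧
      ∃ Q0 ∈ stdSimplex ℝ (T k), Tendsto Q atTop (𝓝 Q0) := by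
  obtain ⟨k, hk, hfreq⟩ : ∃ k ≤ K, ∃ᶠ n in atTop, ∃ Q ∈ stdSimplex ℝ (T k), S n k Q := by
    by_contra! hc
    have h1 : ∀ᶠ n in atTop, ∀ k ∈ Finset.range (K + 1), ¬ ∃ Q ∈ stdSimplex ℝ (T k), S n k Q :=
      (Filter.eventually_all_finset _).2 fun k hk =>
        not_frequently.1 fun hf => by
          obtain ⟨n, hn⟩ := ((hc k (Nat.lt_succ_iff.1 (Finset.mem_range.1 hk))).and_frequently
            hf).exists
          obtain ⟨Q, hQ, hS⟩ := hn.2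
          exact hn.1 Q hQ hS
    obtain ⟨n, hn⟩ := h1.exists
    obtain ⟨k, hk, hQ⟩ := h n
    exact hn k (Finset.mem_range.2 (Nat.lt_succ_of_le hk)) hQ
  obtain ⟨φ, hφ, hQ⟩ := extraction_of_frequently_atTop hfreq
  choose Q hQ1 hQ2 using hQ
  obtain ⟨Q0, hQ0, ψ, hψ, hlim⟩ := (isCompact_stdSimplex (𝕜 := ℝ) (T k)).tendsto_subseq hQ1
  exact ⟨k, hk, fun n => φ (ψ n), hφ.tendsto_atTop.comp hψ.tendsto_atTop, fun n => Q (ψ n),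
    fun n => hQ1 _, fun n => hQ2 _, Q0, hQ0, hlim⟩

/-- Lower semicontinuity of sums whose terms are bounded below by a multiple of `√q log √q`. -/
lemma sum_le_of_tendsto {T : Type*} [Fintype T] {Q : ℕ → T → ℝ} {Q0 : T → ℝ}
    (hQ : Tendsto Q atTop (𝓝 Q0)) {f : ℕ → T → ℝ} {f0 : T → ℝ} {C : ℝ}
    (hlow : ∀ᶠ n in atTop, ∀ t, C * (2 * (√(Q n t) * Real.log √(Q n t))) ≤ f n t)
    (hpos : ∀ t, Q0 t ≠ 0 → Tendsto (fun n => f n t) atTop (𝓝 (f0 t)))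
    (hzero : ∀ t, Q0 t = 0 → f0 t = 0) {c : ℕ → ℝ} {c0 : ℝ} (hc : Tendsto c atTop (𝓝 c0))
    (hsum : ∀ᶠ n in atTop, ∑ t, f n t ≤ c n) : ∑ t, f0 t ≤ c0 := by
  classical
  -- Where the limit mass is zero, `f` need not converge and is replaced by its lower bound, which
  -- tends to zero by continuity of `x log x`.
  let g : ℕ → T → ℝ := fun n t =>
    if Q0 t = 0 then C * (2 * (√(Q n t) * Real.log √(Q n t))) else f n t
  have hg : Tendsto (fun n => ∑ t, g n t) atTop (𝓝 (∑ t, f0 t)) := by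
    refine tendsto_finsetSum _ fun t _ => ?_
    by_cases h : Q0 t = 0
    · simp only [g, if_pos h]
      have h1 : Tendsto (fun n => Q n t) atTop (𝓝 (Q0 t)) := (tendsto_pi_nhds.1 hQ) t
      have h2 : Continuous fun q : ℝ => C * (2 * (√q * Real.log √q)) :=
        continuous_const.mul (continuous_const.mul
          (Real.continuous_mul_log.comp Real.continuous_sqrt))
      have h3 := (h2.tendsto (Q0 t)).comp h1
      rw [h] at h3
      have h4 : C * (2 * (√0 * Real.log √0)) = f0 t := by simp [hzero t h]
      rwa [h4] at h3
    · simp only [g, if_neg h]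
      exact hpos t h
  refine le_of_tendsto_of_tendsto hg hc ?_
  filter_upwards [hlow, hsum] with n h1 h2
  refine le_trans (Finset.sum_le_sum fun t _ => ?_) h2
  dsimp only [g]
  split_ifs
  · exact h1 t
  · exact le_rfl

variable {X Y Z Xh U : Type*} [Fintype X] [Fintype Y] [Fintype Z] [Fintype Xh] [Fintype U]
  {PX : X → ℝ} {PYX : X → Y → ℝ} {PZX : X → Z → ℝ} {d : X → Xh → ℝ}

lemma continuousAt_log_law {T A : Type*} [Fintype T] {Q0 : T → ℝ} (hQ0 : ∀ t, 0 ≤ Q0 t)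
    (f : T → A) {t : T} (ht : 0 < Q0 t) :
    ContinuousAt (fun Q : T → ℝ => Real.log (law Q f (f t))) Q0 :=
  (continuous_law f (f t)).continuousAt.log (ht.trans_le (le_law hQ0 f t)).ne'

lemma continuousAt_markovTerm {Q0 : X × Y × Z × U × Xh → ℝ} (hQ0 : ∀ t, 0 ≤ Q0 t)
    {t : X × Y × Z × U × Xh} (ht : 0 < Q0 t) :
    ContinuousAt (fun Q => markovTerm PX PYX PZX Q t) Q0 := by
  unfold markovTerm
  exact ((((((continuous_apply t).continuousAt (x := Q0)).log ht.ne').sub continuousAt_const).add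
    (continuousAt_log_law hQ0 (fun s => s.2.1) ht)).sub
    (continuousAt_log_law hQ0 (fun s => (s.2.1, s.2.2.2.1)) ht)).add
    (continuousAt_log_law hQ0 (fun s => (s.2.2.1, s.2.2.2.1)) ht) |>.sub
    (continuousAt_log_law hQ0 (fun s => (s.2.2.1, s.2.2.2.1, s.2.2.2.2)) ht)

lemma continuousAt_rateTerm {Q0 : X × Y × Z × U × Xh → ℝ} (hQ0 : ∀ t, 0 ≤ Q0 t) (μ β : ℝ)
    {t : X × Y × Z × U × Xh} (ht : 0 < Q0 t) :
    ContinuousAt (fun Q => rateTerm PX PYX PZX d μ β Q t) Q0 := by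
  unfold rateTerm
  exact ((continuousAt_const.mul
    (((continuousAt_log_law hQ0 (fun s => (s.2.1, s.2.2.1, s.2.2.2.1)) ht).sub
    (continuousAt_log_law hQ0 (fun s => s.2.2.2.1) ht)).sub continuousAt_const)).add
    (continuousAt_const.mul (((continuousAt_log_law hQ0 (fun s => s.2.2.1) ht).add
    (continuousAt_log_law hQ0 (fun s => s.2.2.2.1) ht)).sub
    (continuousAt_log_law hQ0 (fun s => (s.2.2.1, s.2.2.2.1)) ht)))).add continuousAt_const

end Compactness

/-! ### Nonnegativity of relative entropy and its equality case. -/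

section Gibbs

variable {T : Type*} [Fintype T] {Q R : T → ℝ}

lemma gibbs_term_nonneg (hQ : ∀ t, 0 ≤ Q t) (hR : ∀ t, 0 ≤ R t) (hQR : ∀ t, 0 < Q t → 0 < R t)
    (t : T) : 0 ≤ R t - Q t + Q t * (Real.log (Q t) - Real.log (R t)) := by
  rcases (hQ t).eq_or_lt with h | h
  · rw [← h]; simpa using hR t
  · have h1 := Real.log_le_sub_one_of_pos (div_pos (hQR t h) h)
    rw [Real.log_div (hQR t h).ne' h.ne'] at h1
    have h2 := mul_le_mul_of_nonneg_left h1 h.le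
    rw [mul_sub, mul_sub, mul_div_cancel₀ _ h.ne'] at h2
    linarith

lemma gibbs_nonneg (hQ : Q ∈ stdSimplex ℝ T) (hR : R ∈ stdSimplex ℝ T)
    (hQR : ∀ t, 0 < Q t → 0 < R t) : 0 ≤ ∑ t, Q t * (Real.log (Q t) - Real.log (R t)) := by
  have h := Finset.sum_nonneg fun t (_ : t ∈ Finset.univ) => gibbs_term_nonneg hQ.1 hR.1 hQR t
  rw [Finset.sum_add_distrib, Finset.sum_sub_distrib, hQ.2, hR.2] at h
  linarith

lemma eq_of_gibbs_nonpos (hQ : Q ∈ stdSimplex ℝ T) (hR : R ∈ stdSimplex ℝ T)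
    (hQR : ∀ t, 0 < Q t → 0 < R t) (h : ∑ t, Q t * (Real.log (Q t) - Real.log (R t)) ≤ 0) :
    Q = R := by
  have h0 : ∑ t, (R t - Q t + Q t * (Real.log (Q t) - Real.log (R t))) = 0 := by
    refine le_antisymm ?_ (Finset.sum_nonneg fun t _ => gibbs_term_nonneg hQ.1 hR.1 hQR t)
    rw [Finset.sum_add_distrib, Finset.sum_sub_distrib, hQ.2, hR.2]
    linarith
  funext t
  have ht := (Finset.sum_eq_zero_iff_of_nonneg fun t _ =>
    gibbs_term_nonneg hQ.1 hR.1 hQR t).1 h0 t (Finset.mem_univ t)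
  rcases (hQ.1 t).eq_or_lt with h1 | h1
  · rw [← h1] at ht ⊢
    linarith
  · by_contra hne
    have h2 := Real.log_lt_sub_one_of_pos (div_pos (hQR t h1) h1)
      (fun he => hne ((div_eq_one_iff_eq h1.ne').1 he).symm)
    rw [Real.log_div (hQR t h1).ne' h1.ne'] at h2
    have h3 := mul_lt_mul_of_pos_left h2 h1
    rw [mul_sub, mul_sub, mul_div_cancel₀ _ h1.ne'] at h3
    linarith

end Gibbs

/-! ### The Markov term as a relative entropy. -/

section Markov

lemma sum_law {T A B C : Type*} [Fintype T] [Fintype B] (Q : T → ℝ) {h : T → C} {e : B → C}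
    {f : T → A} {g : T → B} {a : A} (H : ∀ t b, h t = e b ↔ f t = a ∧ g t = b) :
    ∑ b, law Q h (e b) = law Q f a := by
  classical
  simp only [law]
  rw [Finset.sum_comm]
  refine Finset.sum_congr rfl fun t _ => ?_
  simp [H, ite_and, Finset.sum_ite_irrel]

/-- Normalization of a nonnegative function, uniform if the function vanishes. -/
noncomputable def normalize {A : Type*} [Fintype A] (a : A → ℝ) (i : A) : ℝ :=
  if ∑ j, a j = 0 then 1 / (Fintype.card A : ℝ) else a i / ∑ j, a j

lemma normalize_mem_stdSimplex {A : Type*} [Fintype A] [Nonempty A] {a : A → ℝ}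
    (ha : ∀ i, 0 ≤ a i) : normalize a ∈ stdSimplex ℝ A := by
  unfold normalize
  by_cases h : ∑ j, a j = 0
  · simp only [if_pos h]
    refine ⟨fun i => by positivity, ?_⟩
    have : (Fintype.card A : ℝ) ≠ 0 := by exact_mod_cast Fintype.card_ne_zero
    simp [this]
  · simp only [if_neg h]
    exact ⟨fun i => div_nonneg (ha i) (Finset.sum_nonneg fun j _ => ha j), by
      rw [← Finset.sum_div, div_self h]⟩

lemma normalize_of_pos {A : Type*} [Fintype A] {a : A → ℝ} (ha : ∀ i, 0 ≤ a i) {i : A}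
    (hi : 0 < a i) : 0 < normalize a i ∧
      Real.log (normalize a i) = Real.log (a i) - Real.log (∑ j, a j) := by
  have h : 0 < ∑ j, a j := hi.trans_le (Finset.single_le_sum (fun j _ => ha j) (Finset.mem_univ i))
  unfold normalize
  rw [if_neg h.ne']
  exact ⟨div_pos hi h, Real.log_div hi.ne' h.ne'⟩

variable {X Y Z Xh U : Type*} [Fintype X] [Fintype Y] [Fintype Z] [Fintype Xh] [Fintype U]
  {PX : X → ℝ} {PYX : X → Y → ℝ} {PZX : X → Z → ℝ} {d : X → Xh → ℝ}
  {Q : X × Y × Z × U × Xh → ℝ}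

/-- The conditional law of `U` given `Y`. -/
noncomputable def condU (Q : X × Y × Z × U × Xh → ℝ) (u : U) (y : Y) : ℝ :=
  normalize (fun u => law Q (fun s => (s.2.1, s.2.2.2.1)) (y, u)) u

/-- The conditional law of `X̂` given `(Z, U)`. -/
noncomputable def condXh (Q : X × Y × Z × U × Xh → ℝ) (u : U) (z : Z) : Xh → ℝ :=
  normalize fun xh => law Q (fun s => (s.2.2.1, s.2.2.2.1, s.2.2.2.2)) (z, u, xh)

lemma isTestChannel_condU [Nonempty U] (hQ : ∀ t, 0 ≤ Q t) : IsTestChannel (condU Q) where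
  nonneg u _ := (normalize_mem_stdSimplex fun _ => law_nonneg hQ _ _).1 u
  sum_eq_one _ := (normalize_mem_stdSimplex fun _ => law_nonneg hQ _ _).2

lemma condXh_mem_stdSimplex [Nonempty Xh] (hQ : ∀ t, 0 ≤ Q t) (u : U) (z : Z) :
    condXh Q u z ∈ stdSimplex ℝ Xh :=
  normalize_mem_stdSimplex fun _ => law_nonneg hQ _ _

/-- The kernels built from `Q` itself turn the Markov term into a log-likelihood ratio against a
probability law, so its mean is a relative entropy. -/
lemma markovTerm_eq_log_sub (hPX : PX ∈ stdSimplex ℝ X) (hPYX : ∀ x, PYX x ∈ stdSimplex ℝ Y)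
    (hPZX : ∀ x, PZX x ∈ stdSimplex ℝ Z) (hQ : ∀ t, 0 ≤ Q t)
    {t : X × Y × Z × U × Xh} (ht : 0 < Q t)
    (hP : jointXYZ PX PYX PZX (t.1, t.2.1, t.2.2.1) ≠ 0) :
    0 < productLaw PX PYX PZX (condU Q) (condXh Q) t ∧ markovTerm PX PYX PZX Q t =
      Real.log (Q t) - Real.log (productLaw PX PYX PZX (condU Q) (condXh Q) t) := by
  have hP := (jointXYZ_nonneg hPX hPYX hPZX (t.1, t.2.1, t.2.2.1)).lt_of_ne' hP
  obtain ⟨h1, h2⟩ := normalize_of_pos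
    (a := fun u => law Q (fun s => (s.2.1, s.2.2.2.1)) (t.2.1, u))
    (fun _ => law_nonneg hQ _ _) (ht.trans_le (le_law hQ (fun s => (s.2.1, s.2.2.2.1)) t))
  obtain ⟨h3, h4⟩ := normalize_of_pos
    (a := fun xh => law Q (fun s => (s.2.2.1, s.2.2.2.1, s.2.2.2.2)) (t.2.2.1, t.2.2.2.1, xh))
    (fun _ => law_nonneg hQ _ _)
    (ht.trans_le (le_law hQ (fun s => (s.2.2.1, s.2.2.2.1, s.2.2.2.2)) t))
  rw [sum_law (f := fun s => s.2.1) (g := fun s => s.2.2.2.1) (a := t.2.1) Q (by simp)] at h2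
  rw [sum_law (f := fun s => (s.2.2.1, s.2.2.2.1)) (g := fun s => s.2.2.2.2)
    (a := (t.2.2.1, t.2.2.2.1)) Q (by simp [and_assoc])] at h4
  have h5 : productLaw PX PYX PZX (condU Q) (condXh Q) t =
    jointXYZ PX PYX PZX (t.1, t.2.1, t.2.2.1) * condU Q t.2.2.2.1 t.2.1 *
      condXh Q t.2.2.2.1 t.2.2.1 t.2.2.2.2 := rfl
  rw [h5, condU, condXh]
  refine ⟨mul_pos (mul_pos hP h1) h3, ?_⟩
  rw [Real.log_mul (mul_pos hP h1).ne' h3.ne', Real.log_mul hP.ne' h1.ne', h2, h4,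
    markovTerm]
  ring

lemma sum_mul_markovTerm_eq (hPX : PX ∈ stdSimplex ℝ X) (hPYX : ∀ x, PYX x ∈ stdSimplex ℝ Y)
    (hPZX : ∀ x, PZX x ∈ stdSimplex ℝ Z) (hQ : ∀ t, 0 ≤ Q t)
    (hac : ∀ t, 0 < Q t → jointXYZ PX PYX PZX (t.1, t.2.1, t.2.2.1) ≠ 0) :
    ∑ t, Q t * markovTerm PX PYX PZX Q t = ∑ t, Q t *
      (Real.log (Q t) - Real.log (productLaw PX PYX PZX (condU Q) (condXh Q) t)) := by
  refine Finset.sum_congr rfl fun t _ => ?_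
  rcases (hQ t).eq_or_lt with h | h
  · rw [← h]; simp
  · rw [(markovTerm_eq_log_sub hPX hPYX hPZX hQ h (hac t h)).2]

variable [Nonempty Xh] [Nonempty U]

lemma sum_mul_markovTerm_nonneg (hPX : PX ∈ stdSimplex ℝ X) (hPYX : ∀ x, PYX x ∈ stdSimplex ℝ Y)
    (hPZX : ∀ x, PZX x ∈ stdSimplex ℝ Z) (hQ : Q ∈ stdSimplex ℝ (X × Y × Z × U × Xh))
    (hac : ∀ t, 0 < Q t → jointXYZ PX PYX PZX (t.1, t.2.1, t.2.2.1) ≠ 0) :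
    0 ≤ ∑ t, Q t * markovTerm PX PYX PZX Q t := by
  rw [sum_mul_markovTerm_eq hPX hPYX hPZX hQ.1 hac]
  exact gibbs_nonneg hQ (productLaw_mem_stdSimplex hPX hPYX hPZX (isTestChannel_condU hQ.1)
    (condXh_mem_stdSimplex hQ.1))
    fun t ht => (markovTerm_eq_log_sub hPX hPYX hPZX hQ.1 ht (hac t ht)).1

lemma eq_productLaw_of_sum_markovTerm_nonpos (hPX : PX ∈ stdSimplex ℝ X)
    (hPYX : ∀ x, PYX x ∈ stdSimplex ℝ Y) (hPZX : ∀ x, PZX x ∈ stdSimplex ℝ Z)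
    (hQ : Q ∈ stdSimplex ℝ (X × Y × Z × U × Xh))
    (hac : ∀ t, 0 < Q t → jointXYZ PX PYX PZX (t.1, t.2.1, t.2.2.1) ≠ 0)
    (h : ∑ t, Q t * markovTerm PX PYX PZX Q t ≤ 0) :
    Q = productLaw PX PYX PZX (condU Q) (condXh Q) := by
  rw [sum_mul_markovTerm_eq hPX hPYX hPZX hQ.1 hac] at h
  exact eq_of_gibbs_nonpos hQ (productLaw_mem_stdSimplex hPX hPYX hPZX
    (isTestChannel_condU hQ.1) (condXh_mem_stdSimplex hQ.1))
    (fun t ht => (markovTerm_eq_log_sub hPX hPYX hPZX hQ.1 ht (hac t ht)).1) h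

end Markov

/-! ### Positivity of the exponent function outside the region -/

section NearMinimizers

variable {X Y Z Xh : Type*} [Fintype X] [Fintype Y] [Fintype Z] [Fintype Xh]
  {PX : X → ℝ} {PYX : X → Y → ℝ} {PZX : X → Z → ℝ} {d : X → Xh → ℝ}

lemma sqrt_mul_log_nonpos {q : ℝ} (hq1 : q ≤ 1) : √q * Real.log √q ≤ 0 :=
  mul_nonpos_of_nonneg_of_nonpos (Real.sqrt_nonneg q)
    (Real.log_nonpos (Real.sqrt_nonneg q) (Real.sqrt_le_one.2 hq1))

/-- Strictness of the bound on the infimum supplies an actual `Q`; the exponential is linearized by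
`1 - c ≤ exp (-c)`. -/
lemma exists_one_sub_le_expSum (hPX : PX ∈ stdSimplex ℝ X) (hPYX : ∀ x, PYX x ∈ stdSimplex ℝ Y)
    (hPZX : ∀ x, PZX x ∈ stdSimplex ℝ Z) {α μ β θ c : ℝ} (hα : 0 ≤ α)
    (hμ : μ ∈ Set.Icc (0 : ℝ) 1) (hβ : β ∈ Set.Icc (0 : ℝ) 1) (hθ : 0 < θ)
    (h : OmegaMin PX PYX PZX d α μ β θ < (c : EReal)) :
    ∃ k ≤ Fintype.card X * Fintype.card Y * Fintype.card Z * Fintype.card Xh,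
      ∃ Q ∈ stdSimplex ℝ (X × Y × Z × Fin k × Xh), 1 - c ≤ expSum PX PYX PZX d α μ β θ Q := by
  simp only [OmegaMin, iInf_lt_iff] at h
  obtain ⟨k, hk, Q, hQ, hlt⟩ := h
  have h1 := (OmegaQ_le_coe_iff hPX hPYX hPZX hQ.1 hα hμ hβ hθ c).1 hlt.le
  exact ⟨k, hk, Q, hQ, by linarith [Real.add_one_le_exp (-c)]⟩

/-- The limit `θ → 0`. -/
lemma exists_sum_mul_omega_le (hPX : PX ∈ stdSimplex ℝ X) (hPYX : ∀ x, PYX x ∈ stdSimplex ℝ Y)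
    (hPZX : ∀ x, PZX x ∈ stdSimplex ℝ Z) (hd : ∀ x xh, 0 ≤ d x xh) {α μ β r : ℝ} (hα : 0 ≤ α)
    (hμ : μ ∈ Set.Icc (0 : ℝ) 1) (hβ : β ∈ Set.Icc (0 : ℝ) 1)
    (h : ∀ θ, 0 < θ → OmegaMin PX PYX PZX d α μ β θ < ((θ * r : ℝ) : EReal)) :
    ∃ k ≤ Fintype.card X * Fintype.card Y * Fintype.card Z * Fintype.card Xh,
      ∃ Q ∈ stdSimplex ℝ (X × Y × Z × Fin k × Xh),
        (∀ t, 0 < Q t → jointXYZ PX PYX PZX (t.1, t.2.1, t.2.2.1) ≠ 0) ∧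
        ∑ t, Q t * (markovTerm PX PYX PZX Q t + α * rateTerm PX PYX PZX d μ β Q t) ≤ r := by
  let θ : ℕ → ℝ := fun n => 1 / ((n : ℝ) + 1)
  have hθ : ∀ n, 0 < θ n := fun n => Nat.one_div_pos_of_nat
  obtain ⟨k, hk, φ, hφ, Q, hQ, hS, Q0, hQ0, hlim⟩ := exists_subseq_stdSimplex
    (S := fun n k (Q : X × Y × Z × Fin k × Xh → ℝ) =>
      1 - θ n * r ≤ expSum PX PYX PZX d α μ β (θ n) Q)
    fun n => exists_one_sub_le_expSum hPX hPYX hPZX hα hμ hβ (hθ n) (h _ (hθ n))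
  have hθ0 : Tendsto (fun n => θ (φ n)) atTop (𝓝 0) :=
    (tendsto_one_div_add_atTop_nhds_zero_nat (𝕜 := ℝ)).comp hφ
  have hsmall : ∀ᶠ n in atTop, θ (φ n) * (1 + 3 * α) ≤ 1 / 2 := by
    have h1 : Tendsto (fun n => θ (φ n) * (1 + 3 * α)) atTop (𝓝 (0 * (1 + 3 * α))) :=
      hθ0.mul_const _
    rw [zero_mul] at h1
    exact h1.eventually (Iic_mem_nhds (by norm_num))
  have happly : ∀ t, Tendsto (fun n => Q n t) atTop (𝓝 (Q0 t)) := tendsto_pi_nhds.1 hlim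
  -- Mass of `Q` outside the support of P_XYZ contributes nothing to `expSum`. Since `expSum` is at
  -- least 1 - θr and exceeds the supported mass by O(θ) at most, the limit has no mass outside.
  have hac : ∀ t, 0 < Q0 t → jointXYZ PX PYX PZX (t.1, t.2.1, t.2.2.1) ≠ 0 := by
    set B : ℝ := Fintype.card (X × Y × Z × Fin k × Xh) * ((1 + 3 * α) * 2) with hB
    have hle : 1 ≤ ∑ t, if jointXYZ PX PYX PZX (t.1, t.2.1, t.2.2.1) = 0 then 0 else Q0 t := by
      have h1 : Tendsto (fun n => 1 - θ (φ n) * r - θ (φ n) * B) atTop (𝓝 (1 - 0 * r - 0 * B)) :=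
        (tendsto_const_nhds.sub (hθ0.mul_const r)).sub (hθ0.mul_const B)
      simp only [zero_mul, sub_zero] at h1
      refine le_of_tendsto_of_tendsto h1 (tendsto_finsetSum (f := fun t n =>
        if jointXYZ PX PYX PZX (t.1, t.2.1, t.2.2.1) = 0 then 0 else Q n t) _ fun t _ => ?_) ?_
      · split_ifs
        · exact tendsto_const_nhds
        · exact happly t
      · filter_upwards [hsmall] with n hn
        have h2 := expSum_add_le (PX := PX) (PYX := PYX) (PZX := PZX) (d := d) (hQ n).1 α μ β
          (θ (φ n))
        have h3 := mul_le_mul_of_nonneg_left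
          (le_tiltSum hPX hPYX hPZX hd (hQ n) hα hμ hβ (hθ (φ n)).le hn) (hθ (φ n)).le
        have h4 := hS n
        linarith
    intro t ht h0
    have hlt : (∑ t, if jointXYZ PX PYX PZX (t.1, t.2.1, t.2.2.1) = 0 then 0 else Q0 t) <
        ∑ t, Q0 t := Finset.sum_lt_sum (fun s _ => by split_ifs <;> simp [hQ0.1 s])
      ⟨t, Finset.mem_univ t, by rwa [if_pos h0]⟩
    rw [hQ0.2] at hlt
    linarith
  refine ⟨k, hk, Q0, hQ0, hac, ?_⟩
  -- The sums are `tiltSum`, at most `r`; their exponential factors tend to one on the support of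
  -- the limit.
  refine sum_le_of_tendsto hlim (C := 1 + 3 * α) (f := fun n t =>
    if jointXYZ PX PYX PZX (t.1, t.2.1, t.2.2.1) = 0 then 0 else Q n t *
      ((markovTerm PX PYX PZX (Q n) t + α * rateTerm PX PYX PZX d μ β (Q n) t) *
      Real.exp (-(θ (φ n) *
        (markovTerm PX PYX PZX (Q n) t + α * rateTerm PX PYX PZX d μ β (Q n) t)))))
    ?_ (fun t ht => ?_) (fun t ht => by rw [ht, zero_mul]) tendsto_const_nhds
    (Eventually.of_forall fun n => ?_)
  · filter_upwards [hsmall] with n hn t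
    split_ifs
    · exact mul_nonpos_of_nonneg_of_nonpos (by linarith)
        (mul_nonpos_of_nonneg_of_nonpos zero_le_two (sqrt_mul_log_nonpos (apply_le_one (hQ n) t)))
    · exact mul_log_le_mul_exp ((hQ n).1 t) (apply_le_one (hQ n) t) (by linarith) (hθ _).le hn
        fun hpos => log_le_omega hPX hPYX hPZX hd (hQ n) hα hμ hβ hpos
  · have hpos := (hQ0.1 t).lt_of_ne' ht
    simp only [if_neg (hac t hpos)]
    have h1 : Tendsto (fun n => markovTerm PX PYX PZX (Q n) t +
        α * rateTerm PX PYX PZX d μ β (Q n) t) atTop (𝓝 (markovTerm PX PYX PZX Q0 t +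
        α * rateTerm PX PYX PZX d μ β Q0 t)) :=
      ((continuousAt_markovTerm hQ0.1 hpos).tendsto.comp hlim).add
        (((continuousAt_rateTerm hQ0.1 μ β hpos).tendsto.comp hlim).const_mul α)
    have h2 := (happly t).mul (h1.mul ((Real.continuous_exp.tendsto _).comp (hθ0.mul h1).neg))
    simpa using h2
  · have h1 := expSum_add_le (PX := PX) (PYX := PYX) (PZX := PZX) (d := d) (hQ n).1 α μ β
      (θ (φ n))
    have h2 := sum_support_le_one (PX := PX) (PYX := PYX) (PZX := PZX) (hQ n)
    have h3 : θ (φ n) * tiltSum PX PYX PZX d α μ β (θ (φ n)) (Q n) ≤ θ (φ n) * r := by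
      linarith [hS n]
    exact le_of_mul_le_mul_left h3 (hθ _)

lemma nonempty_fin_of_mem_stdSimplex {k : ℕ} {Q : X × Y × Z × Fin k × Xh → ℝ}
    (hQ : Q ∈ stdSimplex ℝ (X × Y × Z × Fin k × Xh)) : Nonempty (Fin k) :=
  (nonempty_of_mem_stdSimplex hQ).map fun t => t.2.2.2.1

lemma le_sum_mul_of_log_le {T : Type*} [Fintype T] {Q s : T → ℝ} (hQ : Q ∈ stdSimplex ℝ T)
    {C : ℝ} (hC : 0 ≤ C) (hs : ∀ t, 0 < Q t → C * Real.log (Q t) ≤ s t) (t : T) :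
    C * (2 * (√(Q t) * Real.log √(Q t))) ≤ Q t * s t := by
  simpa using mul_log_le_mul_exp (hQ.1 t) (apply_le_one hQ t) hC le_rfl (by simp) (hs t)

/-- The limit `α → 0`. -/
lemma exists_markov_sum_mul_rateTerm_le [Nonempty Xh] (hPX : PX ∈ stdSimplex ℝ X)
    (hPYX : ∀ x, PYX x ∈ stdSimplex ℝ Y)
    (hPZX : ∀ x, PZX x ∈ stdSimplex ℝ Z) (hd : ∀ x xh, 0 ≤ d x xh) {μ β r : ℝ}
    (hμ : μ ∈ Set.Icc (0 : ℝ) 1) (hβ : β ∈ Set.Icc (0 : ℝ) 1)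
    (h : ∀ α, 0 < α → ∀ θ, 0 < θ →
      OmegaMin PX PYX PZX d α μ β θ < ((θ * (α * r) : ℝ) : EReal)) :
    ∃ (k : ℕ), ∃ Q ∈ stdSimplex ℝ (X × Y × Z × Fin k × Xh),
        (∀ t, 0 < Q t → jointXYZ PX PYX PZX (t.1, t.2.1, t.2.2.1) ≠ 0) ∧
        ∑ t, Q t * markovTerm PX PYX PZX Q t ≤ 0 ∧
        ∑ t, Q t * rateTerm PX PYX PZX d μ β Q t ≤ r := by
  let α : ℕ → ℝ := fun n => 1 / ((n : ℝ) + 1)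
  have hα : ∀ n, 0 < α n := fun n => Nat.one_div_pos_of_nat
  obtain ⟨k, -, φ, hφ, Q, hQ, hS, Q0, hQ0, hlim⟩ := exists_subseq_stdSimplex
    (S := fun n k (Q : X × Y × Z × Fin k × Xh → ℝ) =>
      (∀ t, 0 < Q t → jointXYZ PX PYX PZX (t.1, t.2.1, t.2.2.1) ≠ 0) ∧
        ∑ t, Q t * (markovTerm PX PYX PZX Q t + α n * rateTerm PX PYX PZX d μ β Q t) ≤ α n * r)
    fun n => exists_sum_mul_omega_le hPX hPYX hPZX hd (hα n).le hμ hβ (h _ (hα n))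
  have hα0 : Tendsto (fun n => α (φ n)) atTop (𝓝 0) :=
    (tendsto_one_div_add_atTop_nhds_zero_nat (𝕜 := ℝ)).comp hφ
  have hsplit : ∀ n, ∑ t, Q n t * markovTerm PX PYX PZX (Q n) t +
      α (φ n) * ∑ t, Q n t * rateTerm PX PYX PZX d μ β (Q n) t ≤ α (φ n) * r := by
    intro n
    refine le_trans (le_of_eq ?_) (hS n).2
    rw [Finset.mul_sum, ← Finset.sum_add_distrib]
    exact Finset.sum_congr rfl fun t _ => by ring
  have hk := nonempty_fin_of_mem_stdSimplex hQ0
  have hmk : ∀ n t, 1 * (2 * (√(Q n t) * Real.log √(Q n t))) ≤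
      Q n t * markovTerm PX PYX PZX (Q n) t := fun n =>
    le_sum_mul_of_log_le (hQ n) zero_le_one fun t ht => by
      rw [one_mul]; exact log_le_markovTerm hPX hPYX hPZX (hQ n).1 ht
  have hrt : ∀ n t, 3 * (2 * (√(Q n t) * Real.log √(Q n t))) ≤
      Q n t * rateTerm PX PYX PZX d μ β (Q n) t := fun n =>
    le_sum_mul_of_log_le (hQ n) zero_le_three fun t ht =>
      log_le_rateTerm hPX hPYX hPZX hd (hQ n) hμ hβ ht
  -- A uniform lower bound for the mean rate term. It forces the mean Markov term below `α * (r -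
  -- B)`, which tends to zero.
  set B : ℝ := ∑ _t : X × Y × Z × Fin k × Xh, (-6 : ℝ) with hB
  have hrB : ∀ n, B ≤ ∑ t, Q n t * rateTerm PX PYX PZX d μ β (Q n) t := fun n =>
    Finset.sum_le_sum fun t _ => by linarith [hrt n t, neg_one_le_sqrt_mul_log (Q n t)]
  have happly : ∀ t, Tendsto (fun n => Q n t) atTop (𝓝 (Q0 t)) := tendsto_pi_nhds.1 hlim
  refine ⟨k, Q0, hQ0, fun t ht => ?_, ?_, ?_⟩
  · obtain ⟨n, hn⟩ := ((happly t).eventually (lt_mem_nhds ht)).exists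
    exact (hS n).1 t hn
  · have hlim0 : Tendsto (fun n => α (φ n) * (r - B)) atTop (𝓝 0) := by
      simpa using hα0.mul_const (r - B)
    refine sum_le_of_tendsto hlim (C := 1) (f := fun n t => Q n t * markovTerm PX PYX PZX (Q n) t)
      (Eventually.of_forall hmk) (fun t ht => ?_) (fun t ht => by rw [ht, zero_mul]) hlim0
      (Eventually.of_forall fun n => ?_)
    · exact (happly t).mul ((continuousAt_markovTerm hQ0.1
        ((hQ0.1 t).lt_of_ne' ht)).tendsto.comp hlim)
    · have := mul_le_mul_of_nonneg_left (hrB n) (hα (φ n)).le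
      linarith [hsplit n]
  · refine sum_le_of_tendsto hlim (C := 3)
      (f := fun n t => Q n t * rateTerm PX PYX PZX d μ β (Q n) t)
      (Eventually.of_forall hrt) (fun t ht => ?_) (fun t ht => by rw [ht, zero_mul])
      tendsto_const_nhds (Eventually.of_forall fun n => ?_)
    · exact (happly t).mul ((continuousAt_rateTerm hQ0.1 μ β
        ((hQ0.1 t).lt_of_ne' ht)).tendsto.comp hlim)
    · have h1 := sum_mul_markovTerm_nonneg hPX hPYX hPZX (hQ n) (hS n).1
      exact le_of_mul_le_mul_left (show α (φ n) * _ ≤ α (φ n) * r by linarith [hsplit n])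
        (hα (φ n))

/-- The limit law has zero relative entropy from its Markov version, so it equals a test channel
followed by a randomized decoder. Its mean rate term dominates the Lagrangian of the best
deterministic decoder. The extra `δ` makes the hypothesis strict, as needed to select
near-minimizers. -/
theorem exists_lagrangian_le_of_OmegaMin_le [Nonempty Xh] (hPX : PX ∈ stdSimplex ℝ X)
    (hPYX : ∀ x, PYX x ∈ stdSimplex ℝ Y)
    (hPZX : ∀ x, PZX x ∈ stdSimplex ℝ Z) (hd : ∀ x xh, 0 ≤ d x xh) {μ β r : ℝ}
    (hμ : μ ∈ Set.Icc (0 : ℝ) 1) (hβ : β ∈ Set.Icc (0 : ℝ) 1)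
    (h : ∀ α, 0 < α → ∀ θ, 0 < θ →
      OmegaMin PX PYX PZX d α μ β θ ≤ ((θ * α * r : ℝ) : EReal)) {δ : ℝ} (hδ : 0 < δ) :
    ∃ (k : ℕ) (V : Fin k → Y → ℝ) (φ : Fin k → Z → Xh), IsTestChannel V ∧
      lagrangian (pairYZ PX PYX PZX) (condDist PX PYX PZX d) μ β V φ ≤ r + δ := by
  obtain ⟨k, Q, hQ, hac, hm, hr⟩ := exists_markov_sum_mul_rateTerm_le (r := r + δ) hPX hPYX hPZX
    hd hμ hβ fun α hα θ hθ => (h α hα θ hθ).trans_lt (EReal.coe_lt_coe_iff.2 (by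
      rw [mul_assoc]
      exact mul_lt_mul_of_pos_left (mul_lt_mul_of_pos_left (by linarith) hα) hθ))
  have hk := nonempty_fin_of_mem_stdSimplex hQ
  have hV := isTestChannel_condU hQ.1
  have heq := eq_productLaw_of_sum_markovTerm_nonpos hPX hPYX hPZX hQ hac hm
  obtain ⟨φ, hφ⟩ := exists_lagrangian_le_productLaw (d := d) hPX hPYX hPZX hV
    (condXh_mem_stdSimplex hQ.1) β hμ.1
  rw [← heq] at hφ
  exact ⟨k, condU Q, φ, hV, hφ.trans hr⟩

end NearMinimizers

end ContentId

theorem mainTheorem2 {X Y Z Xh : Type*} [Fintype X] [Fintype Y] [Fintype Z] [Fintype Xh]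
    [Nonempty Xh]
    (PX : X → ℝ) (hPX : PX ∈ stdSimplex ℝ X)
    (PYX : X → Y → ℝ) (hPYX : ∀ x, PYX x ∈ stdSimplex ℝ Y)
    (PZX : X → Z → ℝ) (hPZX : ∀ x, PZX x ∈ stdSimplex ℝ Z)
    (d : X → Xh → ℝ) (hd : ∀ x xh, 0 ≤ d x xh)
    (Ri Rc D : ℝ) (hRi : 0 ≤ Ri) :
    ((Ri, Rc, D) ∉ ContentId.region PX PYX PZX d → 0 < ContentId.F PX PYX PZX d Ri Rc D) ∧
    ((Ri, Rc, D) ∈ ContentId.region PX PYX PZX d → ContentId.F PX PYX PZX d Ri Rc D = 0) := by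
  refine ⟨fun hout => ?_, fun hin => le_antisymm ?_
    (ContentId.F_nonneg hPX hPYX hPZX hd Ri Rc D)⟩
  · by_contra! hF
    refine hout (ContentId.mem_region_of_lagrangian_le hPX hPYX hPZX hRi fun μ hμ β hβ δ hδ => ?_)
    exact ContentId.exists_lagrangian_le_of_OmegaMin_le hPX hPYX hPZX hd hμ hβ
      (fun α hα θ hθ => (ContentId.Fparam_nonpos_iff hα hμ hβ hθ Ri Rc D).1
        ((ContentId.Fparam_le_F hα hμ hβ hθ Ri Rc D).trans hF)) hδ
  · refine iSup₂_le fun α hα => iSup₂_le fun θ hθ => iSup₂_le fun μ hμ => iSup₂_le fun β hβ =>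
      (ContentId.Fparam_nonpos_iff hα hμ hβ hθ Ri Rc D).2
        (EReal.le_of_forall_lt_iff_le.1 fun z hz => ?_)
    have hz' := EReal.coe_lt_coe_iff.1 hz
    have hθα : 0 < θ * α := mul_pos hθ hα
    -- The tolerance on the Lagrangian is scaled by 1 / (θα), so that the resulting bound on Ω is
    -- exactly `z`.
    obtain ⟨k, V, φ, hV, hle⟩ := ContentId.exists_lagrangian_le_of_mem_region hPX hPYX hPZX hin
      hμ hβ (δ := (z - θ * α * ((1 - μ) * ((1 - β) * Rc - Ri) + μ * D)) / (θ * α))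
      (div_pos (by linarith) hθα)
    refine (ContentId.OmegaMin_le_of_lagrangian_le hPX hPYX hPZX hα hμ hβ hθ hV φ hle).trans
      (le_of_eq ?_)
    rw [mul_add, mul_div_cancel₀ _ hθα.ne']
    congr 1
    ring
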